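/- Let $d\ge 1$ and $\alpha>1$, and let $\Psi$ be a stationary Poisson process on $\mathbb R^d$ with intensity $\alpha$, regarded as a random locally finite subset of $\mathbb R^d$. For locally finite sets $\varphi,\psi\subset\mathbb R^d$ let $\tau(\varphi,\psi,\cdot)$ be the mutual nearest neighbour matching: in each round, a still unmatched $p\in\varphi$ and a still unmatched $q\in\psi$ are matched to each other if $q$ is the lexicographically smallest among the points nearest to $p$ in the set of unmatched points of $\psi$, and $p$ is the lexicographically largest among the points nearest to $q$ in the set of unmatched points of $\varphi$; all pairs matched in a round are then removed and the procedure is iterated over the rounds $1,2,3,\dots$. For $x\in\varphi\cup\psi$ let $\tau(\varphi,\psi,x)$ be the partner of $x$, or $\infty$ if $x$ is never matched, and put $\tau(\varphi,\psi,x):=x$ for $x\notin\varphi\cup\psi$. Let $M(\varphi,\psi,x):=\mathbf 1\{\tau(\varphi,\psi,x)\in\varphi\cup\psi\}$ be the matching status of $x$. For $x,y\in\mathbb R^d$ put $$\rho_1(x):=\alpha\,\mathbb E\,M(\Psi\cup\{x\},\mathbb Z^d,x),\qquad \rho_2(x,y):=\alpha^2\,\mathbb E\big[M(\Psi\cup\{x,y\},\mathbb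 Z^d,x)\,M(\Psi\cup\{x,y\},\mathbb Z^d,y)\big];$$ by the Mecke formulas these are an intensity function and a second order correlation function of the set of points of $\Psi$ that are matched to $\mathbb Z^d$. Then there exists a constant $a_1>0$, depending only on $d$ and $\alpha$, such that $$|\rho_2(x,y)-\rho_1(x)\rho_1(y)|\le a_1\exp\!\big(-a_1^{-1}\|x-y\|^{d/(2d+1)}\big)\qquad\text{for all }x,y\in\mathbb R^d,$$ where $\|\cdot\|$ is the Euclidean norm. -/

import Mathlib

open MeasureTheory ProbabilityTheory

/-- Euclidean space `ℝ^d` (with the Euclidean norm). -/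
abbrev E (d : ℕ) : Type := EuclideanSpace ℝ (Fin d)

/-- The (non-strict) lexicographic order on `ℝ^d`. -/
def LexLE {d : ℕ} (x y : E d) : Prop :=
  toLex (fun i : Fin d => x i) ≤ toLex (fun i : Fin d => y i)

/-- The lattice `ℤ^d ⊂ ℝ^d`. -/
def integerLattice (d : ℕ) : Set (E d) :=
  {x | ∀ i : Fin d, ∃ n : ℤ, x i = (n : ℝ)}

/-- A set is locally finite if each bounded set contains only finitely many of its points. -/
def IsLocallyFinite {d : ℕ} (φ : Set (E d)) : Prop :=
  ∀ B : Set (E d), Bornology.IsBounded B → (φ ∩ B).Finite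

/-- `p` is a nearest neighbour of `x` in `φ`. -/
def IsNearest {d : ℕ} (φ : Set (E d)) (x p : E d) : Prop :=
  p ∈ φ ∧ ∀ q ∈ φ, ‖x - p‖ ≤ ‖x - q‖

/-- `p = N⁻(φ, x)`: the lexicographically smallest nearest neighbour of `x` in `φ`. -/
def IsNearestMin {d : ℕ} (φ : Set (E d)) (x p : E d) : Prop :=
  IsNearest φ x p ∧ ∀ q, IsNearest φ x q → LexLE p q

/-- `p = N⁺(φ, x)`: the lexicographically largest nearest neighbour of `x` in `φ`. -/
def IsNearestMax {d : ℕ} (φ : Set (E d)) (x p : E d) : Prop :=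
  IsNearest φ x p ∧ ∀ q, IsNearest φ x q → LexLE q p

/-- The point `p` of `φ` and the point `q` of `ψ` are mutual nearest neighbours:
`N⁻(ψ, p) = q` and `N⁺(φ, q) = p`. -/
def IsMutualNearest {d : ℕ} (φ ψ : Set (E d)) (p q : E d) : Prop :=
  IsNearestMin ψ p q ∧ IsNearestMax φ q p

open Classical in
/-- One round `τ₁(φ, ψ, x)` of the matching algorithm: the mutual nearest neighbour of `x`
(unique if it exists), where `x` may belong to `φ` or to `ψ`; the value is `∞` if there
is none. -/
noncomputable def matchStep {d : ℕ} (φ ψ : Set (E d)) (x : E d) : OnePoint (E d) :=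
  if h : ∃ y, IsMutualNearest φ ψ x y ∨ IsMutualNearest φ ψ y x then
    ((h.choose : E d) : OnePoint (E d))
  else OnePoint.infty

/-- The pair `(φ_n, ψ_n)` of the sets of points that are not matched in the first `n` rounds;
round `n + 1` applies `matchStep` to this pair. -/
noncomputable def unmatched {d : ℕ} (φ ψ : Set (E d)) : ℕ → Set (E d) × Set (E d)
  | 0 => (φ, ψ)
  | n + 1 =>
    ({x ∈ (unmatched φ ψ n).1 |
        ∀ y ∈ (unmatched φ ψ n).2,
          matchStep (unmatched φ ψ n).1 (unmatched φ ψ n).2 x ≠ (y : OnePoint (E d))},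
     {x ∈ (unmatched φ ψ n).2 |
        ∀ y ∈ (unmatched φ ψ n).1,
          matchStep (unmatched φ ψ n).1 (unmatched φ ψ n).2 x ≠ (y : OnePoint (E d))})

/-- `x` is matched in round `n + 1`, that is,
`x ∈ (φ_n \ φ_{n+1}) ∪ (ψ_n \ ψ_{n+1})`. -/
def MatchedAt {d : ℕ} (φ ψ : Set (E d)) (x : E d) (n : ℕ) : Prop :=
  x ∈ ((unmatched φ ψ n).1 \ (unmatched φ ψ (n + 1)).1) ∪
    ((unmatched φ ψ n).2 \ (unmatched φ ψ (n + 1)).2)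

open Classical in
/-- The mutual nearest neighbour matching `τ(φ, ψ, x)`. A point of `φ ∪ ψ` is sent to its
partner in the round in which it is matched, and to `∞` if it is never matched; all other
points are sent to themselves. -/
noncomputable def tau {d : ℕ} (φ ψ : Set (E d)) (x : E d) : OnePoint (E d) :=
  if x ∈ φ ∪ ψ then
    if h : ∃ n, MatchedAt φ ψ x n then
      matchStep (unmatched φ ψ (Nat.find h)).1 (unmatched φ ψ (Nat.find h)).2 x
    else OnePoint.infty
  else (x : OnePoint (E d))

open Classical in
/-- The matching status `M(φ, ψ, x) = 𝟙{τ(φ, ψ, x) ∈ φ ∪ ψ}`. -/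
noncomputable def matchingStatus {d : ℕ} (φ ψ : Set (E d)) (x : E d) : ℝ :=
  if ∃ y ∈ φ ∪ ψ, tau φ ψ x = (y : OnePoint (E d)) then 1 else 0

/-- `Ψ` is a (simple, stationary) Poisson process on `ℝ^d` with intensity `α`: a random
locally finite set such that the number of points in a Borel set of finite volume `v` is
Poisson distributed with parameter `α v`, and such that the numbers of points in pairwise
disjoint Borel sets are independent. -/
structure IsPoissonProcess {d : ℕ} {Ω : Type*} [MeasurableSpace Ω] (P : Measure Ω)
    (α : ℝ) (Ψ : Ω → Set (E d)) : Prop where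
  locallyFinite : ∀ ω, IsLocallyFinite (Ψ ω)
  measurable_count : ∀ B : Set (E d), MeasurableSet B →
    Measurable (fun ω => (Ψ ω ∩ B).encard)
  law_count : ∀ B : Set (E d), MeasurableSet B → volume B ≠ ⊤ →
    P.map (fun ω => (Ψ ω ∩ B).encard) =
      (poissonMeasure (α.toNNReal * (volume B).toNNReal)).map (fun n : ℕ => (n : ℕ∞))
  indep_count : ∀ B : ℕ → Set (E d), (∀ i, MeasurableSet (B i)) →
    Pairwise (Function.onFun Disjoint B) →
    iIndepFun (fun i ω => (Ψ ω ∩ B i).encard) P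

/-- The intensity function `ρ₁(x) = α 𝔼 M(Ψ ∪ {x}, ℤ^d, x)` of the matched points of `Ψ`. -/
noncomputable def rhoOne {d : ℕ} {Ω : Type*} [MeasurableSpace Ω] (P : Measure Ω)
    (α : ℝ) (Ψ : Ω → Set (E d)) (x : E d) : ℝ :=
  α * ∫ ω, matchingStatus (Ψ ω ∪ {x}) (integerLattice d) x ∂P

/-- The second order correlation function
`ρ₂(x, y) = α² 𝔼 [M(Ψ ∪ {x, y}, ℤ^d, x) M(Ψ ∪ {x, y}, ℤ^d, y)]` of the matched points
of `Ψ`. -/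
noncomputable def rhoTwo {d : ℕ} {Ω : Type*} [MeasurableSpace Ω] (P : Measure Ω)
    (α : ℝ) (Ψ : Ω → Set (E d)) (x y : E d) : ℝ :=
  α ^ 2 * ∫ ω, matchingStatus (Ψ ω ∪ {x, y}) (integerLattice d) x *
    matchingStatus (Ψ ω ∪ {x, y}) (integerLattice d) y ∂P

/-! The matching is greedy. Order the pairs of `φ × ψ` by length, with the tie-breaks encoded in
`pairKey`. If there are no infinite descending chains, a pair is matched exactly when no smaller
pair sharing a point with it is matched (`isMatchedPair_iff`). So its fate depends only on the pairs
reached from it by descending chains (`isMatchedPair_congr`). If the pair has length at most `R` and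
loop-erased descending chains have fewer than `n` steps, only points within distance of order `n R`
matter (`isMatchedPair_inter_iff`). Two probabilistic estimates turn this into decorrelation.

Chains (`exists_measure_levelChain_le`): a long chain yields distinct process points whose distances
to a lattice path decrease. Sort these distances into shells of equal volume; monotonicity leaves
only `2 ^ (n + K)` level sequences instead of `K ^ n`. A union bound over paths and levels then
gives probability at most `exp (-n)` as soon as `n ≥ C R ^ (2 d)`. The relevant window therefore has
radius of order `R ^ (2 d + 1)`.

Tails (`exists_measure_not_matchedWithin_le`): a lattice point fails to be matched within `ρ` with
probability at most `2 exp (-c ρ ^ d)`, even after two points are added. If it fails, stability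
forces every process point within `ρ` of it to have a partner within `ρ`. As `α > 1`, these points
typically outnumber the lattice points of a slightly larger ball, so a positive fraction of the
nearby lattice points is matched only beyond distance `L`. Telescoping over geometric scales shows
that for large `L` such points are rare on average (`exists_sum_not_matchedWithin_le`). Replacing
them by finite-range bad points, collected in blocks that are independent within residue classes mod
3, upgrades this to a bound exponential in the volume.

Finally take a scale `N` with `N ^ (2 d + 1)` comparable to `‖x - y‖`. Outside events of probability
of order `exp (-a N ^ d)`, the statuses of `x` and of `y` are decided by the process in two disjoint
balls, hence by independent events, and `N ^ d` is of order `‖x - y‖ ^ (d / (2 d + 1))`. -/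

/-! ## The order on pairs and mutual nearest neighbours -/

/-- The key of a pair `(p, q)`: pairs are compared first by length, then by the lexicographic
order of `q`, then by the reverse lexicographic order of `p`. -/
noncomputable def pairKey {d : ℕ} (e : E d × E d) :
    ℝ ×ₗ (Lex (Fin d → ℝ) ×ₗ (Lex (Fin d → ℝ))ᵒᵈ) :=
  toLex (‖e.1 - e.2‖, toLex (toLex (fun i => e.2 i), OrderDual.toDual (toLex (fun i => e.1 i))))

lemma pairKey_injective {d : ℕ} : Function.Injective (pairKey (d := d)) := by
  rintro ⟨p, q⟩ ⟨p', q'⟩ h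
  simp only [pairKey, EmbeddingLike.apply_eq_iff_eq, Prod.mk.injEq] at h
  obtain ⟨-, h2, h3⟩ := h
  refine Prod.ext ?_ ?_
  · ext i; exact congrFun h3 i
  · ext i; exact congrFun h2 i

lemma pairKey_le_left_iff {d : ℕ} {p q q' : E d} :
    pairKey (p, q) ≤ pairKey (p, q') ↔ ‖p - q‖ < ‖p - q'‖ ∨ (‖p - q‖ = ‖p - q'‖ ∧ LexLE q q') := by
  simp only [pairKey, Prod.Lex.toLex_le_toLex, LexLE]
  refine or_congr Iff.rfl (and_congr Iff.rfl ?_)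
  constructor
  · rintro (h | h)
    · exact h.le
    · exact h.1.le
  · intro h
    rcases h.lt_or_eq with h | h
    · exact Or.inl h
    · exact Or.inr ⟨h, le_rfl⟩

lemma pairKey_le_right_iff {d : ℕ} {p p' q : E d} :
    pairKey (p, q) ≤ pairKey (p', q) ↔ ‖q - p‖ < ‖q - p'‖ ∨ (‖q - p‖ = ‖q - p'‖ ∧ LexLE p' p) := by
  simp only [pairKey, Prod.Lex.toLex_le_toLex, LexLE, norm_sub_rev q]
  refine or_congr Iff.rfl (and_congr Iff.rfl ?_)
  simp only [OrderDual.toDual_le_toDual, true_and]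
  exact or_iff_right (lt_irrefl _)

lemma norm_le_of_pairKey_le {d : ℕ} {e f : E d × E d} (h : pairKey e ≤ pairKey f) :
    ‖e.1 - e.2‖ ≤ ‖f.1 - f.2‖ := by
  simp only [pairKey, Prod.Lex.toLex_le_toLex] at h
  rcases h with h | h
  · exact h.le
  · exact h.1.le

lemma isNearestMin_iff {d : ℕ} {ψ : Set (E d)} {p q : E d} :
    IsNearestMin ψ p q ↔ q ∈ ψ ∧ ∀ q' ∈ ψ,
      ‖p - q‖ < ‖p - q'‖ ∨ (‖p - q‖ = ‖p - q'‖ ∧ LexLE q q') := by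
  constructor
  · rintro ⟨⟨hq, hmin⟩, hlex⟩
    refine ⟨hq, fun q' hq' => ?_⟩
    rcases (hmin q' hq').lt_or_eq with h | h
    · exact Or.inl h
    · exact Or.inr ⟨h, hlex q' ⟨hq', fun q'' hq'' => h ▸ hmin q'' hq''⟩⟩
  · rintro ⟨hq, h⟩
    refine ⟨⟨hq, fun q' hq' => ?_⟩, fun q' hq' => ?_⟩
    · rcases h q' hq' with h | h
      · exact h.le
      · exact h.1.le
    · rcases h q' hq'.1 with h | h
      · exact absurd (hq'.2 q hq) (not_le.2 h)
      · exact h.2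

lemma isNearestMax_iff {d : ℕ} {φ : Set (E d)} {p q : E d} :
    IsNearestMax φ q p ↔ p ∈ φ ∧ ∀ p' ∈ φ,
      ‖q - p‖ < ‖q - p'‖ ∨ (‖q - p‖ = ‖q - p'‖ ∧ LexLE p' p) := by
  constructor
  · rintro ⟨⟨hq, hmin⟩, hlex⟩
    refine ⟨hq, fun q' hq' => ?_⟩
    rcases (hmin q' hq').lt_or_eq with h | h
    · exact Or.inl h
    · exact Or.inr ⟨h, hlex q' ⟨hq', fun q'' hq'' => h ▸ hmin q'' hq''⟩⟩
  · rintro ⟨hq, h⟩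
    refine ⟨⟨hq, fun q' hq' => ?_⟩, fun q' hq' => ?_⟩
    · rcases h q' hq' with h | h
      · exact h.le
      · exact h.1.le
    · rcases h q' hq'.1 with h | h
      · exact absurd (hq'.2 p hq) (not_le.2 h)
      · exact h.2

/-- The key serves both conventions at once: for fixed `p` it prefers the lexicographically smallest
`q`, for fixed `q` the largest `p`. One linear order thus replaces the two nearest neighbour rules.
-/
lemma isMutualNearest_iff {d : ℕ} {φ ψ : Set (E d)} {p q : E d} :
    IsMutualNearest φ ψ p q ↔ p ∈ φ ∧ q ∈ ψ ∧ (∀ q' ∈ ψ, pairKey (p, q) ≤ pairKey (p, q')) ∧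
      ∀ p' ∈ φ, pairKey (p, q) ≤ pairKey (p', q) := by
  simp only [IsMutualNearest, isNearestMin_iff, isNearestMax_iff, pairKey_le_left_iff,
    pairKey_le_right_iff]
  tauto

lemma IsMutualNearest.right_unique {d : ℕ} {φ ψ : Set (E d)} {p q q' : E d}
    (h : IsMutualNearest φ ψ p q) (h' : IsMutualNearest φ ψ p q') : q = q' := by
  rw [isMutualNearest_iff] at h h'
  exact congrArg Prod.snd
    (pairKey_injective (le_antisymm (h.2.2.1 q' h'.2.1) (h'.2.2.1 q h.2.1)))

lemma IsMutualNearest.left_unique {d : ℕ} {φ ψ : Set (E d)} {p p' q : E d}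
    (h : IsMutualNearest φ ψ p q) (h' : IsMutualNearest φ ψ p' q) : p = p' := by
  rw [isMutualNearest_iff] at h h'
  exact congrArg Prod.fst
    (pairKey_injective (le_antisymm (h.2.2.2 p' h'.1) (h'.2.2.2 p h.1)))

/-- A point lying in both sets is its own nearest neighbour at distance zero. Since `φ` and `ψ` may
overlap, this is what settles the ambiguous role of such a point. -/
lemma IsMutualNearest.eq_of_mem_left {d : ℕ} {φ ψ : Set (E d)} {p q : E d}
    (h : IsMutualNearest φ ψ p q) (hq : q ∈ φ) : p = q := by
  have := h.2.1.2 q hq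
  rw [sub_self, norm_zero] at this
  exact (sub_eq_zero.1 (norm_le_zero_iff.1 this)).symm

lemma IsMutualNearest.eq_of_mem_right {d : ℕ} {φ ψ : Set (E d)} {p q : E d}
    (h : IsMutualNearest φ ψ p q) (hp : p ∈ ψ) : p = q := by
  have := h.1.1.2 p hp
  rw [sub_self, norm_zero] at this
  exact sub_eq_zero.1 (norm_le_zero_iff.1 this)

/-! ## The rounds of the matching algorithm -/

/-- `matchStep` looks for a partner without regard to the side of `x`. If the chosen partner has `x`
in the role of a point of `ψ`, then `x ∈ φ` makes it the pair `(x, x)`, which also counts for the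
left role. -/
lemma forall_matchStep_ne_left_iff {d : ℕ} {φ ψ : Set (E d)} {x : E d} (hx : x ∈ φ) :
    (∀ y ∈ ψ, matchStep φ ψ x ≠ (y : OnePoint (E d))) ↔ ¬ ∃ q, IsMutualNearest φ ψ x q := by
  constructor
  · rintro h ⟨q, hq⟩
    have hex : ∃ y, IsMutualNearest φ ψ x y ∨ IsMutualNearest φ ψ y x := ⟨q, Or.inl hq⟩
    have hs : matchStep φ ψ x = ((hex.choose : E d) : OnePoint (E d)) := by
      simp only [matchStep, dif_pos hex]
    refine h hex.choose ?_ hs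
    rcases hex.choose_spec with h1 | h1
    · exact h1.1.1.1
    · have := h1.eq_of_mem_left hx
      rw [this]; exact h1.1.1.1
  · rintro h y hy hs
    by_cases hex : ∃ y, IsMutualNearest φ ψ x y ∨ IsMutualNearest φ ψ y x
    · rcases hex.choose_spec with h1 | h1
      · exact h ⟨_, h1⟩
      · have := h1.eq_of_mem_left hx
        rw [this] at h1
        exact h ⟨_, h1⟩
    · simp [matchStep, dif_neg hex] at hs

lemma forall_matchStep_ne_right_iff {d : ℕ} {φ ψ : Set (E d)} {x : E d} (hx : x ∈ ψ) :
    (∀ y ∈ φ, matchStep φ ψ x ≠ (y : OnePoint (E d))) ↔ ¬ ∃ p, IsMutualNearest φ ψ p x := by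
  constructor
  · rintro h ⟨q, hq⟩
    have hex : ∃ y, IsMutualNearest φ ψ x y ∨ IsMutualNearest φ ψ y x := ⟨q, Or.inr hq⟩
    have hs : matchStep φ ψ x = ((hex.choose : E d) : OnePoint (E d)) := by
      simp only [matchStep, dif_pos hex]
    refine h hex.choose ?_ hs
    rcases hex.choose_spec with h1 | h1
    · have := h1.eq_of_mem_right hx
      rw [← this]; exact h1.2.1.1
    · exact h1.2.1.1
  · rintro h y hy hs
    by_cases hex : ∃ y, IsMutualNearest φ ψ x y ∨ IsMutualNearest φ ψ y x
    · rcases hex.choose_spec with h1 | h1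
      · have := h1.eq_of_mem_right hx
        rw [← this] at h1
        exact h ⟨_, h1⟩
      · exact h ⟨_, h1⟩
    · simp [matchStep, dif_neg hex] at hs

section Rounds

variable {d : ℕ} {φ ψ : Set (E d)}

/-- `p` and `q` are mutual nearest neighbours in round `n + 1`. -/
def MutualAt (φ ψ : Set (E d)) (n : ℕ) (p q : E d) : Prop :=
  IsMutualNearest (unmatched φ ψ n).1 (unmatched φ ψ n).2 p q

/-- `p ∈ φ` and `q ∈ ψ` are matched to each other by the algorithm. -/
def IsMatchedPair (φ ψ : Set (E d)) (p q : E d) : Prop := ∃ n, MutualAt φ ψ n p q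

lemma mem_unmatched_succ_left {n : ℕ} {p : E d} : p ∈ (unmatched φ ψ (n + 1)).1 ↔
    p ∈ (unmatched φ ψ n).1 ∧ ¬ ∃ q, MutualAt φ ψ n p q := by
  simp only [unmatched, Set.mem_ofPred_eq]
  exact and_congr_right fun h => forall_matchStep_ne_left_iff h

lemma mem_unmatched_succ_right {n : ℕ} {q : E d} : q ∈ (unmatched φ ψ (n + 1)).2 ↔
    q ∈ (unmatched φ ψ n).2 ∧ ¬ ∃ p, MutualAt φ ψ n p q := by
  simp only [unmatched, Set.mem_ofPred_eq]
  exact and_congr_right fun h => forall_matchStep_ne_right_iff h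

lemma unmatched_left_anti : Antitone fun n => (unmatched φ ψ n).1 :=
  antitone_nat_of_succ_le fun _ _ h => (mem_unmatched_succ_left.1 h).1

lemma unmatched_right_anti : Antitone fun n => (unmatched φ ψ n).2 :=
  antitone_nat_of_succ_le fun _ _ h => (mem_unmatched_succ_right.1 h).1

lemma unmatched_left_subset (n : ℕ) : (unmatched φ ψ n).1 ⊆ φ :=
  unmatched_left_anti (φ := φ) (ψ := ψ) (Nat.zero_le n)

lemma unmatched_right_subset (n : ℕ) : (unmatched φ ψ n).2 ⊆ ψ :=
  unmatched_right_anti (φ := φ) (ψ := ψ) (Nat.zero_le n)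

lemma MutualAt.mem_left {n : ℕ} {p q : E d} (h : MutualAt φ ψ n p q) :
    p ∈ (unmatched φ ψ n).1 := h.2.1.1

lemma MutualAt.mem_right {n : ℕ} {p q : E d} (h : MutualAt φ ψ n p q) :
    q ∈ (unmatched φ ψ n).2 := h.1.1.1

lemma MutualAt.not_mem_left {n m : ℕ} {p q : E d} (h : MutualAt φ ψ n p q) (hnm : n < m) :
    p ∉ (unmatched φ ψ m).1 := fun hp =>
  (mem_unmatched_succ_left.1 (unmatched_left_anti (φ := φ) (ψ := ψ) hnm hp)).2 ⟨q, h⟩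

lemma MutualAt.not_mem_right {n m : ℕ} {p q : E d} (h : MutualAt φ ψ n p q) (hnm : n < m) :
    q ∉ (unmatched φ ψ m).2 := fun hp =>
  (mem_unmatched_succ_right.1 (unmatched_right_anti (φ := φ) (ψ := ψ) hnm hp)).2 ⟨p, h⟩

lemma exists_mutualAt_of_not_mem_left {p : E d} (hp : p ∈ φ) {n : ℕ}
    (hn : p ∉ (unmatched φ ψ n).1) : ∃ m < n, ∃ q, MutualAt φ ψ m p q := by
  induction n with
  | zero => exact absurd hp hn
  | succ n ih =>
    by_cases h : p ∈ (unmatched φ ψ n).1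
    · rw [mem_unmatched_succ_left] at hn
      push Not at hn
      exact ⟨n, Nat.lt_succ_self n, hn h⟩
    · obtain ⟨m, hm, hq⟩ := ih h
      exact ⟨m, hm.trans (Nat.lt_succ_self n), hq⟩

lemma IsMatchedPair.mem_left {p q : E d} (h : IsMatchedPair φ ψ p q) : p ∈ φ :=
  let ⟨n, hn⟩ := h; unmatched_left_subset n hn.mem_left

lemma IsMatchedPair.mem_right {p q : E d} (h : IsMatchedPair φ ψ p q) : q ∈ ψ :=
  let ⟨n, hn⟩ := h; unmatched_right_subset n hn.mem_right

/-- The earlier of two rounds removes the common point, so both matchings happen in the same round.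
-/
lemma IsMatchedPair.right_unique {p q q' : E d} (h : IsMatchedPair φ ψ p q)
    (h' : IsMatchedPair φ ψ p q') : q = q' := by
  obtain ⟨n, hn⟩ := h
  obtain ⟨m, hm⟩ := h'
  rcases lt_trichotomy n m with hlt | rfl | hlt
  · exact absurd hm.mem_left (hn.not_mem_left hlt)
  · exact IsMutualNearest.right_unique hn hm
  · exact absurd hn.mem_left (hm.not_mem_left hlt)

lemma IsMatchedPair.left_unique {p p' q : E d} (h : IsMatchedPair φ ψ p q)
    (h' : IsMatchedPair φ ψ p' q) : p = p' := by
  obtain ⟨n, hn⟩ := h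
  obtain ⟨m, hm⟩ := h'
  rcases lt_trichotomy n m with hlt | rfl | hlt
  · exact absurd hm.mem_right (hn.not_mem_right hlt)
  · exact IsMutualNearest.left_unique hn hm
  · exact absurd hn.mem_right (hm.not_mem_right hlt)

lemma exists_matchStep_eq {φ ψ : Set (E d)} {x : E d}
    (h : ∃ y, IsMutualNearest φ ψ x y ∨ IsMutualNearest φ ψ y x) :
    ∃ y ∈ φ ∪ ψ, matchStep φ ψ x = (y : OnePoint (E d)) := by
  refine ⟨h.choose, ?_, by simp only [matchStep, dif_pos h]⟩
  rcases h.choose_spec with h1 | h1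
  · exact Or.inr h1.1.1.1
  · exact Or.inl h1.2.1.1

lemma matchedAt_iff {x : E d} {n : ℕ} : MatchedAt φ ψ x n ↔
    ∃ y, MutualAt φ ψ n x y ∨ MutualAt φ ψ n y x := by
  simp only [MatchedAt, Set.mem_union, Set.mem_sdiff, mem_unmatched_succ_left,
    mem_unmatched_succ_right, not_and, not_not]
  constructor
  · rintro (⟨h, h'⟩ | ⟨h, h'⟩)
    · obtain ⟨q, hq⟩ := h' h
      exact ⟨q, Or.inl hq⟩
    · obtain ⟨q, hq⟩ := h' h
      exact ⟨q, Or.inr hq⟩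
  · rintro ⟨y, h | h⟩
    · exact Or.inl ⟨h.mem_left, fun _ => ⟨y, h⟩⟩
    · exact Or.inr ⟨h.mem_right, fun _ => ⟨y, h⟩⟩

open Classical in
lemma matchingStatus_eq {x : E d} (hx : x ∈ φ) :
    matchingStatus φ ψ x = if ∃ q, IsMatchedPair φ ψ x q then 1 else 0 := by
  unfold matchingStatus
  congr 1
  have hx' : x ∈ φ ∪ ψ := Or.inl hx
  simp only [tau, if_pos hx']
  apply propext
  constructor
  · rintro ⟨y, -, hy⟩
    by_cases h : ∃ n, MatchedAt φ ψ x n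
    · obtain ⟨n, hn⟩ := h
      obtain ⟨y, h | h⟩ := matchedAt_iff.1 hn
      · exact ⟨y, n, h⟩
      -- Here `x` is matched as a point of `ψ`. Either it is still present in `φ`, and the pair is
      -- `(x, x)`, or it left `φ` in an earlier round with another partner.
      · by_cases hxn : x ∈ (unmatched φ ψ n).1
        · have := IsMutualNearest.eq_of_mem_left h hxn
          subst this
          exact ⟨y, n, h⟩
        · obtain ⟨m, -, q, hq⟩ := exists_mutualAt_of_not_mem_left hx hxn
          exact ⟨q, m, hq⟩
    · simp [dif_neg h] at hy
  · rintro ⟨q, n, hn⟩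
    have h : ∃ n, MatchedAt φ ψ x n := ⟨n, matchedAt_iff.2 ⟨q, Or.inl hn⟩⟩
    rw [dif_pos h]
    obtain ⟨y, hy, hy'⟩ := exists_matchStep_eq (matchedAt_iff.1 (Nat.find_spec h))
    exact ⟨y, Set.union_subset_union (unmatched_left_subset _) (unmatched_right_subset _) hy, hy'⟩

/-! ## Stability and locality -/

/-- `f` is a pair of `φ × ψ` that precedes `e` and has a point in common with it. -/
def Desc (φ ψ : Set (E d)) (f e : E d × E d) : Prop :=
  f.1 ∈ φ ∧ f.2 ∈ ψ ∧ (f.1 = e.1 ∨ f.2 = e.2) ∧ pairKey f < pairKey e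

lemma Desc.norm_le {e f : E d × E d} (h : Desc φ ψ f e) : ‖f.1 - f.2‖ ≤ ‖e.1 - e.2‖ :=
  norm_le_of_pairKey_le h.2.2.2.le

lemma IsLocallyFinite.mono {φ φ' : Set (E d)} (h : IsLocallyFinite φ) (hs : φ' ⊆ φ) :
    IsLocallyFinite φ' := fun B hB => (h B hB).subset (Set.inter_subset_inter_left _ hs)

lemma finite_setOf_desc (hφ : IsLocallyFinite φ) (hψ : IsLocallyFinite ψ) (e : E d × E d) :
    {f | Desc φ ψ f e}.Finite := by
  have h1 := hφ (Metric.closedBall e.2 ‖e.1 - e.2‖) Metric.isBounded_closedBall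
  have h2 := hψ (Metric.closedBall e.1 ‖e.1 - e.2‖) Metric.isBounded_closedBall
  refine ((h1.prod (Set.finite_singleton e.2)).union
    ((Set.finite_singleton e.1).prod h2)).subset ?_
  rintro ⟨p, q⟩ hf
  have hn := hf.norm_le
  obtain ⟨hp, hq, h | h, -⟩ := hf
  · right
    simp only at h hn
    subst h
    exact ⟨rfl, hq, by rwa [Metric.mem_closedBall, dist_eq_norm, norm_sub_rev]⟩
  · left
    simp only at h hn
    subst h
    exact ⟨⟨hp, by rwa [Metric.mem_closedBall, dist_eq_norm]⟩, rfl⟩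

/-- A matched pair excludes every other pair which has a point in common with it. -/
lemma IsMatchedPair.not_of_desc {e f : E d × E d} (he : IsMatchedPair φ ψ e.1 e.2)
    (h : Desc φ ψ f e) : ¬ IsMatchedPair φ ψ f.1 f.2 := by
  intro hf
  obtain ⟨-, -, hs | hs, hk⟩ := h
  · rw [hs] at hf
    have : f = e := Prod.ext hs (hf.right_unique he)
    exact hk.ne (congrArg _ this)
  · rw [hs] at hf
    have : f = e := Prod.ext (hf.left_unique he) hs
    exact hk.ne (congrArg _ this)

/-- Stability: a pair that is not matched is preceded by a matched pair with which it has a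
point in common. -/
lemma exists_desc_of_not_isMatchedPair (hφ : IsLocallyFinite φ) (hψ : IsLocallyFinite ψ)
    {e : E d × E d} (hacc : Acc (Desc φ ψ) e) :
    e.1 ∈ φ → e.2 ∈ ψ → ¬ IsMatchedPair φ ψ e.1 e.2 →
      ∃ f, Desc φ ψ f e ∧ IsMatchedPair φ ψ f.1 f.2 := by
  induction hacc with
  | intro e _ ih =>
  intro h1 h2 hne
  by_contra! hno
  -- Each preceding pair is unmatched by assumption, so by induction it is blocked by a matched
  -- pair, and the round of that pair removes one of its points.
  have hrem : ∀ f ∈ {f | Desc φ ψ f e}, ∃ n, f.1 ∉ (unmatched φ ψ n).1 ∨ f.2 ∉ (unmatched φ ψ n).2 := by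
    intro f hf
    obtain ⟨g, hg, n, hgn⟩ := ih f hf hf.1 hf.2.1 (hno f hf)
    refine ⟨n + 1, ?_⟩
    rcases hg.2.2.1 with h | h
    · left; rw [← h]; exact MutualAt.not_mem_left hgn (Nat.lt_succ_self n)
    · right; rw [← h]; exact MutualAt.not_mem_right hgn (Nat.lt_succ_self n)
  -- Only finitely many pairs precede `e`, by local finiteness, so one round destroys them all.
  obtain ⟨N, hN⟩ : ∃ N, ∀ f, Desc φ ψ f e →
      f.1 ∉ (unmatched φ ψ N).1 ∨ f.2 ∉ (unmatched φ ψ N).2 := by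
    choose! n hn using hrem
    obtain ⟨N, hN⟩ := ((finite_setOf_desc hφ hψ e).image n).bddAbove
    refine ⟨N, fun f hf => ?_⟩
    have hle : n f ≤ N := hN ⟨f, hf, rfl⟩
    exact (hn f hf).imp (fun h h' => h (unmatched_left_anti (φ := φ) (ψ := ψ) hle h'))
      (fun h h' => h (unmatched_right_anti (φ := φ) (ψ := ψ) hle h'))
  -- the first of the two points to disappear would do so with a preceding pair
  have key : ∀ n, e.1 ∈ (unmatched φ ψ n).1 ∧ e.2 ∈ (unmatched φ ψ n).2 := by
    intro n
    induction n with
    | zero => exact ⟨h1, h2⟩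
    | succ n ihn =>
      constructor
      · rw [mem_unmatched_succ_left]
        refine ⟨ihn.1, ?_⟩
        rintro ⟨q, hq⟩
        have hle := (isMutualNearest_iff.1 hq).2.2.1 e.2 ihn.2
        rcases hle.lt_or_eq with hlt | heq
        · exact hno (e.1, q) ⟨h1, IsMatchedPair.mem_right ⟨n, hq⟩, Or.inl rfl, hlt⟩ ⟨n, hq⟩
        · have := congrArg Prod.snd (pairKey_injective heq)
          simp only at this
          rw [this] at hq
          exact hne ⟨n, hq⟩
      · rw [mem_unmatched_succ_right]
        refine ⟨ihn.2, ?_⟩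
        rintro ⟨p, hp⟩
        have hle := (isMutualNearest_iff.1 hp).2.2.2 e.1 ihn.1
        rcases hle.lt_or_eq with hlt | heq
        · exact hno (p, e.2) ⟨IsMatchedPair.mem_left ⟨n, hp⟩, h2, Or.inr rfl, hlt⟩ ⟨n, hp⟩
        · have := congrArg Prod.fst (pairKey_injective heq)
          simp only at this
          rw [this] at hp
          exact hne ⟨n, hp⟩
  -- Both points of `e` survive to round `N`, when no competing pair is left; hence `e` is a mutual
  -- nearest pair then.
  refine hne ⟨N, isMutualNearest_iff.2 ⟨(key N).1, (key N).2, fun q' hq' => ?_, fun p' hp' => ?_⟩⟩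
  · by_contra! hlt
    have hd : Desc φ ψ (e.1, q') e := ⟨h1, unmatched_right_subset N hq', Or.inl rfl, hlt⟩
    rcases hN _ hd with h | h
    · exact h (key N).1
    · exact h hq'
  · by_contra! hlt
    have hd : Desc φ ψ (p', e.2) e := ⟨unmatched_left_subset N hp', h2, Or.inr rfl, hlt⟩
    rcases hN _ hd with h | h
    · exact h hp'
    · exact h (key N).2

/-- This recursion along the key order no longer mentions rounds. It is the form in which the
matching is compared across configurations. -/
lemma isMatchedPair_iff (hφ : IsLocallyFinite φ) (hψ : IsLocallyFinite ψ) {e : E d × E d}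
    (hacc : Acc (Desc φ ψ) e) (h1 : e.1 ∈ φ) (h2 : e.2 ∈ ψ) :
    IsMatchedPair φ ψ e.1 e.2 ↔ ∀ f, Desc φ ψ f e → ¬ IsMatchedPair φ ψ f.1 f.2 := by
  refine ⟨fun h f hf => h.not_of_desc hf, fun h => ?_⟩
  by_contra hne
  obtain ⟨f, hf, hf'⟩ := exists_desc_of_not_isMatchedPair hφ hψ hacc h1 h2 hne
  exact h f hf hf'

/-- Locality: whether a pair is matched depends only on the pairs that are reached from it by
descending chains. -/
lemma isMatchedPair_congr {φ' : Set (E d)} (hφ : IsLocallyFinite φ) (hφ' : IsLocallyFinite φ')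
    (hψ : IsLocallyFinite ψ) {e : E d × E d} (hacc : Acc (Desc φ ψ) e) :
    e.1 ∈ φ → e.1 ∈ φ' → e.2 ∈ ψ →
    (∀ f, Relation.ReflTransGen (Desc φ ψ) f e → ∀ g, Desc φ ψ g f ↔ Desc φ' ψ g f) →
    Acc (Desc φ' ψ) e ∧ (IsMatchedPair φ ψ e.1 e.2 ↔ IsMatchedPair φ' ψ e.1 e.2) := by
  induction hacc with
  | intro e hacc ih =>
  intro h1 h1' h2 hD
  have hD0 := hD e Relation.ReflTransGen.refl
  have ih' : ∀ f, Desc φ ψ f e →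
      Acc (Desc φ' ψ) f ∧ (IsMatchedPair φ ψ f.1 f.2 ↔ IsMatchedPair φ' ψ f.1 f.2) := by
    intro f hf
    exact ih f hf hf.1 ((hD0 f).1 hf).1 hf.2.1 fun g hg => hD g (hg.tail hf)
  have hacc' : Acc (Desc φ' ψ) e := ⟨_, fun f hf => (ih' f ((hD0 f).2 hf)).1⟩
  refine ⟨hacc', ?_⟩
  rw [isMatchedPair_iff hφ hψ ⟨_, hacc⟩ h1 h2, isMatchedPair_iff hφ' hψ hacc' h1' h2]
  refine forall_congr' fun f => ?_
  rw [← hD0 f]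
  refine imp_congr_right fun hf => ?_
  rw [(ih' f hf).2]

end Rounds

/-! ## Descending chains -/

section Chains

variable {d : ℕ} {φ ψ : Set (E d)}

/-- There are `n` distinct points `p₀, …, pₙ₋₁` of `φ` and points `q₀, …, qₙ₋₁` of `ψ`, the first
one within distance `2R` of `z`, such that successive points are at distance at most `R` and
the distances `‖pᵢ - qᵢ‖` decrease. -/
def LongChain (φ ψ : Set (E d)) (z : E d) (R : ℝ) (n : ℕ) : Prop :=
  ∃ p q : ℕ → E d, ‖q 0 - z‖ ≤ 2 * R ∧ (∀ i < n, q i ∈ ψ ∧ p i ∈ φ ∧ ‖p i - q i‖ ≤ R) ∧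
    Set.InjOn p (Set.Iio n) ∧
    ∀ i, i + 1 < n → ‖p i - q (i + 1)‖ ≤ R ∧ ‖p (i + 1) - q (i + 1)‖ ≤ ‖p i - q i‖

lemma LongChain.mono {φ' : Set (E d)} (hs : φ ⊆ φ') {z : E d} {R : ℝ} {n : ℕ}
    (h : LongChain φ ψ z R n) : LongChain φ' ψ z R n := by
  obtain ⟨p, q, h0, h1, h2, h3⟩ := h
  exact ⟨p, q, h0, fun i hi => ⟨(h1 i hi).1, hs (h1 i hi).2.1, (h1 i hi).2.2⟩, h2, h3⟩

/-- Loop erasure of a descending chain. Steps that keep the first point only change `q`; steps that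
keep `q` append a new first point. The invariant that the current length is below all recorded
lengths survives truncation and yields monotonicity for the next step. Distinctness of the `p i` is
needed later for the product bound on probabilities. -/
lemma exists_simple_chain {e f : E d × E d} {R : ℝ} (he2 : e.2 ∈ ψ) (heR : ‖e.1 - e.2‖ ≤ R)
    (h : Relation.ReflTransGen (Desc φ ψ) f e) :
    f.2 ∈ ψ ∧ ‖f.1 - f.2‖ ≤ R ∧ ∃ (n : ℕ) (p q : ℕ → E d), p 0 = e.1 ∧ p n = f.1 ∧
      Set.InjOn p (Set.Iic n) ∧
      (∀ i < n, p (i + 1) ∈ φ ∧ q i ∈ ψ ∧ ‖p i - q i‖ ≤ R ∧ ‖p (i + 1) - q i‖ ≤ R ∧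
        ‖f.1 - f.2‖ ≤ ‖p (i + 1) - q i‖) ∧
      ∀ i, i + 1 < n → ‖p (i + 2) - q (i + 1)‖ ≤ ‖p (i + 1) - q i‖ := by
  induction h using Relation.ReflTransGen.head_induction_on with
  | refl =>
    refine ⟨he2, heR, 0, fun _ => e.1, fun _ => e.2, rfl, rfl, ?_, fun i hi => absurd hi (by lia),
      fun i hi => absurd hi (by lia)⟩
    intro i hi j hj _
    simp only [Set.mem_Iic] at hi hj
    lia
  | @head g f hgf _ ih =>
    obtain ⟨hf2, hfR, n, p, q, hp0, hpn, hinj, hch, hdec⟩ := ih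
    have hle := hgf.norm_le
    refine ⟨hgf.2.1, hle.trans hfR, ?_⟩
    rcases hgf.2.2.1 with hs | hs
    · exact ⟨n, p, q, hp0, hpn.trans hs.symm, hinj, fun i hi =>
        ⟨(hch i hi).1, (hch i hi).2.1, (hch i hi).2.2.1, (hch i hi).2.2.2.1,
          hle.trans (hch i hi).2.2.2.2⟩, hdec⟩
    -- A return to an earlier point erases the loop in between.
    · by_cases hold : ∃ j ≤ n, p j = g.1
      · obtain ⟨j, hj, hpj⟩ := hold
        refine ⟨j, p, q, hp0, hpj, hinj.mono (Set.Iic_subset_Iic.2 hj), fun i hi => ?_,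
          fun i hi => hdec i (hi.trans_le hj)⟩
        have := hch i (hi.trans_le hj)
        exact ⟨this.1, this.2.1, this.2.2.1, this.2.2.2.1, hle.trans this.2.2.2.2⟩
      · push Not at hold
        have hpu : ∀ i ≤ n, Function.update p (n + 1) g.1 i = p i := fun i hi =>
          Function.update_of_ne (by lia) _ _
        have hqu : ∀ i < n, Function.update q n f.2 i = q i := fun i hi =>
          Function.update_of_ne (by lia) _ _
        refine ⟨n + 1, Function.update p (n + 1) g.1, Function.update q n f.2, ?_, by simp, ?_, ?_,
          ?_⟩
        · rw [hpu 0 (Nat.zero_le _), hp0]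
        · intro i hi j hj hij
          simp only [Set.mem_Iic] at hi hj
          rcases Nat.lt_or_ge n i with h1 | h1 <;> rcases Nat.lt_or_ge n j with h2 | h2
          · lia
          · obtain rfl : i = n + 1 := by lia
            rw [hpu j h2, Function.update_self] at hij
            exact absurd hij.symm (hold j h2)
          · obtain rfl : j = n + 1 := by lia
            rw [hpu i h1, Function.update_self] at hij
            exact absurd hij (hold i h1)
          · rw [hpu j h2, hpu i h1] at hij
            exact hinj h1 h2 hij
        · intro i hi
          rcases Nat.lt_succ_iff_lt_or_eq.1 hi with hi | rfl
          · rw [hpu _ hi.le, hpu (i + 1) hi, hqu i hi]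
            have := hch i hi
            exact ⟨this.1, this.2.1, this.2.2.1, this.2.2.2.1, hle.trans this.2.2.2.2⟩
          · rw [hpu _ le_rfl, Function.update_self, Function.update_self, hpn, ← hs]
            rw [← hs] at hf2 hfR
            exact ⟨hgf.1, hf2, hfR, hle.trans (by rw [← hs] at *; exact hfR), le_rfl⟩
        · intro i hi
          rcases Nat.lt_succ_iff_lt_or_eq.1 hi with hi | hi
          · rw [hpu (i + 2) hi, hpu (i + 1) hi.le, hqu (i + 1) hi, hqu i (by lia)]
            exact hdec i hi
          · subst hi
            rw [hpu (i + 1) le_rfl, Function.update_self, Function.update_self, hqu i (by lia), ← hs]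
            have := (hch i (by lia)).2.2.2.2
            exact hle.trans this

/-- If there is no long chain, then descending chains stay close to their starting point. -/
lemma norm_sub_le_of_not_longChain {e f : E d × E d} {R : ℝ} {z : E d} {n : ℕ} (hn : 0 < n)
    (he2 : e.2 ∈ ψ) (heR : ‖e.1 - e.2‖ ≤ R) (hz : ‖e.1 - z‖ ≤ R)
    (hno : ¬ LongChain ((φ \ {e.1}) ∩ Metric.closedBall e.1 (2 * R * n)) ψ z R n)
    (h : Relation.ReflTransGen (Desc φ ψ) f e) :
    ‖f.1 - e.1‖ ≤ 2 * R * n ∧ ‖f.1 - f.2‖ ≤ R := by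
  obtain ⟨-, hfR, N, p, q, hp0, hpN, hinj, hch, hdec⟩ := exists_simple_chain he2 heR h
  refine ⟨?_, hfR⟩
  have hR : 0 ≤ R := (norm_nonneg _).trans heR
  have hdist : ∀ i ≤ N, ‖p i - e.1‖ ≤ 2 * R * i := by
    intro i
    induction i with
    | zero => intro _; simp [hp0]
    | succ i ih =>
      intro hi
      have h1 := ih (by lia)
      obtain ⟨-, -, h2, h3, -⟩ := hch i hi
      have : p (i + 1) - e.1 = (p (i + 1) - q i) - (p i - q i) + (p i - e.1) := by abel
      rw [this]
      push_cast
      calc _ ≤ ‖p (i + 1) - q i‖ + ‖p i - q i‖ + ‖p i - e.1‖ :=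
            (norm_add_le _ _).trans (add_le_add_left (norm_sub_le _ _) _)
        _ ≤ R + R + 2 * R * i := by gcongr
        _ = _ := by ring
  have hNn : N < n := by
    by_contra! hle
    -- The initial point `p 0 = e.1` is dropped: it may be an added point that does not belong to
    -- the process.
    refine hno ⟨fun i => p (i + 1), q, ?_, ?_, ?_, ?_⟩
    · obtain ⟨-, -, h2, -⟩ := hch 0 (by lia)
      rw [hp0, norm_sub_rev] at h2
      calc ‖q 0 - z‖ ≤ ‖q 0 - e.1‖ + ‖e.1 - z‖ := norm_sub_le_norm_sub_add_norm_sub _ _ _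
        _ ≤ R + R := add_le_add h2 hz
        _ = _ := by ring
    · intro i hi
      have h1 := hch i (by lia)
      refine ⟨h1.2.1, ⟨⟨h1.1, ?_⟩, ?_⟩, h1.2.2.2.1⟩
      · intro heq
        rw [Set.mem_singleton_iff, ← hp0] at heq
        have := hinj (by simp; lia) (by simp) heq
        lia
      · rw [Metric.mem_closedBall, dist_eq_norm]
        refine (hdist (i + 1) (by lia)).trans ?_
        have : ((i + 1 : ℕ) : ℝ) ≤ n := by exact_mod_cast hi
        gcongr
    · intro i hi j hj hij
      simp only [Set.mem_Iio] at hi hj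
      have := hinj (by simp; lia) (by simp; lia) hij
      lia
    · intro i hi
      exact ⟨(hch (i + 1) (by lia)).2.2.1, hdec i (by lia)⟩
  rw [← hpN]
  refine (hdist N le_rfl).trans ?_
  have : (N : ℝ) ≤ n := by exact_mod_cast hNn.le
  gcongr

/-- Locality for configurations which agree in a ball that no descending chain leaves. -/
lemma isMatchedPair_inter_iff {φ' : Set (E d)} (hφ : IsLocallyFinite φ) (hφ' : IsLocallyFinite φ')
    (hψ : IsLocallyFinite ψ) (hwf : WellFounded (Desc φ ψ)) {e : E d × E d} {R : ℝ} {z : E d}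
    {n : ℕ} (hn : 0 < n) (he1 : e.1 ∈ φ) (he2 : e.2 ∈ ψ) (heR : ‖e.1 - e.2‖ ≤ R)
    (hz : ‖e.1 - z‖ ≤ R)
    (hno : ¬ LongChain ((φ \ {e.1}) ∩ Metric.closedBall e.1 (2 * R * n)) ψ z R n)
    {s : ℝ} (hs : (2 * n + 3) * R ≤ s)
    (hag : φ ∩ Metric.closedBall z s = φ' ∩ Metric.closedBall z s) :
    IsMatchedPair φ ψ e.1 e.2 ↔ IsMatchedPair φ' ψ e.1 e.2 := by
  have hR : 0 ≤ R := (norm_nonneg _).trans heR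
  have hmem : ∀ x : E d, ‖x - z‖ ≤ s → (x ∈ φ ↔ x ∈ φ') := by
    intro x hx
    have hx' : x ∈ Metric.closedBall z s := by rwa [Metric.mem_closedBall, dist_eq_norm]
    constructor
    · intro h
      exact (hag.subset ⟨h, hx'⟩).1
    · intro h
      exact (hag.symm.subset ⟨h, hx'⟩).1
  have hns : 0 ≤ 2 * (n : ℝ) * R := by positivity
  refine (isMatchedPair_congr hφ hφ' hψ (hwf.apply e) he1 ((hmem _ (hz.trans ?_)).1 he1) he2 ?_).2
  · nlinarith
  -- The radius `(2 n + 3) R` splits as `R` from `z` to `e.1`, `2 R n` along the chain, and `2 R`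
  -- for one further descent.
  · intro f hf g
    obtain ⟨h1, h2⟩ := norm_sub_le_of_not_longChain hn he2 heR hz hno hf
    refine and_congr_left fun h => hmem _ ?_
    have hgn : ‖g.1 - g.2‖ ≤ ‖f.1 - f.2‖ := norm_le_of_pairKey_le h.2.2.le
    have hgf : ‖g.1 - f.1‖ ≤ 2 * R := by
      rcases h.2.1 with h | h
      · rw [h, sub_self, norm_zero]; positivity
      · have : g.1 - f.1 = (g.1 - g.2) - (f.1 - f.2) := by rw [h]; abel
        rw [this]
        exact (norm_sub_le _ _).trans (by linarith)
    have : g.1 - z = (g.1 - f.1) + (f.1 - e.1) + (e.1 - z) := by abel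
    rw [this]
    refine (norm_add₃_le).trans (le_trans ?_ hs)
    nlinarith

lemma strictAnti_of_desc_seq {s : ℕ → E d × E d} (hs : ∀ i, Desc φ ψ (s (i + 1)) (s i)) :
    StrictAnti (fun i => pairKey (s i)) :=
  strictAnti_nat_of_succ_lt fun i => (hs i).2.2.2

lemma norm_le_of_desc_seq {s : ℕ → E d × E d} (hs : ∀ i, Desc φ ψ (s (i + 1)) (s i)) (i : ℕ) :
    ‖(s i).1 - (s i).2‖ ≤ ‖(s 0).1 - (s 0).2‖ :=
  norm_le_of_pairKey_le ((strictAnti_of_desc_seq hs).antitone (Nat.zero_le i))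

lemma injective_of_desc_seq {s : ℕ → E d × E d} (hs : ∀ i, Desc φ ψ (s (i + 1)) (s i)) :
    Function.Injective s :=
  Function.Injective.of_comp (f := pairKey) (strictAnti_of_desc_seq hs).injective

/-- An infinite descent would stay in a bounded region with bounded lengths. It would then visit
only finitely many pairs, although its keys strictly decrease. -/
lemma wellFounded_desc_of_not_longChain (hφ : IsLocallyFinite φ) (hψ : IsLocallyFinite ψ)
    (h : ∀ R : ℕ, 0 < R → ∃ n : ℕ, 0 < n ∧ ¬ LongChain φ ψ 0 R n) : WellFounded (Desc φ ψ) := by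
  rw [wellFounded_iff_isEmpty_descending_chain]
  refine ⟨fun ⟨s, hs⟩ => ?_⟩
  -- The bounds refer to `s 1`, since `Desc` puts only its smaller pair in `φ × ψ`, so `s 0` need
  -- not consist of points of the two sets.
  obtain ⟨R, hR⟩ := exists_nat_ge (max (max ‖(s 1).1‖ ‖(s 1).1 - (s 1).2‖) 1)
  simp only [max_le_iff] at hR
  obtain ⟨n, hn0, hn⟩ := h R (by have := hR.2; exact_mod_cast this)
  have hreach : ∀ i, Relation.ReflTransGen (Desc φ ψ) (s (i + 1)) (s 1) := by
    intro i
    induction i with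
    | zero => exact Relation.ReflTransGen.refl
    | succ i ih => exact Relation.ReflTransGen.head (hs (i + 1)) ih
  have hbd : ∀ i, ‖(s (i + 1)).1 - (s 1).1‖ ≤ 2 * R * n ∧ ‖(s (i + 1)).1 - (s (i + 1)).2‖ ≤ R := by
    intro i
    refine norm_sub_le_of_not_longChain hn0 (hs 0).2.1 hR.1.2 (z := 0) (by simpa using hR.1.1) ?_
      (hreach i)
    exact fun hl => hn (hl.mono fun x hx => hx.1.1)
  have hfin := (hφ (Metric.closedBall (s 1).1 (2 * R * n)) Metric.isBounded_closedBall).prod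
    (hψ (Metric.closedBall (s 1).1 (2 * R * n + R)) Metric.isBounded_closedBall)
  refine Set.infinite_of_injective_forall_mem (f := fun i => s (i + 1)) ?_ ?_ hfin
  · exact (injective_of_desc_seq hs).comp (add_left_injective 1)
  · intro i
    refine ⟨⟨(hs i).1, ?_⟩, (hs i).2.1, ?_⟩
    · rw [Metric.mem_closedBall, dist_eq_norm]; exact (hbd i).1
    · rw [Metric.mem_closedBall, dist_eq_norm]
      have : (s (i + 1)).2 - (s 1).1
          = ((s (i + 1)).1 - (s 1).1) - ((s (i + 1)).1 - (s (i + 1)).2) := by abel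
      rw [this]
      exact (norm_sub_le _ _).trans (add_le_add (hbd i).1 (hbd i).2)

/-- Lengths are bounded along a descent, so only finitely many pairs can involve a point of `F`, and
each occurs at most once. The tail of an infinite descent would thus be a descent in `φ`. -/
lemma wellFounded_desc_union_finite (hψ : IsLocallyFinite ψ)
    (hwf : WellFounded (Desc φ ψ)) {F : Set (E d)} (hF : F.Finite) :
    WellFounded (Desc (φ ∪ F) ψ) := by
  rw [wellFounded_iff_isEmpty_descending_chain] at hwf ⊢
  refine ⟨fun ⟨s, hs⟩ => ?_⟩
  have hfin : {i | (s (i + 1)).1 ∈ F}.Finite := by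
    obtain ⟨B, hB⟩ := hF.isBounded.exists_norm_le
    have hfin := hF.prod (hψ (Metric.closedBall 0 (B + ‖(s 0).1 - (s 0).2‖))
      Metric.isBounded_closedBall)
    refine Set.Finite.of_finite_image (f := fun i => s (i + 1)) (hfin.subset ?_) ?_
    · rintro _ ⟨i, hi, rfl⟩
      refine ⟨hi, (hs i).2.1, ?_⟩
      rw [mem_closedBall_zero_iff]
      have h1 := norm_le_of_desc_seq hs (i + 1)
      have h2 := hB _ hi
      have : (s (i + 1)).2 = (s (i + 1)).1 - ((s (i + 1)).1 - (s (i + 1)).2) := by abel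
      rw [this]
      exact (norm_sub_le _ _).trans (add_le_add h2 h1)
    · exact ((injective_of_desc_seq hs).comp (add_left_injective 1)).injOn
  obtain ⟨N, hN⟩ := hfin.bddAbove
  refine hwf.elim ⟨fun i => s (i + N + 2), fun i => ?_⟩
  have h := hs (i + N + 2)
  have hi : i + 1 + N + 2 = i + N + 2 + 1 := by ring
  beta_reduce
  rw [hi]
  refine ⟨?_, h.2.1, h.2.2.1, h.2.2.2⟩
  · refine h.1.resolve_right fun hF' => ?_
    have := hN (show i + N + 2 ∈ {i | (s (i + 1)).1 ∈ F} from hF')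
    lia

/-! ## Matching within a given distance -/

/-- `q ∈ ψ` is matched to a point within distance `L`. -/
def MatchedWithin (φ ψ : Set (E d)) (q : E d) (L : ℝ) : Prop :=
  ∃ p, ‖p - q‖ ≤ L ∧ IsMatchedPair φ ψ p q

lemma MatchedWithin.mono {q : E d} {L L' : ℝ} (h : MatchedWithin φ ψ q L) (hL : L ≤ L') :
    MatchedWithin φ ψ q L' :=
  let ⟨p, hp, hm⟩ := h; ⟨p, hp.trans hL, hm⟩

/-- If `q₀` is not matched within distance `ρ`, then all points of `φ` within distance `ρ` of
`q₀` are matched, either within distance `L` or to points that are not matched within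
distance `L`. -/
lemma encard_le_of_not_matchedWithin (hφ : IsLocallyFinite φ) (hψ : IsLocallyFinite ψ)
    (hwf : WellFounded (Desc φ ψ)) {q₀ : E d} (hq₀ : q₀ ∈ ψ) {ρ L : ℝ}
    (hno : ¬ MatchedWithin φ ψ q₀ ρ) :
    (φ ∩ Metric.closedBall q₀ ρ).encard ≤ (ψ ∩ Metric.closedBall q₀ (ρ + L)).encard +
      {q ∈ ψ ∩ Metric.closedBall q₀ (2 * ρ) |
        MatchedWithin φ ψ q ρ ∧ ¬ MatchedWithin φ ψ q L}.encard := by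
  -- Apply stability to `(p, q₀)`: the blocking matched pair cannot contain `q₀`, which has no
  -- partner within `ρ`, so it contains `p`.
  have hex : ∀ p ∈ φ ∩ Metric.closedBall q₀ ρ, ∃ q, IsMatchedPair φ ψ p q ∧ ‖p - q‖ ≤ ρ := by
    rintro p ⟨hp, hpB⟩
    rw [Metric.mem_closedBall, dist_eq_norm] at hpB
    by_cases hm : IsMatchedPair φ ψ p q₀
    · exact absurd ⟨p, hpB, hm⟩ hno
    · obtain ⟨f, hf, hfm⟩ := exists_desc_of_not_isMatchedPair hφ hψ (hwf.apply (p, q₀)) hp hq₀ hm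
      have hn := hf.norm_le
      rcases hf.2.2.1 with h | h
      · simp only at h
        rw [h] at hfm hn
        exact ⟨f.2, hfm, hn.trans hpB⟩
      · simp only at h
        rw [h] at hfm hn
        exact absurd ⟨f.1, hn.trans hpB, hfm⟩ hno
  choose! m hm hmd using hex
  have hinj : Set.InjOn m (φ ∩ Metric.closedBall q₀ ρ) := by
    intro p hp p' hp' heq
    have h1 := hm p hp
    rw [heq] at h1
    exact h1.left_unique (hm p' hp')
  rw [← hinj.encard_image]
  refine le_trans (Set.encard_le_encard ?_) (Set.encard_union_le _ _)
  rintro _ ⟨p, hp, rfl⟩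
  have hpB : ‖p - q₀‖ ≤ ρ := by
    have := hp.2; rwa [Metric.mem_closedBall, dist_eq_norm] at this
  have htri : ‖m p - q₀‖ ≤ ‖p - m p‖ + ρ := by
    have : m p - q₀ = (p - q₀) - (p - m p) := by abel
    rw [this]
    exact (norm_sub_le _ _).trans (by linarith)
  by_cases hL : ‖p - m p‖ ≤ L
  · left
    refine ⟨(hm p hp).mem_right, ?_⟩
    rw [Metric.mem_closedBall, dist_eq_norm]
    linarith
  · right
    refine ⟨⟨(hm p hp).mem_right, ?_⟩, ⟨p, hmd p hp, hm p hp⟩, ?_⟩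
    · rw [Metric.mem_closedBall, dist_eq_norm]
      linarith [hmd p hp]
    · rintro ⟨p', hp', hm'⟩
      rw [hm'.left_unique (hm p hp)] at hp'
      exact hL hp'

end Chains

/-! ## Measurability of the matching -/

lemma lexLE_iff {d : ℕ} (x y : E d) :
    LexLE x y ↔ x = y ∨ ∃ i, (∀ j, j < i → x j = y j) ∧ x i < y i := by
  rw [LexLE, le_iff_eq_or_lt]
  refine or_congr ⟨fun h => ?_, fun h => by rw [h]⟩ Iff.rfl
  ext i
  exact congrFun h i

lemma measurableSet_lexLE {d : ℕ} : MeasurableSet {a : E d × E d | LexLE a.1 a.2} := by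
  have : {a : E d × E d | LexLE a.1 a.2} = {a | a.1 = a.2} ∪
      ⋃ i, ((⋂ j, ⋂ (_ : j < i), {a : E d × E d | a.1 j = a.2 j}) ∩ {a | a.1 i < a.2 i}) := by
    ext a
    simp [lexLE_iff]
  rw [this]
  refine (measurableSet_eq_fun measurable_fst measurable_snd).union
    (MeasurableSet.iUnion fun i => (MeasurableSet.iInter fun j => MeasurableSet.iInter fun _ =>
      measurableSet_eq_fun ?_ ?_).inter (measurableSet_lt ?_ ?_))
  all_goals fun_prop

/-- A random locally finite set with measurable counts. -/
structure IsMeasurableConfig {d : ℕ} {Ω : Type*} [MeasurableSpace Ω] (Φ : Ω → Set (E d)) :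
    Prop where
  locallyFinite : ∀ ω, IsLocallyFinite (Φ ω)
  measurable_count : ∀ B : Set (E d), MeasurableSet B → Measurable (fun ω => (Φ ω ∩ B).encard)

lemma isLocallyFinite_of_finite {d : ℕ} {F : Set (E d)} (hF : F.Finite) : IsLocallyFinite F :=
  fun _ _ => hF.subset Set.inter_subset_left

lemma IsLocallyFinite.union {d : ℕ} {φ φ' : Set (E d)} (h : IsLocallyFinite φ)
    (h' : IsLocallyFinite φ') : IsLocallyFinite (φ ∪ φ') := fun B hB => by
  rw [Set.union_inter_distrib_right]
  exact (h B hB).union (h' B hB)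

namespace IsMeasurableConfig

variable {d : ℕ} {Ω α : Type*} [MeasurableSpace Ω] [MeasurableSpace α] {Φ : Ω → Set (E d)}

lemma comp (hΦ : IsMeasurableConfig Φ) {f : α → Ω} (hf : Measurable f) :
    IsMeasurableConfig (fun a => Φ (f a)) :=
  ⟨fun _ => hΦ.locallyFinite _, fun B hB => (hΦ.measurable_count B hB).comp hf⟩

lemma union_finite (hΦ : IsMeasurableConfig Φ) {F : Set (E d)} (hF : F.Finite) :
    IsMeasurableConfig (fun ω => Φ ω ∪ F) := by
  refine ⟨fun ω => (hΦ.locallyFinite ω).union (isLocallyFinite_of_finite hF), fun B hB => ?_⟩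
  -- Removing `F` from `B` avoids counting twice the points of `F` that are already in the
  -- configuration.
  have : ∀ ω, ((Φ ω ∪ F) ∩ B).encard = (Φ ω ∩ (B \ F)).encard + (F ∩ B).encard := by
    intro ω
    rw [← Set.encard_union_eq]
    · congr 1
      ext x
      simp only [Set.mem_inter_iff, Set.mem_union, Set.mem_sdiff]
      tauto
    · rw [Set.disjoint_left]
      rintro x ⟨_, _, h⟩ ⟨h', _⟩
      exact h h'
  simp_rw [this]
  exact (Measurable.of_discrete (f := fun n : ℕ∞ => n + (F ∩ B).encard)).comp
    (hΦ.measurable_count _ (hB.diff hF.measurableSet))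

/-- The points of the configuration in a ball, as a kernel. -/
noncomputable def kernel (hΦ : IsMeasurableConfig Φ) (n : ℕ) : Kernel Ω (E d) where
  toFun ω := Measure.count.restrict (Φ ω ∩ Metric.closedBall 0 n)
  measurable' := by
    refine Measure.measurable_of_measurable_coe _ fun s hs => ?_
    have : ∀ ω, Measure.count.restrict (Φ ω ∩ Metric.closedBall 0 n) s =
        ((Φ ω ∩ (s ∩ Metric.closedBall 0 n)).encard : ENNReal) := by
      intro ω
      have hfin := hΦ.locallyFinite ω (Metric.closedBall 0 n) Metric.isBounded_closedBall
      rw [Measure.restrict_apply hs, Measure.count_apply]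
      · congr 2
        ext x
        simp only [Set.mem_inter_iff]
        tauto
      · exact (hfin.subset Set.inter_subset_right).measurableSet
    simp_rw [this]
    exact (Measurable.of_discrete (f := fun n : ℕ∞ => (n : ENNReal))).comp
      (hΦ.measurable_count _ (hs.inter Metric.isClosed_closedBall.measurableSet))

lemma kernel_apply (hΦ : IsMeasurableConfig Φ) (n : ℕ) (ω : Ω) :
    hΦ.kernel n ω = Measure.count.restrict (Φ ω ∩ Metric.closedBall 0 n) := rfl

/-- The quantifier runs over uncountably many possible positions. The event says that a section of
`S` has positive mass under the counting measure of the configuration in some ball; these measures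
form a kernel with finite values, so the mass is measurable in `ω`. -/
lemma measurableSet_exists_mem_aux (hΦ : IsMeasurableConfig Φ) {S : Set (Ω × E d)}
    (hS : MeasurableSet S) : MeasurableSet {ω | ∃ p ∈ Φ ω, (ω, p) ∈ S} := by
  have hfin : ∀ (n : ℕ) (ω : Ω), (Φ ω ∩ Metric.closedBall 0 n).Finite := fun n ω =>
    hΦ.locallyFinite ω (Metric.closedBall 0 n) Metric.isBounded_closedBall
  have : {ω | ∃ p ∈ Φ ω, (ω, p) ∈ S} = ⋃ n, {ω | hΦ.kernel n ω (Prod.mk ω ⁻¹' S) ≠ 0} := by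
    ext ω
    simp only [Set.mem_ofPred_eq, Set.mem_iUnion, kernel_apply]
    have hr : ∀ n : ℕ, Measure.count.restrict (Φ ω ∩ Metric.closedBall 0 n) (Prod.mk ω ⁻¹' S) ≠ 0 ↔
        ((Prod.mk ω ⁻¹' S) ∩ (Φ ω ∩ Metric.closedBall 0 n)).Nonempty := by
      intro n
      rw [Measure.restrict_apply (measurable_prodMk_left hS), Measure.count_apply
        ((hfin n ω).subset Set.inter_subset_right).measurableSet]
      simp [Set.nonempty_iff_ne_empty]
    simp only [hr]
    constructor
    · rintro ⟨p, hp, hpS⟩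
      obtain ⟨n, hn⟩ := exists_nat_ge ‖p‖
      exact ⟨n, p, hpS, hp, by rwa [mem_closedBall_zero_iff]⟩
    · rintro ⟨n, p, hpS, hp, -⟩
      exact ⟨p, hp, hpS⟩
  rw [this]
  refine MeasurableSet.iUnion fun n => ?_
  have hk : ∀ ω, IsFiniteMeasure (hΦ.kernel n ω) := fun ω => by
    refine ⟨?_⟩
    rw [kernel_apply, Measure.restrict_apply_univ, Measure.count_apply (hfin n ω).measurableSet]
    simpa using (hfin n ω)
  exact (Kernel.measurable_kernel_prodMk_left_of_finite hS hk)
    (measurableSet_singleton (0 : ENNReal)).compl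

/-- Measurability of existential statements about the points of a random configuration. -/
lemma measurableSet_exists_mem (hΦ : IsMeasurableConfig Φ) {f : α → Ω} (hf : Measurable f)
    {S : Set (α × E d)} (hS : MeasurableSet S) :
    MeasurableSet {a | ∃ p ∈ Φ (f a), (a, p) ∈ S} :=
  (hΦ.comp hf).measurableSet_exists_mem_aux hS

lemma measurableSet_forall_mem (hΦ : IsMeasurableConfig Φ) {f : α → Ω} (hf : Measurable f)
    {S : Set (α × E d)} (hS : MeasurableSet S) :
    MeasurableSet {a | ∀ p ∈ Φ (f a), (a, p) ∈ S} := by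
  have := (hΦ.measurableSet_exists_mem hf hS.compl).compl
  convert this using 1
  ext a
  simp

lemma measurableSet_mem (hΦ : IsMeasurableConfig Φ) :
    MeasurableSet {a : Ω × E d | a.2 ∈ Φ a.1} := by
  have := hΦ.measurableSet_exists_mem (α := Ω × E d) measurable_fst
    (S := {b | b.1.2 = b.2}) (measurableSet_eq_fun (by fun_prop) (by fun_prop))
  convert this using 1
  ext a
  simp

/-- The two sides are treated asymmetrically: `ψ` is countable, so fixed `q` and countable
intersections suffice, while the random side needs joint measurability in `(ω, p)`. Quantifiers over
unmatched points become quantifiers over all points, with the membership moved into the set. -/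
lemma measurableSet_mutualAt_aux (hΦ : IsMeasurableConfig Φ) {ψ : Set (E d)} (hψ : ψ.Countable)
    {n : ℕ} (hU : MeasurableSet {a : Ω × E d | a.2 ∈ (unmatched (Φ a.1) ψ n).1})
    (hV : ∀ q, MeasurableSet {ω | q ∈ (unmatched (Φ ω) ψ n).2}) (q : E d) :
    MeasurableSet {a : Ω × E d | MutualAt (Φ a.1) ψ n a.2 q} := by
  have : {a : Ω × E d | MutualAt (Φ a.1) ψ n a.2 q} =
      ((Prod.fst ⁻¹' {ω | q ∈ (unmatched (Φ ω) ψ n).2}) ∩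
        ⋂ q' ∈ ψ, ((Prod.fst ⁻¹' {ω | q' ∈ (unmatched (Φ ω) ψ n).2})ᶜ ∪
          ({a : Ω × E d | ‖a.2 - q‖ < ‖a.2 - q'‖} ∪
            ({a | ‖a.2 - q‖ = ‖a.2 - q'‖} ∩ {a | LexLE q q'})))) ∩
      ({a : Ω × E d | a.2 ∈ (unmatched (Φ a.1) ψ n).1} ∩
        {a | ∀ p' ∈ Φ a.1, (a, p') ∈
          {b : (Ω × E d) × E d | b.2 ∈ (unmatched (Φ b.1.1) ψ n).1}ᶜ ∪
            ({b | ‖q - b.1.2‖ < ‖q - b.2‖} ∪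
              ({b | ‖q - b.1.2‖ = ‖q - b.2‖} ∩ {b | LexLE b.2 b.1.2}))}) := by
    ext a
    simp only [MutualAt, IsMutualNearest, isNearestMin_iff, isNearestMax_iff, Set.mem_inter_iff,
      Set.mem_iInter, Set.mem_union, Set.mem_compl_iff, Set.mem_preimage, Set.mem_ofPred_eq]
    refine and_congr (and_congr_right fun _ => ⟨fun h q' _ => ?_, fun h q' hq' => ?_⟩)
      (and_congr_right fun _ => ⟨fun h p' _ => ?_, fun h p' hp' => ?_⟩)
    · by_cases hq' : q' ∈ (unmatched (Φ a.1) ψ n).2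
      · exact Or.inr (h q' hq')
      · exact Or.inl hq'
    · exact (h q' (unmatched_right_subset _ hq')).resolve_left (not_not.2 hq')
    · by_cases hp' : p' ∈ (unmatched (Φ a.1) ψ n).1
      · exact Or.inr (h p' hp')
      · exact Or.inl hp'
    · exact (h p' (unmatched_left_subset _ hp')).resolve_left (not_not.2 hp')
  rw [this]
  refine (((measurable_fst (hV q)).inter (MeasurableSet.biInter hψ fun q' _ =>
    (measurable_fst (hV q')).compl.union ((measurableSet_lt ?_ ?_).union
      ((measurableSet_eq_fun ?_ ?_).inter (MeasurableSet.const _)))))).inter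
    (hU.inter (hΦ.measurableSet_forall_mem measurable_fst ?_))
  · fun_prop
  · fun_prop
  · fun_prop
  · fun_prop
  · refine MeasurableSet.union (MeasurableSet.compl ?_) ((measurableSet_lt ?_ ?_).union
      ((measurableSet_eq_fun ?_ ?_).inter ?_))
    · have hm : Measurable fun b : (Ω × E d) × E d => (b.1.1, b.2) := by fun_prop
      exact hm hU
    · fun_prop
    · fun_prop
    · fun_prop
    · fun_prop
    · have hm : Measurable fun b : (Ω × E d) × E d => (b.2, b.1.2) := by fun_prop
      exact hm measurableSet_lexLE

lemma measurableSet_unmatched (hΦ : IsMeasurableConfig Φ) {ψ : Set (E d)} (hψ : ψ.Countable)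
    (n : ℕ) : MeasurableSet {a : Ω × E d | a.2 ∈ (unmatched (Φ a.1) ψ n).1} ∧
      ∀ q, MeasurableSet {ω | q ∈ (unmatched (Φ ω) ψ n).2} := by
  induction n with
  | zero => exact ⟨hΦ.measurableSet_mem, fun q => MeasurableSet.const _⟩
  | succ n ih =>
    have hM := hΦ.measurableSet_mutualAt_aux hψ ih.1 ih.2
    constructor
    · have : {a : Ω × E d | a.2 ∈ (unmatched (Φ a.1) ψ (n + 1)).1} =
          {a : Ω × E d | a.2 ∈ (unmatched (Φ a.1) ψ n).1} ∩
            (⋃ q ∈ ψ, {a : Ω × E d | MutualAt (Φ a.1) ψ n a.2 q})ᶜ := by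
        ext a
        simp only [Set.mem_ofPred_eq, mem_unmatched_succ_left, Set.mem_inter_iff,
          Set.mem_compl_iff, Set.mem_iUnion, exists_prop]
        refine and_congr_right fun _ => not_congr ⟨fun ⟨q, hq⟩ => ⟨q, ?_, hq⟩,
          fun ⟨q, _, hq⟩ => ⟨q, hq⟩⟩
        exact unmatched_right_subset _ hq.mem_right
      rw [this]
      exact ih.1.inter (MeasurableSet.biUnion hψ fun q _ => hM q).compl
    · intro q
      have : {ω | q ∈ (unmatched (Φ ω) ψ (n + 1)).2} =
          {ω | q ∈ (unmatched (Φ ω) ψ n).2} ∩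
            {ω | ∃ p ∈ Φ ω, (ω, p) ∈ {a : Ω × E d | MutualAt (Φ a.1) ψ n a.2 q}}ᶜ := by
        ext ω
        simp only [Set.mem_ofPred_eq, mem_unmatched_succ_right, Set.mem_inter_iff,
          Set.mem_compl_iff]
        refine and_congr_right fun _ => not_congr ⟨fun ⟨p, hp⟩ => ⟨p, ?_, hp⟩,
          fun ⟨p, _, hp⟩ => ⟨p, hp⟩⟩
        exact unmatched_left_subset _ hp.mem_left
      rw [this]
      exact (ih.2 q).inter (hΦ.measurableSet_exists_mem measurable_id (hM q)).compl

lemma measurableSet_isMatchedPair_joint (hΦ : IsMeasurableConfig Φ) {ψ : Set (E d)}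
    (hψ : ψ.Countable) (q : E d) :
    MeasurableSet {a : Ω × E d | IsMatchedPair (Φ a.1) ψ a.2 q} := by
  have : {a : Ω × E d | IsMatchedPair (Φ a.1) ψ a.2 q} =
      ⋃ n, {a : Ω × E d | MutualAt (Φ a.1) ψ n a.2 q} := by
    ext a; simp [IsMatchedPair]
  rw [this]
  exact MeasurableSet.iUnion fun n => hΦ.measurableSet_mutualAt_aux hψ
    (hΦ.measurableSet_unmatched hψ n).1 (hΦ.measurableSet_unmatched hψ n).2 q

lemma measurableSet_isMatchedPair (hΦ : IsMeasurableConfig Φ) {ψ : Set (E d)}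
    (hψ : ψ.Countable) (p q : E d) : MeasurableSet {ω | IsMatchedPair (Φ ω) ψ p q} :=
  measurable_prodMk_right (hΦ.measurableSet_isMatchedPair_joint hψ q)

lemma measurableSet_matchedWithin (hΦ : IsMeasurableConfig Φ) {ψ : Set (E d)}
    (hψ : ψ.Countable) (q : E d) (L : ℝ) : MeasurableSet {ω | MatchedWithin (Φ ω) ψ q L} := by
  have := hΦ.measurableSet_exists_mem measurable_id (S := {a : Ω × E d | ‖a.2 - q‖ ≤ L} ∩
    {a : Ω × E d | IsMatchedPair (Φ a.1) ψ a.2 q})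
    ((measurableSet_le (by fun_prop) (by fun_prop)).inter
      (hΦ.measurableSet_isMatchedPair_joint hψ q))
  convert this using 1
  ext ω
  refine ⟨fun ⟨p, hp, hm⟩ => ⟨p, hm.mem_left, hp, hm⟩, fun ⟨p, _, hp, hm⟩ => ⟨p, hp, hm⟩⟩

end IsMeasurableConfig

/-! ## The σ-algebras generated by the points in a set -/

section CountAlgebra

variable {d : ℕ} {Ω : Type*}

/-- The σ-algebra generated by the counts of `Ψ` in Borel subsets of `A`. -/
@[reducible] noncomputable def countAlgebra (Ψ : Ω → Set (E d)) (A : Set (E d)) : MeasurableSpace Ω :=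
  ⨆ B : {B : Set (E d) // MeasurableSet B},
    MeasurableSpace.comap (fun ω => (Ψ ω ∩ (A ∩ B)).encard) inferInstance

lemma countAlgebra_le [m : MeasurableSpace Ω] {Ψ : Ω → Set (E d)} (hΨ : IsMeasurableConfig Ψ)
    {A : Set (E d)} (hA : MeasurableSet A) : countAlgebra Ψ A ≤ m :=
  iSup_le fun B => (hΨ.measurable_count _ (hA.inter B.2)).comap_le

lemma measurable_count_countAlgebra {Ψ : Ω → Set (E d)} {A B : Set (E d)} (hB : MeasurableSet B)
    (hBA : B ⊆ A) : Measurable[countAlgebra Ψ A] fun ω => (Ψ ω ∩ B).encard := by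
  refine Measurable.of_comap_le (le_trans (le_of_eq ?_) (le_iSup _ ⟨B, hB⟩))
  simp only [Set.inter_eq_right.2 hBA]

lemma countAlgebra_mono {Ψ : Ω → Set (E d)} {A A' : Set (E d)} (hA : MeasurableSet A)
    (h : A ⊆ A') : countAlgebra Ψ A ≤ countAlgebra Ψ A' :=
  iSup_le fun B => (measurable_count_countAlgebra (hA.inter B.2)
    (Set.inter_subset_left.trans h)).comap_le

/-- Seen through `countAlgebra Ψ A`, the restricted process is again a measurable configuration. All
measurability results thus apply with the smaller σ-algebra, which is how locality becomes
independence. -/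
lemma isMeasurableConfig_inter {Ψ : Ω → Set (E d)} (hΨ : ∀ ω, IsLocallyFinite (Ψ ω))
    {A : Set (E d)} (hA : MeasurableSet A) :
    @IsMeasurableConfig d Ω (countAlgebra Ψ A) (fun ω => Ψ ω ∩ A) := by
  let _ := countAlgebra Ψ A
  refine ⟨fun ω => (hΨ ω).mono Set.inter_subset_left, fun B hB => ?_⟩
  simp_rw [Set.inter_assoc]
  exact measurable_count_countAlgebra (hA.inter hB) Set.inter_subset_left

end CountAlgebra

/-! ## Independence of a Poisson process on disjoint sets -/

namespace IsPoissonProcess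

variable {d : ℕ} {Ω : Type*} [MeasurableSpace Ω] {P : Measure Ω}
  {α : ℝ} {Ψ : Ω → Set (E d)}

lemma isMeasurableConfig (hΨ : IsPoissonProcess P α Ψ) : IsMeasurableConfig Ψ :=
  ⟨hΨ.locallyFinite, hΨ.measurable_count⟩

lemma iIndepFun_count {ι : Type*} [Countable ι] (hΨ : IsPoissonProcess P α Ψ)
    (B : ι → Set (E d)) (hB : ∀ i, MeasurableSet (B i)) (hd : Pairwise (Function.onFun Disjoint B)) :
    iIndepFun (fun i ω => (Ψ ω ∩ B i).encard) P := by
  obtain ⟨f, hf⟩ := exists_injective_nat ι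
  have hrange : ∀ (n : ℕ), MeasurableSet (Function.extend f B (fun _ => ∅) n) ∧
      ∀ i, f i ≠ n → Disjoint (B i) (Function.extend f B (fun _ => ∅) n) := by
    intro n
    by_cases h : ∃ i, f i = n
    · obtain ⟨i, rfl⟩ := h
      rw [hf.extend_apply]
      exact ⟨hB i, fun j hj => hd fun h => hj (h ▸ rfl)⟩
    · rw [Function.extend_apply' _ _ _ h]
      exact ⟨MeasurableSet.empty, fun i _ => Set.disjoint_empty _⟩
  have := hΨ.indep_count (Function.extend f B fun _ => ∅) (fun n => (hrange n).1) ?_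
  · have := this.precomp hf
    simpa only [hf.extend_apply] using this
  · intro n m hnm
    by_cases h : ∃ i, f i = n
    · obtain ⟨i, rfl⟩ := h
      have := (hrange m).2 i hnm
      rwa [Function.onFun, hf.extend_apply]
    · rw [Function.onFun, Function.extend_apply' _ _ _ h]
      exact Set.empty_disjoint _

/-- The numbers of points in subsets of disjoint sets are independent. -/
lemma indep_countAlgebra [IsProbabilityMeasure P] (hΨ : IsPoissonProcess P α Ψ) {A A' : Set (E d)} (hA : MeasurableSet A)
    (hA' : MeasurableSet A') (hAA' : Disjoint A A') :
    Indep (countAlgebra Ψ A) (countAlgebra Ψ A') P := by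
  classical
  let I := {B : Set (E d) // MeasurableSet B}
  let m : Set (E d) → I → MeasurableSpace Ω := fun A B =>
    MeasurableSpace.comap (fun ω => (Ψ ω ∩ (A ∩ B)).encard) inferInstance
  have hgen : ∀ A, countAlgebra Ψ A = MeasurableSpace.generateFrom
      (piiUnionInter (fun B => {s | MeasurableSet[m A B] s}) Set.univ) := by
    intro A
    refine Eq.trans ?_ (generateFrom_piiUnionInter_measurableSet (m A) Set.univ).symm
    simp only [countAlgebra, m, Set.mem_univ, iSup_pos]
    rfl
  refine IndepSets.indep (countAlgebra_le hΨ.isMeasurableConfig hA)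
    (countAlgebra_le hΨ.isMeasurableConfig hA')
    (isPiSystem_piiUnionInter _ (fun B => @MeasurableSpace.isPiSystem_measurableSet Ω (m A B)) _)
    (isPiSystem_piiUnionInter _ (fun B => @MeasurableSpace.isPiSystem_measurableSet Ω (m A' B)) _)
    (hgen A) (hgen A') ?_
  rw [IndepSets_iff]
  rintro _ _ ⟨t, -, f, hf, rfl⟩ ⟨t', -, f', hf', rfl⟩
  -- refine the two finite families to a common family of atoms
  let T : Finset I := t ∪ t'
  let atom : (T → Bool) → Set (E d) := fun σ => ⋂ B : T, if σ B then (B.1 : Set (E d)) else (B.1 : Set (E d))ᶜ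
  have hatom : ∀ σ, MeasurableSet (atom σ) := fun σ => MeasurableSet.iInter fun B => by
    split_ifs
    · exact B.1.2
    · exact B.1.2.compl
  have hatomd : ∀ σ σ', σ ≠ σ' → Disjoint (atom σ) (atom σ') := by
    intro σ σ' h
    obtain ⟨B, hB⟩ := Function.ne_iff.1 h
    rw [Set.disjoint_left]
    intro x hx hx'
    have h1 := Set.mem_iInter.1 hx B
    have h2 := Set.mem_iInter.1 hx' B
    cases hs : σ B <;> cases hs' : σ' B <;> simp_all
  -- All counts involved are finite sums of counts in these disjoint pieces; the Boolean tells the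
  -- `A` side from the `A'` side.
  let R : Bool × (T → Bool) → Set (E d) := fun i => (if i.1 then A else A') ∩ atom i.2
  have hR : ∀ i, MeasurableSet (R i) := fun i => by
    refine MeasurableSet.inter ?_ (hatom _)
    split_ifs
    · exact hA
    · exact hA'
  have hRd : Pairwise (Function.onFun Disjoint R) := by
    rintro ⟨b, σ⟩ ⟨b', σ'⟩ h
    by_cases hσ : σ = σ'
    · have hb : b ≠ b' := fun hb => h (by rw [hb, hσ])
      refine Set.disjoint_of_subset Set.inter_subset_left Set.inter_subset_left ?_
      cases b <;> cases b' <;> simp_all [hAA'.symm]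
    · exact Set.disjoint_of_subset Set.inter_subset_right Set.inter_subset_right (hatomd _ _ hσ)
  have hind := hΨ.iIndepFun_count R hR hRd
  have hind' := indep_iSup_of_disjoint
    (fun i => (hΨ.measurable_count (R i) (hR i)).comap_le) hind
    (S := {i | i.1 = true}) (T := {i | i.1 = false}) (by
      rw [Set.disjoint_left]; rintro i hi hi'; simp_all)
  have hmeas : ∀ (b : Bool) (B : I), B ∈ T →
      Measurable[⨆ i ∈ {i : Bool × (T → Bool) | i.1 = b},
        MeasurableSpace.comap (fun ω => (Ψ ω ∩ R i).encard) inferInstance]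
        fun ω => (Ψ ω ∩ ((if b then A else A') ∩ B)).encard := by
    intro b B hB
    have : ∀ ω, (Ψ ω ∩ ((if b then A else A') ∩ B)).encard =
        ∑ σ : {σ : T → Bool // σ ⟨B, hB⟩ = true}, (Ψ ω ∩ R (b, σ)).encard := by
      intro ω
      rw [← finsum_eq_sum_of_fintype, ← Set.encard_iUnion_of_finite]
      · congr 1
        ext x
        simp only [Set.mem_inter_iff, Set.mem_iUnion, R, atom]
        constructor
        · rintro ⟨hx, hxA, hxB⟩
          refine ⟨⟨fun C => decide (x ∈ (C.1 : Set (E d))), by simpa using hxB⟩, hx, hxA, Set.mem_iInter.2 ?_⟩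
          intro C
          by_cases hC : x ∈ (C.1 : Set (E d)) <;> simp [hC]
        · rintro ⟨⟨σ, hσ⟩, hx, hxA, hC⟩
          have := Set.mem_iInter.1 hC ⟨B, hB⟩
          rw [if_pos hσ] at this
          exact ⟨hx, hxA, this⟩
      · rintro ⟨σ, _⟩ ⟨σ', _⟩ h
        refine Set.disjoint_of_subset Set.inter_subset_right Set.inter_subset_right (hRd ?_)
        simpa using h
    simp_rw [this]
    refine Finset.measurable_sum (M := ℕ∞) _ fun σ _ => ?_
    exact Measurable.of_comap_le (le_iSup₂_of_le (b, σ.1) rfl le_rfl)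
  refine (Indep_iff _ _ _).1 hind' _ _ ?_ ?_
  · refine Finset.measurableSet_biInter _ fun B hB => ?_
    obtain ⟨s, hs, hs'⟩ := hf B hB
    rw [← hs']
    exact hmeas true B (Finset.mem_union_left _ hB) hs
  · refine Finset.measurableSet_biInter _ fun B hB => ?_
    obtain ⟨s, hs, hs'⟩ := hf' B hB
    rw [← hs']
    exact hmeas false B (Finset.mem_union_right _ hB) hs

/-- Events that depend on the points in disjoint sets are independent. -/
lemma measure_biInter_eq_prod [IsProbabilityMeasure P] {ι : Type*} (hΨ : IsPoissonProcess P α Ψ) {A : ι → Set (E d)}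
    (hA : ∀ i, MeasurableSet (A i)) {D : ι → Set Ω}
    (hD : ∀ i, MeasurableSet[countAlgebra Ψ (A i)] (D i)) (T : Finset ι)
    (hd : (T : Set ι).PairwiseDisjoint A) : P (⋂ i ∈ T, D i) = ∏ i ∈ T, P (D i) := by
  classical
  induction T using Finset.induction_on with
  | empty => simp
  | insert j T hj ih =>
    rw [Finset.prod_insert hj, Finset.set_biInter_insert, ← ih (hd.subset (by simp))]
    have hU : MeasurableSet (⋃ i ∈ T, A i) := Finset.measurableSet_biUnion _ fun i _ => hA i
    refine (Indep_iff _ _ _).1 (hΨ.indep_countAlgebra (hA j) hU ?_) _ _ (hD j) ?_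
    · rw [Set.disjoint_iUnion₂_right]
      intro i hi
      exact hd (by simp) (by simp [hi]) (fun h => hj (h ▸ hi))
    · refine Finset.measurableSet_biInter _ fun i hi => ?_
      exact countAlgebra_mono (hA i) (Set.subset_biUnion_of_mem (u := A) (Finset.mem_coe.2 hi)) _ (hD i)

/-! ## Counts -/

/-- This is `1 - exp (-r) ≤ r` for the Poisson parameter `r`. -/
lemma measure_nonempty_le (hΨ : IsPoissonProcess P α Ψ) {B : Set (E d)} (hB : MeasurableSet B)
    (hv : volume B ≠ ⊤) : P {ω | (Ψ ω ∩ B).Nonempty} ≤ ENNReal.ofReal α * volume B := by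
  have h1 : {ω | (Ψ ω ∩ B).Nonempty} = (fun ω => (Ψ ω ∩ B).encard) ⁻¹' {0}ᶜ := by
    ext ω; simp [Set.nonempty_iff_ne_empty]
  rw [h1, ← Measure.map_apply (hΨ.measurable_count B hB) (by measurability), hΨ.law_count B hB hv,
    Measure.map_apply (by fun_prop) (by measurability)]
  set r := α.toNNReal * (volume B).toNNReal with hr
  have h2 : ((fun n : ℕ => (n : ℕ∞)) ⁻¹' {0}ᶜ) = ({0} : Set ℕ)ᶜ := by
    ext n; simp
  have h3 : ENNReal.ofReal α * volume B = ENNReal.ofReal r := by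
    rw [hr, ENNReal.ofReal_coe_nnreal, ENNReal.coe_mul, ENNReal.coe_toNNReal hv]
    rfl
  rw [h2, measure_compl (measurableSet_singleton 0) (measure_ne_top _ _), measure_univ,
    poissonMeasure_singleton, h3]
  simp only [pow_zero, mul_one, Nat.factorial_zero, Nat.cast_one, div_one]
  rw [← ENNReal.ofReal_one, ← ENNReal.ofReal_sub _ (Real.exp_pos _).le]
  refine ENNReal.ofReal_le_ofReal ?_
  have := Real.add_one_le_exp (-(r : ℝ))
  linarith

end IsPoissonProcess

lemma ENNReal.tsum_pi_prod {ι : Type*} {n : ℕ} (f : Fin n → ι → ENNReal) :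
    ∑' c : Fin n → ι, ∏ i, f i (c i) = ∏ i, ∑' j, f i j := by
  induction n with
  | zero => simp
  | succ n ih =>
    rw [← (Fin.consEquiv (fun _ => ι)).tsum_eq, ENNReal.tsum_prod', Fin.prod_univ_succ,
      ← ih (fun i => f i.succ), ← ENNReal.tsum_mul_right]
    refine tsum_congr fun j => ?_
    rw [← ENNReal.tsum_mul_left]
    refine tsum_congr fun c => ?_
    simp [Fin.consEquiv, Fin.prod_univ_succ]

/-! ### Distinct points of the process in prescribed sets -/

section Hitting

variable {d : ℕ}

/-- The index of the cell of side `1 / m` that contains `x`. -/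
noncomputable def cellIndex (m : ℕ) (x : E d) : Fin d → ℤ := fun i => ⌊(m : ℝ) * x i⌋

lemma measurable_cellIndex (m : ℕ) : Measurable (cellIndex (d := d) m) :=
  measurable_pi_lambda _ fun i => Int.measurable_floor.comp (by fun_prop)

lemma eventually_cellIndex_ne {x y : E d} (h : x ≠ y) :
    ∀ᶠ m in Filter.atTop, cellIndex m x ≠ cellIndex m y := by
  obtain ⟨i, hi⟩ : ∃ i, x i ≠ y i := by
    by_contra! hc
    exact h (by ext i; exact hc i)
  obtain ⟨N, hN⟩ := exists_nat_gt (1 / |x i - y i|)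
  filter_upwards [Filter.eventually_ge_atTop N] with m hm heq
  have h1 := Int.abs_sub_lt_one_of_floor_eq_floor (congrFun heq i)
  rw [← mul_sub, abs_mul, Nat.abs_cast] at h1
  have hpos : 0 < |x i - y i| := abs_pos.2 (sub_ne_zero.2 hi)
  rw [div_lt_iff₀ hpos] at hN
  have hm' : (N : ℝ) ≤ m := by exact_mod_cast hm
  nlinarith

/-- There are distinct points `pᵢ ∈ φ ∩ Aᵢ`. -/
def HitsDistinct {n : ℕ} (φ : Set (E d)) (A : Fin n → Set (E d)) : Prop :=
  ∃ p : Fin n → E d, Function.Injective p ∧ ∀ i, p i ∈ φ ∩ A i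

variable {Ω : Type*} {Ψ : Ω → Set (E d)} {n : ℕ} {A : Fin n → Set (E d)}

/-- Fine grids separate distinct points. Although the `A i` may overlap, the event thereby reduces
to hitting disjoint sets, where counts are independent. -/
lemma hitsDistinct_iff_eventually {φ : Set (E d)} :
    HitsDistinct φ A ↔ ∃ M : ℕ, ∀ m ≥ M, ∃ c : Fin n → Fin d → ℤ, Function.Injective c ∧
      ∀ i, (φ ∩ (A i ∩ cellIndex m ⁻¹' {c i})).Nonempty := by
  constructor
  · rintro ⟨p, hinj, hp⟩
    have : ∀ᶠ m in Filter.atTop, ∀ i j, i ≠ j → cellIndex m (p i) ≠ cellIndex m (p j) := by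
      rw [Filter.eventually_all]
      intro i
      rw [Filter.eventually_all]
      intro j
      by_cases hij : i = j
      · simp [hij]
      · filter_upwards [eventually_cellIndex_ne (hinj.ne hij)] with m hm _ using hm
    obtain ⟨M, hM⟩ := Filter.eventually_atTop.1 this
    refine ⟨M, fun m hm => ⟨fun i => cellIndex m (p i), fun i j hij => ?_,
      fun i => ⟨p i, (hp i).1, (hp i).2, rfl⟩⟩⟩
    by_contra hne
    exact hM m hm i j hne hij
  · rintro ⟨M, hM⟩
    obtain ⟨c, hc, h⟩ := hM M le_rfl
    choose p hp using h
    refine ⟨p, fun i j hij => hc ?_, fun i => ⟨(hp i).1, (hp i).2.1⟩⟩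
    have h1 := (hp i).2.2
    have h2 := (hp j).2.2
    rw [hij] at h1
    exact h1.symm.trans h2

/-- There are points of `φ` in the parts of the sets `Aᵢ` in the distinct cells `cᵢ`. -/
def HitsCells (φ : Set (E d)) (A : Fin n → Set (E d)) (m : ℕ) (c : Fin n → Fin d → ℤ) : Prop :=
  Function.Injective c ∧ ∀ i, (φ ∩ (A i ∩ cellIndex m ⁻¹' {c i})).Nonempty

lemma setOf_hitsDistinct_eq : {ω | HitsDistinct (Ψ ω) A} =
    ⋃ M : ℕ, ⋂ m ≥ M, ⋃ c : Fin n → Fin d → ℤ, {ω | HitsCells (Ψ ω) A m c} := by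
  ext ω
  simp only [Set.mem_ofPred_eq, hitsDistinct_iff_eventually, Set.mem_iUnion, Set.mem_iInter,
    HitsCells]

lemma measurableSet_hitsDistinct (hA : ∀ i, MeasurableSet (A i)) {B : Set (E d)}
    (hAB : ∀ i, A i ⊆ B) : MeasurableSet[countAlgebra Ψ B] {ω | HitsDistinct (Ψ ω) A} := by
  rw [setOf_hitsDistinct_eq]
  refine MeasurableSet.iUnion fun M => MeasurableSet.iInter fun m => MeasurableSet.iInter fun _ =>
    MeasurableSet.iUnion fun c => ?_
  have : {ω | HitsCells (Ψ ω) A m c} = {_ω | Function.Injective c} ∩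
      ⋂ i, (fun ω => (Ψ ω ∩ (A i ∩ cellIndex m ⁻¹' {c i})).encard) ⁻¹' {0}ᶜ := by
    ext ω
    simp [HitsCells, Set.nonempty_iff_ne_empty]
  rw [this]
  refine MeasurableSet.inter (MeasurableSet.const _) (MeasurableSet.iInter fun i => ?_)
  exact measurable_count_countAlgebra ((hA i).inter (measurable_cellIndex m
    (measurableSet_singleton _))) (Set.inter_subset_left.trans (hAB i)) (by measurability)

end Hitting

namespace IsPoissonProcess

variable {d : ℕ} {Ω : Type*} [MeasurableSpace Ω] {P : Measure Ω}
  {α : ℝ} {Ψ : Ω → Set (E d)}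

lemma mgf_poissonMeasure (r : NNReal) (t : ℝ) :
    mgf (fun n : ℕ => (n : ℝ)) (poissonMeasure r) t = Real.exp (r * (Real.exp t - 1)) ∧
    Integrable (fun n : ℕ => Real.exp (t * n)) (poissonMeasure r) := by
  have hs : HasSum (fun n : ℕ => (Real.exp (-r) * r ^ n / n.factorial) • Real.exp (t * n))
      (Real.exp (r * (Real.exp t - 1))) := by
    have h1 := (NormedSpace.expSeries_div_hasSum_exp (r * Real.exp t : ℝ)).mul_left (Real.exp (-r))
    rw [← Real.exp_eq_exp_ℝ, ← Real.exp_add] at h1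
    rw [show (r : ℝ) * (Real.exp t - 1) = -r + r * Real.exp t by ring]
    refine h1.congr_fun fun n => ?_
    rw [smul_eq_mul, mul_pow, ← Real.exp_nat_mul, mul_comm (n : ℝ) t]
    ring
  have hint : Integrable (fun n : ℕ => Real.exp (t * n)) (poissonMeasure r) := by
    rw [integrable_poissonMeasure_iff]
    simpa [abs_of_nonneg (Real.exp_pos _).le] using hs.summable
  exact ⟨by rw [mgf, integral_poissonMeasure]; exact hs.tsum_eq, hint⟩

/-- Lower tail bound for the number of points in a set. -/
lemma measure_ncard_le (hΨ : IsPoissonProcess P α Ψ) (hα : 0 ≤ α) {B : Set (E d)}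
    (hB : MeasurableSet B) (hv : volume B ≠ ⊤) {ε : ℝ} (hε : 0 ≤ ε) :
    P {ω | ((Ψ ω ∩ B).ncard : ℝ) ≤ (1 - ε) * (α * volume.real B)} ≤
      ENNReal.ofReal (Real.exp (-(ε ^ 2 / 2 * (α * volume.real B)))) := by
  set r := α.toNNReal * (volume B).toNNReal with hr
  have hr' : α * volume.real B = r := by
    rw [hr, NNReal.coe_mul, Real.coe_toNNReal α hα]; rfl
  rw [hr']
  have h1 : {ω | ((Ψ ω ∩ B).ncard : ℝ) ≤ (1 - ε) * r} =
      (fun ω => (Ψ ω ∩ B).encard) ⁻¹' {n | (n.toNat : ℝ) ≤ (1 - ε) * r} := rfl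
  rw [h1, ← Measure.map_apply (hΨ.measurable_count B hB) (by measurability), hΨ.law_count B hB hv,
    Measure.map_apply (by fun_prop) (by measurability), ← hr]
  have h2 : (fun n : ℕ => (n : ℕ∞)) ⁻¹' {n | (n.toNat : ℝ) ≤ (1 - ε) * r} =
    {n : ℕ | (n : ℝ) ≤ (1 - ε) * r} := by ext n; simp
  rw [h2]
  -- Chernoff bound with the convenient, not optimal, parameter `-ε`: with `exp (-ε) ≤ 1 - ε + ε ^ 2
  -- / 2` the exponent is at most `-ε ^ 2 / 2 * r`.
  have h3 := measure_le_le_exp_mul_mgf (μ := poissonMeasure r) (X := fun n : ℕ => (n : ℝ))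
    ((1 - ε) * r) (t := -ε) (by linarith) (mgf_poissonMeasure r _).2
  rw [(mgf_poissonMeasure r _).1, ← Real.exp_add] at h3
  rw [← ofReal_measureReal]
  refine ENNReal.ofReal_le_ofReal (h3.trans (Real.exp_le_exp.2 ?_))
  have h4 : Real.exp (-ε) ≤ 1 - ε + ε ^ 2 / 2 := by
    have h5 := Real.quadratic_le_exp_of_nonneg hε
    rw [Real.exp_neg, inv_le_comm₀ (Real.exp_pos _) (by nlinarith [sq_nonneg (1 - ε)])]
    refine le_trans ?_ h5
    rw [inv_le_iff_one_le_mul₀ (by nlinarith [sq_nonneg (1 - ε)])]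
    nlinarith [sq_nonneg (ε ^ 2)]
  have hr0 : (0 : ℝ) ≤ r := r.2
  nlinarith

lemma measure_hitsCells_le (hΨ : IsPoissonProcess P α Ψ) {n : ℕ} {A : Fin n → Set (E d)}
    (hA : ∀ i, MeasurableSet (A i)) (hv : ∀ i, volume (A i) ≠ ⊤) (m : ℕ)
    (c : Fin n → Fin d → ℤ) : P {ω | HitsCells (Ψ ω) A m c} ≤
      ∏ i, (ENNReal.ofReal α * volume (A i ∩ cellIndex m ⁻¹' {c i})) := by
  by_cases hc : Function.Injective c
  · have hM : ∀ i, MeasurableSet (A i ∩ cellIndex m ⁻¹' {c i}) := fun i =>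
      (hA i).inter (measurable_cellIndex m (measurableSet_singleton _))
    have hd : Pairwise (Function.onFun Disjoint fun i => A i ∩ cellIndex m ⁻¹' {c i}) := by
      intro i j hij
      refine Set.disjoint_of_subset Set.inter_subset_right Set.inter_subset_right ?_
      rw [Set.disjoint_left]
      intro x hx hx'
      exact hij (hc (hx.symm.trans hx'))
    have h1 := (hΨ.iIndepFun_count _ hM hd).measure_inter_preimage_eq_mul Finset.univ
      (sets := fun _ => {0}ᶜ) (fun _ _ => by measurability)
    have h2 : ∀ i, (fun ω => (Ψ ω ∩ (A i ∩ cellIndex m ⁻¹' {c i})).encard) ⁻¹' {0}ᶜ =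
        {ω | (Ψ ω ∩ (A i ∩ cellIndex m ⁻¹' {c i})).Nonempty} := by
      intro i; ext ω; simp [Set.nonempty_iff_ne_empty]
    simp only [h2, Finset.mem_univ, Set.iInter_true] at h1
    calc P {ω | HitsCells (Ψ ω) A m c}
        ≤ P (⋂ i, {ω | (Ψ ω ∩ (A i ∩ cellIndex m ⁻¹' {c i})).Nonempty}) :=
          measure_mono fun ω hω => Set.mem_iInter.2 hω.2
      _ = _ := h1
      _ ≤ _ := Finset.prod_le_prod' fun i _ => hΨ.measure_nonempty_le (hM i)
          (ne_top_of_le_ne_top (hv i) (measure_mono Set.inter_subset_left))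
  · have : {ω | HitsCells (Ψ ω) A m c} = ∅ := by
      ext ω; simp [HitsCells, hc]
    simp [this]

/-- The probability that distinct points of a Poisson process can be found in the sets `Aᵢ` is
at most the product of their intensities. -/
lemma measure_hitsDistinct_le (hΨ : IsPoissonProcess P α Ψ) {n : ℕ} {A : Fin n → Set (E d)}
    (hA : ∀ i, MeasurableSet (A i)) (hv : ∀ i, volume (A i) ≠ ⊤) :
    P {ω | HitsDistinct (Ψ ω) A} ≤ ∏ i, (ENNReal.ofReal α * volume (A i)) := by
  -- Summing over all cell choices factorises, and the cells partition each `A i`; the bound is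
  -- therefore uniform in the mesh and passes to the monotone limit.
  have hm : ∀ m, P (⋃ c : Fin n → Fin d → ℤ, {ω | HitsCells (Ψ ω) A m c}) ≤
      ∏ i, (ENNReal.ofReal α * volume (A i)) := by
    intro m
    refine (measure_iUnion_le _).trans ((ENNReal.tsum_le_tsum fun c =>
      hΨ.measure_hitsCells_le hA hv m c).trans (le_of_eq ?_))
    rw [ENNReal.tsum_pi_prod (fun i (j : Fin d → ℤ) =>
      ENNReal.ofReal α * volume (A i ∩ cellIndex m ⁻¹' {j}))]
    refine Finset.prod_congr rfl fun i _ => ?_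
    rw [ENNReal.tsum_mul_left, ← measure_iUnion]
    · congr 2
      ext x
      simp
    · intro j j' hj
      refine Set.disjoint_of_subset Set.inter_subset_right Set.inter_subset_right ?_
      rw [Set.disjoint_left]
      intro x hx hx'
      exact hj (hx.symm.trans hx')
    · exact fun j => (hA i).inter (measurable_cellIndex m (measurableSet_singleton _))
  rw [setOf_hitsDistinct_eq, Monotone.measure_iUnion]
  · exact iSup_le fun M => (measure_mono (Set.iInter₂_subset M le_rfl)).trans (hm M)
  · intro M M' hM
    exact Set.iInter₂_mono' fun m hm => ⟨m, hM.trans hm, le_rfl⟩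

end IsPoissonProcess

/-! ## The lattice -/

section Lattice

variable {d : ℕ}

/-- The lattice point with given coordinates. -/
noncomputable def latticePoint (z : Fin d → ℤ) : E d := WithLp.toLp 2 fun i => (z i : ℝ)

@[simp] lemma latticePoint_apply (z : Fin d → ℤ) (i : Fin d) : latticePoint z i = z i := rfl

lemma latticePoint_injective : Function.Injective (latticePoint (d := d)) := by
  intro z z' h
  funext i
  have := congrArg (fun x : E d => x i) h
  simpa using this

lemma range_latticePoint : Set.range (latticePoint (d := d)) = integerLattice d := by
  ext x
  constructor
  · rintro ⟨z, rfl⟩ i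
    exact ⟨z i, rfl⟩
  · intro h
    choose z hz using h
    exact ⟨z, by ext i; exact (hz i).symm⟩

lemma countable_integerLattice : (integerLattice d).Countable :=
  range_latticePoint (d := d) ▸ Set.countable_range _

lemma latticePoint_mem (z : Fin d → ℤ) : latticePoint z ∈ integerLattice d := fun i => ⟨z i, rfl⟩

lemma zero_mem_integerLattice : (0 : E d) ∈ integerLattice d := fun _ => ⟨0, by simp⟩

lemma sub_mem_integerLattice {x y : E d} (hx : x ∈ integerLattice d) (hy : y ∈ integerLattice d) :
    x - y ∈ integerLattice d := fun i => by
  obtain ⟨n, hn⟩ := hx i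
  obtain ⟨m, hm⟩ := hy i
  exact ⟨n - m, by simp [hn, hm]⟩

/-- The volume of the unit ball. -/
noncomputable def unitBallVolume (d : ℕ) : ℝ := volume.real (Metric.ball (0 : E d) 1)

lemma unitBallVolume_pos (d : ℕ) : 0 < unitBallVolume d :=
  ENNReal.toReal_pos (Metric.measure_ball_pos _ _ one_pos).ne' measure_ball_lt_top.ne

lemma volume_closedBall_eq (x : E d) {r : ℝ} (hr : 0 ≤ r) :
    volume (Metric.closedBall x r) = ENNReal.ofReal (unitBallVolume d * r ^ d) := by
  rw [Measure.addHaar_closedBall _ _ hr, finrank_euclideanSpace_fin, unitBallVolume, mul_comm,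
    ENNReal.ofReal_mul measureReal_nonneg, ofReal_measureReal measure_ball_lt_top.ne]

lemma volume_ball_eq (hd : 1 ≤ d) (x : E d) {r : ℝ} (hr : 0 ≤ r) :
    volume (Metric.ball x r) = ENNReal.ofReal (unitBallVolume d * r ^ d) := by
  have : Nonempty (Fin d) := ⟨⟨0, hd⟩⟩
  rw [Measure.addHaar_ball _ _ hr, finrank_euclideanSpace_fin, unitBallVolume, mul_comm,
    ENNReal.ofReal_mul measureReal_nonneg, ofReal_measureReal measure_ball_lt_top.ne]

lemma volume_unit_cell (z : Fin d → ℤ) : volume (cellIndex 1 ⁻¹' {z} : Set (E d)) = 1 := by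
  have h1 : (WithLp.toLp 2 : (Fin d → ℝ) → E d) ⁻¹' (cellIndex 1 ⁻¹' {z}) =
      Set.pi Set.univ fun i => Set.Ico (z i : ℝ) (z i + 1) := by
    ext x
    simp [cellIndex, funext_iff, Int.floor_eq_iff]
  rw [← (PiLp.volume_preserving_toLp (Fin d)).measure_preimage
    (measurable_cellIndex 1 (measurableSet_singleton _)).nullMeasurableSet, h1, volume_pi_pi]
  simp

lemma norm_sub_latticePoint_le {z : Fin d → ℤ} {x : E d} (hx : cellIndex 1 x = z) :
    ‖x - latticePoint z‖ ≤ √d := by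
  rw [EuclideanSpace.norm_eq]
  refine Real.sqrt_le_sqrt ?_
  calc ∑ i, ‖(x - latticePoint z) i‖ ^ 2 ≤ ∑ _i : Fin d, (1 : ℝ) := by
        refine Finset.sum_le_sum fun i _ => ?_
        have h1 : ⌊x i⌋ = z i := by simpa [cellIndex] using congrFun hx i
        have h2 := Int.floor_le (x i)
        have h3 := Int.lt_floor_add_one (x i)
        rw [h1] at h2 h3
        simp only [PiLp.sub_apply, latticePoint_apply, Real.norm_eq_abs, sq_abs]
        nlinarith
    _ = d := by simp

/-- The unit cells of the lattice points are disjoint, have volume one, and lie in the ball enlarged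
by `√d`. -/
lemma card_le_of_subset_closedBall (T : Finset (E d)) {z : E d} {ρ : ℝ} (hρ : 0 ≤ ρ)
    (hT : (T : Set (E d)) ⊆ integerLattice d ∩ Metric.closedBall z ρ) :
    (T.card : ℝ) ≤ unitBallVolume d * (ρ + √d) ^ d := by
  classical
  let S := T.preimage latticePoint latticePoint_injective.injOn
  have hS : T = S.image latticePoint := by
    ext x
    simp only [S, Finset.mem_image, Finset.mem_preimage]
    constructor
    · intro hx
      obtain ⟨w, rfl⟩ := range_latticePoint (d := d) ▸ (hT hx).1
      exact ⟨w, hx, rfl⟩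
    · rintro ⟨w, hw, rfl⟩; exact hw
  have hc : T.card = S.card := by rw [hS, Finset.card_image_of_injective _ latticePoint_injective]
  have h1 : volume (⋃ w ∈ S, (cellIndex 1 ⁻¹' {w} : Set (E d))) = S.card := by
    rw [measure_biUnion_finset]
    · simp [volume_unit_cell]
    · intro w _ w' _ h
      change Disjoint _ _
      rw [Set.disjoint_left]
      intro x hx hx'
      exact h (hx.symm.trans hx')
    · exact fun w _ => measurable_cellIndex 1 (measurableSet_singleton _)
  have h2 : (⋃ w ∈ S, (cellIndex 1 ⁻¹' {w} : Set (E d))) ⊆ Metric.closedBall z (ρ + √d) := by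
    refine Set.iUnion₂_subset fun w hw x hx => ?_
    have h3 := norm_sub_latticePoint_le hx
    have h4 : latticePoint w ∈ Metric.closedBall z ρ := by
      refine (hT ?_).2
      rw [hS]; exact Finset.mem_coe.2 (Finset.mem_image_of_mem _ hw)
    rw [Metric.mem_closedBall, dist_eq_norm] at h4 ⊢
    calc ‖x - z‖ ≤ ‖x - latticePoint w‖ + ‖latticePoint w - z‖ :=
          norm_sub_le_norm_sub_add_norm_sub _ _ _
      _ ≤ _ := by linarith
  have h3 := measure_mono (μ := volume) h2
  have hpos := unitBallVolume_pos d
  rw [h1, volume_closedBall_eq _ (by positivity), ← ENNReal.ofReal_natCast,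
    ENNReal.ofReal_le_ofReal_iff (by positivity)] at h3
  rwa [hc]

lemma isLocallyFinite_integerLattice : IsLocallyFinite (integerLattice d) := by
  intro B hB
  obtain ⟨ρ, hρ, hBρ⟩ := hB.exists_pos_norm_le
  by_contra hinf
  obtain ⟨T, hT, hc⟩ := Set.Infinite.exists_subset_card_eq hinf
    (⌊unitBallVolume d * (ρ + √d) ^ d⌋₊ + 1)
  have h1 := card_le_of_subset_closedBall (z := 0) T hρ.le (hT.trans
    (Set.inter_subset_inter_right _ fun x hx => by simpa using hBρ x hx))
  rw [hc] at h1
  have := Nat.lt_floor_add_one (unitBallVolume d * (ρ + √d) ^ d)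
  push_cast at h1
  linarith

lemma ncard_integerLattice_le (z : E d) {ρ : ℝ} (hρ : 0 ≤ ρ) :
    ((integerLattice d ∩ Metric.closedBall z ρ).ncard : ℝ) ≤ unitBallVolume d * (ρ + √d) ^ d := by
  have hfin := isLocallyFinite_integerLattice (Metric.closedBall z ρ) Metric.isBounded_closedBall
  rw [Set.ncard_eq_toFinset_card _ hfin]
  exact card_le_of_subset_closedBall (z := z) _ hρ (by rw [Set.Finite.coe_toFinset])

end Lattice

/-! ## The probability of long descending chains -/

section LevelChain

variable {d : ℕ}

/-- Adding `i` to `K - 1 - l i` makes the sequence strictly increasing. It is then determined by its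
range, a subset of `{0, …, n + K - 1}`. -/
lemma card_antitone_le (n K : ℕ) :
    Fintype.card {l : Fin n → Fin K // Antitone l} ≤ 2 ^ (n + K) := by
  classical
  let g : {l : Fin n → Fin K // Antitone l} → Fin n → ℕ := fun l i => (K - 1 - l.1 i) + i
  have hg : ∀ l, StrictMono (g l) := by
    intro l i j hij
    have h1 : l.1 j ≤ l.1 i := l.2 hij.le
    have h2 : (l.1 j : ℕ) ≤ l.1 i := h1
    have h3 : (i : ℕ) < j := hij
    simp only [g]
    lia
  have hlt : ∀ l i, g l i < n + K := by
    intro l i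
    have := (l.1 i).2
    have := i.2
    simp only [g]
    lia
  rw [show 2 ^ (n + K) = (Finset.range (n + K)).powerset.card by simp, ← Finset.card_univ]
  refine Finset.card_le_card_of_injOn (fun l => Finset.univ.image (g l)) ?_ ?_
  · intro l _
    simp only [Finset.coe_powerset, Set.mem_preimage, Set.mem_powerset_iff, Finset.coe_subset]
    intro x hx
    obtain ⟨i, -, rfl⟩ := Finset.mem_image.1 hx
    exact Finset.mem_range.2 (hlt l i)
  · intro l _ l' _ h
    have h1 : Set.range (g l) = Set.range (g l') := by
      simpa using congrArg (fun s : Finset ℕ => (s : Set ℕ)) h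
    have h2 := (StrictMono.range_inj (hg l) (hg l')).1 h1
    refine Subtype.ext (funext fun i => Fin.ext ?_)
    have h3 := congrFun h2 i
    have := (l.1 i).2
    have := (l'.1 i).2
    simp only [g] at h3
    lia

/-- The points `p` within distance `R` of `q` such that `‖p - q‖ ^ d / v` has integer part `l`. -/
def annulus (R v : ℝ) (q : E d) (l : ℕ) : Set (E d) :=
  {p | ‖p - q‖ ≤ R ∧ ⌊‖p - q‖ ^ d / v⌋₊ = l}

lemma measurableSet_annulus (R v : ℝ) (q : E d) (l : ℕ) : MeasurableSet (annulus R v q l) := by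
  refine MeasurableSet.inter (s₁ := {p | ‖p - q‖ ≤ R}) (s₂ := {p | ⌊‖p - q‖ ^ d / v⌋₊ = l})
    (measurableSet_le (by fun_prop) (by fun_prop)) ?_
  have : Measurable fun p : E d => ⌊‖p - q‖ ^ d / v⌋₊ := Nat.measurable_floor.comp (by fun_prop)
  exact this (measurableSet_singleton l)

/-- Levels are cut by `‖p - q‖ ^ d`, so every full shell has volume `κ v`, with `κ` the volume of
the unit ball, whatever the level. The bound for a chain then does not depend on its levels. -/
lemma volume_annulus_le (hd : 1 ≤ d) (R : ℝ) {v : ℝ} (hv : 0 < v) (q : E d) (l : ℕ) :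
    volume (annulus R v q l) ≤ ENNReal.ofReal (unitBallVolume d * v) := by
  have hd0 : d ≠ 0 := by lia
  have hκ := unitBallVolume_pos d
  have hpow : ∀ t : ℝ, 0 ≤ t → (t ^ ((d : ℝ)⁻¹)) ^ d = t := fun t ht =>
    Real.rpow_inv_natCast_pow ht hd0
  have h0 : (0 : ℝ) ≤ l * v := by positivity
  have h1 : (0 : ℝ) ≤ (l + 1) * v := by positivity
  have hsub : annulus R v q l ⊆ Metric.ball q (((l + 1) * v) ^ ((d : ℝ)⁻¹)) \
      Metric.ball q ((l * v) ^ ((d : ℝ)⁻¹)) := by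
    rintro p ⟨-, hp⟩
    rw [Nat.floor_eq_iff (by positivity), le_div_iff₀ hv, div_lt_iff₀ hv] at hp
    rw [Set.mem_sdiff, Metric.mem_ball, Metric.mem_ball, dist_eq_norm, not_lt]
    constructor
    · refine lt_of_pow_lt_pow_left₀ d (by positivity) ?_
      rw [hpow _ h1]; exact hp.2
    · refine le_of_pow_le_pow_left₀ hd0 (norm_nonneg _) ?_
      rw [hpow _ h0]; exact hp.1
  refine (measure_mono hsub).trans ?_
  rw [measure_sdiff (Metric.ball_subset_ball (Real.rpow_le_rpow h0 (by nlinarith) (by positivity)))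
    measurableSet_ball.nullMeasurableSet measure_ball_lt_top.ne, volume_ball_eq hd _ (by positivity),
    volume_ball_eq hd _ (by positivity), hpow _ h0, hpow _ h1,
    ← ENNReal.ofReal_sub _ (by positivity)]
  refine ENNReal.ofReal_le_ofReal (le_of_eq ?_)
  ring

/-- The lattice path with given initial point and steps. -/
noncomputable def latticePath {n : ℕ} (q₀ : E d) (u : Fin n → E d) (i : ℕ) : E d :=
  q₀ + ∑ j ∈ Finset.range i, if h : j < n then u ⟨j, h⟩ else 0

/-- Lattice points within distance `ρ` of `z`. -/
def latticeBall (z : E d) (ρ : ℝ) : Set (E d) := integerLattice d ∩ Metric.closedBall z ρ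

instance finite_latticeBall (z : E d) (ρ : ℝ) : Finite (latticeBall z ρ) :=
  isLocallyFinite_integerLattice (Metric.closedBall z ρ) Metric.isBounded_closedBall

/-- A coarse version of `LongChain`, in which only the levels of the distances are recorded. -/
def LevelChain (φ : Set (E d)) (z : E d) (R v : ℝ) (n : ℕ) : Prop :=
  ∃ (q₀ : latticeBall z (2 * R)) (u : Fin n → latticeBall (0 : E d) (2 * R))
    (l : {l : Fin n → Fin (⌊R ^ d / v⌋₊ + 1) // Antitone l}),
    HitsDistinct φ fun i : Fin n =>
      annulus R v (latticePath (q₀ : E d) (fun i => (u i : E d)) i) (l.1 i)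

/-- Only the lattice path and the levels of the distances are kept, which makes the event a finite
union. The levels are antitone because the distances decrease. -/
lemma LongChain.levelChain {φ : Set (E d)} {z : E d} {R v : ℝ} (hv : 0 < v) {n : ℕ}
    (hn : 0 < n) (h : LongChain φ (integerLattice d) z R n) : LevelChain φ z R v n := by
  obtain ⟨p, q, h0, h1, hinj, h2⟩ := h
  have hR : 0 ≤ R := (norm_nonneg _).trans (h1 0 hn).2.2
  -- The chain does not control `q n`; the last increment is set to `0` and is never used by the
  -- path.
  have hu : ∀ i : Fin n, (if (i : ℕ) + 1 < n then q (i + 1) - q i else 0) ∈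
      latticeBall (0 : E d) (2 * R) := by
    intro i
    split_ifs with hi
    · refine ⟨sub_mem_integerLattice (h1 _ hi).1 (h1 _ i.2).1, ?_⟩
      rw [mem_closedBall_zero_iff]
      have : q (i + 1) - q i = (p i - q i) - (p i - q (i + 1)) := by abel
      rw [this]
      exact (norm_sub_le _ _).trans (by linarith [(h1 _ i.2).2.2, (h2 _ hi).1])
    · exact ⟨zero_mem_integerLattice, by simpa using hR⟩
  have hanti : ∀ i j, i ≤ j → j < n → ‖p j - q j‖ ≤ ‖p i - q i‖ := by
    intro i j hij
    induction j, hij using Nat.le_induction with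
    | base => exact fun _ => le_rfl
    | succ j _ ih => exact fun hj => ((h2 j hj).2).trans (ih (by lia))
  have hlev : ∀ i : Fin n, ⌊‖p i - q i‖ ^ d / v⌋₊ < ⌊R ^ d / v⌋₊ + 1 := by
    intro i
    refine Nat.lt_succ_of_le (Nat.floor_mono ?_)
    have := (h1 i i.2).2.2
    gcongr
  refine ⟨⟨q 0, (h1 0 hn).1, by rwa [Metric.mem_closedBall, dist_eq_norm]⟩, fun i => ⟨_, hu i⟩,
    ⟨fun i => ⟨_, hlev i⟩, fun i j hij => ?_⟩, fun i => p i, ?_, fun i => ⟨(h1 i i.2).2.1, ?_⟩⟩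
  · refine Nat.floor_mono ?_
    have := hanti i j hij j.2
    gcongr
  · intro i j hij
    exact Fin.ext (hinj i.2 j.2 hij)
  · have hpath : latticePath (q 0) (fun i : Fin n => if (i : ℕ) + 1 < n then q (i + 1) - q i else 0) i
        = q i := by
      rw [latticePath, Finset.sum_congr rfl (g := fun j => q (j + 1) - q j), Finset.sum_range_sub]
      · abel
      · intro j hj
        have hj' : j < (i : ℕ) := Finset.mem_range.1 hj
        have := i.2
        rw [dif_pos (by lia), if_pos (by simp only; lia)]
    simp only [annulus, Set.mem_ofPred_eq, hpath, and_true]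
    exact (h1 i i.2).2.2

/-- Start within `2 R`, make at most `n` steps of length `2 R`, then move by `R`. This is the window
radius of `isMatchedPair_inter_iff`, so one ball carries both the chain event and the matching
event. -/
lemma annulus_subset_closedBall {n : ℕ} {z : E d} {R v : ℝ} (hR : 0 ≤ R)
    (q₀ : latticeBall z (2 * R)) (u : Fin n → latticeBall (0 : E d) (2 * R)) (i : Fin n) (l : ℕ) :
    annulus R v (latticePath (q₀ : E d) (fun i => (u i : E d)) i) l ⊆
      Metric.closedBall z ((2 * n + 3) * R) := by
  rintro p ⟨hp, -⟩
  have hq : ∀ i : ℕ, ‖latticePath (q₀ : E d) (fun i => (u i : E d)) i - z‖ ≤ 2 * R + i * (2 * R) := by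
    intro i
    rw [latticePath, add_sub_right_comm]
    refine (norm_add_le _ _).trans (add_le_add ?_ ?_)
    · have := q₀.2.2
      rwa [Metric.mem_closedBall, dist_eq_norm] at this
    · refine (norm_sum_le _ _).trans ((Finset.sum_le_card_nsmul _ _ (2 * R) fun j _ => ?_).trans ?_)
      · split_ifs with h
        · have := (u ⟨j, h⟩).2.2
          rwa [mem_closedBall_zero_iff] at this
        · simpa using hR
      · simp
  rw [Metric.mem_closedBall, dist_eq_norm]
  have h1 := hq i
  have h2 : ((i : ℕ) : ℝ) ≤ n := by exact_mod_cast i.2.le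
  calc ‖p - z‖ ≤ _ := norm_sub_le_norm_sub_add_norm_sub _
        (latticePath (q₀ : E d) (fun i => (u i : E d)) i) _
    _ ≤ R + (2 * R + i * (2 * R)) := add_le_add hp h1
    _ ≤ R + (2 * R + n * (2 * R)) := by gcongr
    _ = _ := by ring

lemma setOf_levelChain_eq {Ω : Type*} {Ψ : Ω → Set (E d)} {z : E d} {R v : ℝ} {n : ℕ} :
    {ω | LevelChain (Ψ ω) z R v n} = ⋃ (q₀ : latticeBall z (2 * R))
      (u : Fin n → latticeBall (0 : E d) (2 * R))
      (l : {l : Fin n → Fin (⌊R ^ d / v⌋₊ + 1) // Antitone l}),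
      {ω | HitsDistinct (Ψ ω) fun i : Fin n =>
        annulus R v (latticePath (q₀ : E d) (fun i => (u i : E d)) i) (l.1 i)} := by
  ext ω
  simp only [LevelChain, Set.mem_ofPred_eq, Set.mem_iUnion]

lemma measurableSet_levelChain {Ω : Type*} {Ψ : Ω → Set (E d)} {z : E d} {R v : ℝ} (hR : 0 ≤ R)
    {n : ℕ} : MeasurableSet[countAlgebra Ψ (Metric.closedBall z ((2 * n + 3) * R))]
      {ω | LevelChain (Ψ ω) z R v n} := by
  rw [setOf_levelChain_eq]
  exact MeasurableSet.iUnion fun q₀ => MeasurableSet.iUnion fun u => MeasurableSet.iUnion fun l =>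
    measurableSet_hitsDistinct (fun i => measurableSet_annulus _ _ _ _)
      fun i => annulus_subset_closedBall hR _ _ _ _

/-- Union bound: at most `N` initial points, `N ^ n` sequences of steps and `2 ^ (n + K)` antitone
level sequences, where `K` is the number of levels, each hit with probability at most `(α κ v) ^ n`.
-/
lemma IsPoissonProcess.measure_levelChain_le {Ω : Type*} [MeasurableSpace Ω] {P : Measure Ω}
    {α : ℝ} {Ψ : Ω → Set (E d)} (hΨ : IsPoissonProcess P α Ψ) (hd : 1 ≤ d) (hα : 0 ≤ α) (z : E d)
    {R v N : ℝ} (hR : 0 ≤ R) (hv : 0 < v) (hN : unitBallVolume d * (2 * R + √d) ^ d ≤ N) (n : ℕ) :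
    P {ω | LevelChain (Ψ ω) z R v n} ≤
      ENNReal.ofReal (N * N ^ n * 2 ^ (n + (⌊R ^ d / v⌋₊ + 1)) * (α * (unitBallVolume d * v)) ^ n) := by
  classical
  have hκ := unitBallVolume_pos d
  have hcard : ∀ z : E d, ((Nat.card (latticeBall z (2 * R)) : ℕ) : ENNReal) ≤ ENNReal.ofReal N := by
    intro z
    rw [← ENNReal.ofReal_natCast]
    refine ENNReal.ofReal_le_ofReal (le_trans ?_ hN)
    exact ncard_integerLattice_le z (by positivity)
  have hN0 : 0 ≤ N := le_trans (by positivity) hN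
  have hfin : ∀ z : E d, Fintype (latticeBall z (2 * R)) := fun z => Fintype.ofFinite _
  have := hfin z
  have := hfin 0
  set M := ⌊R ^ d / v⌋₊ + 1
  have hhit : ∀ (q₀ : latticeBall z (2 * R)) (u : Fin n → latticeBall (0 : E d) (2 * R))
      (l : {l : Fin n → Fin M // Antitone l}), P {ω | HitsDistinct (Ψ ω) fun i : Fin n =>
        annulus R v (latticePath (q₀ : E d) (fun i => (u i : E d)) i) (l.1 i)} ≤
        ENNReal.ofReal ((α * (unitBallVolume d * v)) ^ n) := by
    intro q₀ u l
    refine (hΨ.measure_hitsDistinct_le (fun i => measurableSet_annulus _ _ _ _) fun i =>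
      ne_top_of_le_ne_top ENNReal.ofReal_ne_top (volume_annulus_le hd R hv _ _)).trans ?_
    refine (Finset.prod_le_prod' fun i _ => mul_le_mul_right (volume_annulus_le hd R hv _ _) _).trans ?_
    rw [Finset.prod_const, Finset.card_univ, Fintype.card_fin, ← ENNReal.ofReal_mul hα,
      ENNReal.ofReal_pow (by positivity)]
  rw [setOf_levelChain_eq]
  calc _ ≤ ∑ _q₀ : latticeBall z (2 * R), ∑ _u : Fin n → latticeBall (0 : E d) (2 * R),
        ∑ _l : {l : Fin n → Fin M // Antitone l},
          ENNReal.ofReal ((α * (unitBallVolume d * v)) ^ n) := by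
        refine (measure_iUnion_fintype_le _ _).trans (Finset.sum_le_sum fun q₀ _ => ?_)
        refine (measure_iUnion_fintype_le _ _).trans (Finset.sum_le_sum fun u _ => ?_)
        exact (measure_iUnion_fintype_le _ _).trans (Finset.sum_le_sum fun l _ => hhit q₀ u l)
    _ = (Nat.card (latticeBall z (2 * R)) : ENNReal) *
        (Nat.card (latticeBall (0 : E d) (2 * R)) : ENNReal) ^ n *
        (Fintype.card {l : Fin n → Fin M // Antitone l} : ENNReal) *
          ENNReal.ofReal ((α * (unitBallVolume d * v)) ^ n) := by
        simp only [Finset.sum_const, Finset.card_univ, nsmul_eq_mul, Fintype.card_fun,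
          Fintype.card_fin, Nat.card_eq_fintype_card, Nat.cast_pow]
        ring
    _ ≤ ENNReal.ofReal N * ENNReal.ofReal N ^ n * ENNReal.ofReal (2 ^ (n + M)) *
          ENNReal.ofReal ((α * (unitBallVolume d * v)) ^ n) := by
        gcongr
        · exact hcard z
        · exact hcard 0
        · rw [← ENNReal.ofReal_natCast]
          refine ENNReal.ofReal_le_ofReal ?_
          exact_mod_cast card_antitone_le n M
    _ = _ := by
        rw [← ENNReal.ofReal_pow hN0, ← ENNReal.ofReal_mul hN0, ← ENNReal.ofReal_mul (by positivity),
          ← ENNReal.ofReal_mul (by positivity)]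

/-- Descending chains with steps of length at most `R` have, with high probability, at most
`C R ^ (2 d)` steps. -/
theorem exists_measure_levelChain_le (hd : 1 ≤ d) {α : ℝ} (hα : 0 < α) :
    ∃ C : ℝ, 1 ≤ C ∧ ∃ c : ℝ, 0 < c ∧ ∀ {Ω : Type*} [MeasurableSpace Ω] {P : Measure Ω}
      {Ψ : Ω → Set (E d)}, IsPoissonProcess P α Ψ → ∀ (z : E d) (R : ℝ), 1 ≤ R → ∀ n : ℕ,
      C * R ^ (2 * d) ≤ n → P {ω | LevelChain (Ψ ω) z R (c / R ^ d) n} ≤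
        ENNReal.ofReal (Real.exp (-n)) := by
  have hκ := unitBallVolume_pos d
  set κ := unitBallVolume d
  set C₀ := κ * (2 + √d) ^ d with hC₀
  have hC₀pos : 0 < C₀ := by positivity
  -- With `v = c / R ^ d` each step has weight `C₀ R ^ d * α κ v = 1 / 32`. The remaining factors
  -- amount to at most `8 ^ n`, leaving `(1 / 4) ^ n ≤ exp (-n)`.
  set c := 1 / (32 * C₀ * α * κ) with hc
  have hcpos : 0 < c := by positivity
  -- There are about `R ^ d / v = R ^ (2 d) / c` levels, so `1 + 1 / c` makes their number at most
  -- `n`; this is the origin of the exponent `2 d`. The summand `C₀` gives `C₀ R ^ d ≤ n ≤ 2 ^ n`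
  -- for the initial point.
  refine ⟨1 + 1 / c + C₀, by have : 0 < 1 / c := by positivity
                             linarith, c, hcpos, ?_⟩
  intro Ω _ P Ψ hΨ z R hR n hn
  have hRd : 1 ≤ R ^ d := one_le_pow₀ hR
  have hR2 : R ^ (2 * d) = R ^ d * R ^ d := by rw [two_mul, pow_add]
  set v := c / R ^ d with hv
  have hvpos : 0 < v := by positivity
  have hN : κ * (2 * R + √d) ^ d ≤ C₀ * R ^ d := by
    rw [hC₀, mul_assoc, ← mul_pow]
    have : √d ≤ √d * R := le_mul_of_one_le_right (Real.sqrt_nonneg _) hR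
    gcongr
    linarith
  refine (hΨ.measure_levelChain_le hd hα.le z (by linarith) hvpos hN n).trans
    (ENNReal.ofReal_le_ofReal ?_)
  have hdiv : R ^ d / v = R ^ (2 * d) / c := by
    rw [hv, hR2]; field_simp
  have hM : ⌊R ^ d / v⌋₊ + 1 ≤ n := by
    have h1 := Nat.floor_le (show 0 ≤ R ^ d / v by positivity)
    have h2 : (1 : ℝ) ≤ R ^ (2 * d) := one_le_pow₀ hR
    have : ((⌊R ^ d / v⌋₊ + 1 : ℕ) : ℝ) ≤ n := by
      push_cast
      refine le_trans ?_ hn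
      have h3 : 0 ≤ C₀ * R ^ (2 * d) := by positivity
      rw [hdiv] at h1 ⊢
      rw [add_mul, add_mul, one_div_mul_eq_div]
      linarith
    exact_mod_cast this
  have hNn : C₀ * R ^ d ≤ 2 ^ n := by
    have h1 : C₀ * R ^ d ≤ n := by
      refine le_trans ?_ hn
      rw [hR2]
      have : 0 < 1 / c := by positivity
      have h2 : C₀ * R ^ d ≤ C₀ * (R ^ d * R ^ d) := by gcongr; nlinarith
      have h3 : 0 ≤ (1 + 1 / c) * (R ^ d * R ^ d) := by positivity
      linarith
    exact h1.trans (by exact_mod_cast Nat.lt_two_pow_self.le)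
  have hprod : α * (κ * v) = (1 / 32) / (C₀ * R ^ d) := by
    rw [hv, hc]; field_simp
  rw [hprod, div_pow, mul_comm _ ((1 / 32 : ℝ) ^ n / _)]
  have hNpos : 0 < C₀ * R ^ d := by positivity
  calc (1 / 32 : ℝ) ^ n / (C₀ * R ^ d) ^ n *
        (C₀ * R ^ d * (C₀ * R ^ d) ^ n * 2 ^ (n + (⌊R ^ d / v⌋₊ + 1)))
      = (1 / 32 : ℝ) ^ n * (C₀ * R ^ d * 2 ^ (n + (⌊R ^ d / v⌋₊ + 1))) := by
        field_simp
    _ ≤ (1 / 32 : ℝ) ^ n * (2 ^ n * 2 ^ (n + n)) := by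
        gcongr
        norm_num
    _ = (1 / 4 : ℝ) ^ n := by
        rw [pow_add, ← mul_pow, ← mul_pow, ← mul_pow]
        norm_num
    _ ≤ Real.exp (-1) ^ n := by
        gcongr
        rw [Real.exp_neg, one_div]
        exact inv_anti₀ (Real.exp_pos _) (by linarith [Real.exp_one_lt_d9])
    _ = Real.exp (-n) := by rw [← Real.exp_nat_mul]; simp

end LevelChain

/-! ### Almost sure absence of infinite descents -/

section AlmostSure

variable {d : ℕ} {Ω : Type*} [MeasurableSpace Ω] {P : Measure Ω} {α : ℝ} {Ψ : Ω → Set (E d)}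

/-- Almost surely there are no infinite descending chains. -/
lemma IsPoissonProcess.ae_wellFounded (hΨ : IsPoissonProcess P α Ψ) (hd : 1 ≤ d) (hα : 0 < α) :
    ∀ᵐ ω ∂P, WellFounded (Desc (Ψ ω) (integerLattice d)) := by
  obtain ⟨C, hC, c, hc, hbound⟩ := exists_measure_levelChain_le hd hα
  have h1 : ∀ R : ℕ, 0 < R → ∀ᵐ ω ∂P, ∃ n : ℕ, 0 < n ∧
      ¬ LongChain (Ψ ω) (integerLattice d) 0 R n := by
    intro R hR
    have hR1 : (1 : ℝ) ≤ R := by exact_mod_cast hR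
    have hcR : 0 < c / (R : ℝ) ^ d := by positivity
    rw [ae_iff]
    have hle : ∀ᶠ n : ℕ in Filter.atTop,
        P {ω | ¬ ∃ n : ℕ, 0 < n ∧ ¬ LongChain (Ψ ω) (integerLattice d) 0 R n} ≤
          ENNReal.ofReal (Real.exp (-n)) := by
      obtain ⟨n₀, hn₀⟩ := exists_nat_ge (C * (R : ℝ) ^ (2 * d))
      filter_upwards [Filter.eventually_ge_atTop n₀, Filter.eventually_gt_atTop 0] with n hn hn0
      refine le_trans (measure_mono fun ω hω => ?_)
        (hbound hΨ 0 R hR1 n (hn₀.trans (by exact_mod_cast hn)))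
      have hω' : ¬ ∃ n : ℕ, 0 < n ∧ ¬ LongChain (Ψ ω) (integerLattice d) 0 R n := hω
      push Not at hω'
      exact (hω' n hn0).levelChain hcR hn0
    have hlim : Filter.Tendsto (fun n : ℕ => ENNReal.ofReal (Real.exp (-n))) Filter.atTop
        (nhds 0) := by
      rw [← ENNReal.ofReal_zero]
      exact ENNReal.tendsto_ofReal (Real.tendsto_exp_neg_atTop_nhds_zero.comp
        tendsto_natCast_atTop_atTop)
    exact le_antisymm (ge_of_tendsto hlim hle) (zero_le)
  have h2 : ∀ᵐ ω ∂P, ∀ R : ℕ, 0 < R → ∃ n : ℕ, 0 < n ∧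
      ¬ LongChain (Ψ ω) (integerLattice d) 0 R n := by
    rw [ae_all_iff]
    intro R
    by_cases hR : 0 < R
    · filter_upwards [h1 R hR] with ω hω _ using hω
    · exact Filter.Eventually.of_forall fun ω h => absurd h hR
  filter_upwards [h2] with ω hω
  exact wellFounded_desc_of_not_longChain (hΨ.locallyFinite ω) isLocallyFinite_integerLattice hω

end AlmostSure

section Markov

open Classical in
/-- Markov's inequality for the number of events that occur. -/
lemma measure_card_filter_ge_le {Ω ι : Type*} [MeasurableSpace Ω] (P : Measure Ω) (T : Finset ι)
    {G : ι → Set Ω} (hG : ∀ i, MeasurableSet (G i)) {a : ℝ} (ha : 0 < a) :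
    P {ω | a ≤ ((T.filter fun i => ω ∈ G i).card : ℝ)} ≤
      (∑ i ∈ T, P (G i)) / ENNReal.ofReal a := by
  have hsum : ∀ ω, (((T.filter fun i => ω ∈ G i).card : ℕ) : ENNReal) =
      ∑ i ∈ T, (G i).indicator 1 ω := by
    intro ω
    rw [Finset.card_filter]
    push_cast
    refine Finset.sum_congr rfl fun i _ => ?_
    by_cases h : ω ∈ G i <;> simp [h]
  have h1 := meas_ge_le_lintegral_div (μ := P) (f := fun ω => ∑ i ∈ T, (G i).indicator 1 ω)
    (ε := ENNReal.ofReal a) (by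
      refine (Finset.measurable_fun_sum _ fun i _ => ?_).aemeasurable
      exact measurable_one.indicator (hG i)) (by simpa using ha) ENNReal.ofReal_ne_top
  rw [lintegral_finsetSum _ fun i _ => measurable_one.indicator (hG i)] at h1
  simp only [lintegral_indicator_one (hG _)] at h1
  refine le_trans (measure_mono fun ω hω => ?_) h1
  simp only [Set.mem_ofPred_eq] at hω ⊢
  rw [← hsum, ← ENNReal.ofReal_natCast]
  exact ENNReal.ofReal_le_ofReal hω

end Markov

/-! ## Most lattice points are matched -/

section Density

variable {d : ℕ}

/-- Margin for the density gap: a ball enlarged by the factor `1 + β` still holds lattice points of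
density at most halfway between `1` and `α`. -/
lemma exists_pow_le {α : ℝ} (hα : 1 < α) (d : ℕ) : ∃ β : ℝ, 0 < β ∧ (1 + β) ^ d ≤ (1 + α) / 2 := by
  have hcont : Filter.Tendsto (fun β : ℝ => (1 + β) ^ d) (nhdsWithin 0 (Set.Ioi 0)) (nhds 1) := by
    have : Continuous fun β : ℝ => (1 + β) ^ d := by fun_prop
    have h := this.tendsto 0
    simp only [add_zero, one_pow] at h
    exact h.mono_left nhdsWithin_le_nhds
  have h1 := hcont.eventually (gt_mem_nhds (show 1 < (1 + α) / 2 by linarith))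
  obtain ⟨β, hβ, hβ'⟩ := (h1.and self_mem_nhdsWithin).exists
  exact ⟨β, hβ', hβ.le⟩

/-- If `q₀` is not matched within distance `ρ` in a configuration with sufficiently many points
near `q₀`, then many lattice points near `q₀` are not matched within distance `L`. -/
lemma le_ncard_of_not_matchedWithin {φ : Set (E d)} (hφ : IsLocallyFinite φ) {α β : ℝ}
    (hβ : (1 + β) ^ d ≤ (1 + α) / 2) (hwf : WellFounded (Desc φ (integerLattice d))) {q₀ : E d}
    (hq₀ : q₀ ∈ integerLattice d) {ρ L : ℝ} (hρ : 0 ≤ ρ) (hL : 0 ≤ L) (hLρ : L + √d ≤ β * ρ)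
    (hno : ¬ MatchedWithin φ (integerLattice d) q₀ ρ)
    (hcount : (1 + 3 * α) / 4 * (unitBallVolume d * ρ ^ d) ≤
      ((φ ∩ Metric.closedBall q₀ ρ).ncard : ℝ)) :
    unitBallVolume d * (α - 1) / 4 * ρ ^ d ≤
      ({q ∈ integerLattice d ∩ Metric.closedBall q₀ (2 * ρ) |
        MatchedWithin φ (integerLattice d) q ρ ∧
          ¬ MatchedWithin φ (integerLattice d) q L}.ncard : ℝ) := by
  have hκ := unitBallVolume_pos d
  have h1 := encard_le_of_not_matchedWithin (L := L) hφ isLocallyFinite_integerLattice hwf hq₀ hno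
  have hf1 := hφ (Metric.closedBall q₀ ρ) Metric.isBounded_closedBall
  have hf2 := isLocallyFinite_integerLattice (Metric.closedBall q₀ (ρ + L))
    Metric.isBounded_closedBall
  have hf3 : {q ∈ integerLattice d ∩ Metric.closedBall q₀ (2 * ρ) |
      MatchedWithin φ (integerLattice d) q ρ ∧
        ¬ MatchedWithin φ (integerLattice d) q L}.Finite :=
    (isLocallyFinite_integerLattice (Metric.closedBall q₀ (2 * ρ))
      Metric.isBounded_closedBall).subset fun q hq => hq.1
  rw [← hf1.cast_ncard_eq, ← hf2.cast_ncard_eq, ← hf3.cast_ncard_eq] at h1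
  have h2 : ((φ ∩ Metric.closedBall q₀ ρ).ncard : ℝ) ≤
      (integerLattice d ∩ Metric.closedBall q₀ (ρ + L)).ncard +
      {q ∈ integerLattice d ∩ Metric.closedBall q₀ (2 * ρ) |
        MatchedWithin φ (integerLattice d) q ρ ∧
          ¬ MatchedWithin φ (integerLattice d) q L}.ncard := by exact_mod_cast h1
  have h3 := ncard_integerLattice_le q₀ (show 0 ≤ ρ + L by positivity)
  have h4 : unitBallVolume d * (ρ + L + √d) ^ d ≤
      unitBallVolume d * ((1 + α) / 2 * ρ ^ d) := by
    refine mul_le_mul_of_nonneg_left ?_ hκ.le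
    calc (ρ + L + √d) ^ d ≤ ((1 + β) * ρ) ^ d := by
          gcongr
          linarith
      _ = (1 + β) ^ d * ρ ^ d := mul_pow _ _ _
      _ ≤ _ := by gcongr
  -- The surplus density is `(1 + 3 α) / 4 - (1 + α) / 2 = (α - 1) / 4`.
  nlinarith

/-- The probability of finding too few points of the process in a ball. -/
lemma IsPoissonProcess.measure_ncard_closedBall_le {Ω : Type*} [MeasurableSpace Ω] {P : Measure Ω}
    {α : ℝ} {Ψ : Ω → Set (E d)} (hΨ : IsPoissonProcess P α Ψ) (hα : 1 < α) (x : E d) {ρ : ℝ}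
    (hρ : 0 ≤ ρ) : P {ω | ((Ψ ω ∩ Metric.closedBall x ρ).ncard : ℝ) ≤
        (1 + 3 * α) / 4 * (unitBallVolume d * ρ ^ d)} ≤
      ENNReal.ofReal (Real.exp (-(((α - 1) / (4 * α)) ^ 2 / 2 * α * unitBallVolume d * ρ ^ d))) := by
  have hκ := unitBallVolume_pos d
  -- This `ε` satisfies `(1 - ε) α = (1 + 3 α) / 4`.
  have h := hΨ.measure_ncard_le (by linarith) (B := Metric.closedBall x ρ)
    Metric.isClosed_closedBall.measurableSet measure_closedBall_lt_top.ne
    (ε := (α - 1) / (4 * α)) (div_nonneg (by linarith) (by linarith))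
  have hvol : volume.real (Metric.closedBall x ρ) = unitBallVolume d * ρ ^ d := by
    rw [measureReal_def, volume_closedBall_eq _ hρ, ENNReal.toReal_ofReal (by positivity)]
  rw [hvol] at h
  convert h using 4
  · have : α ≠ 0 := by linarith
    rw [← mul_assoc (1 - (α - 1) / (4 * α))]
    congr! 2
    field_simp
    ring
  · ring

/-- The lattice points in a cube of side `k + 2 m`. -/
noncomputable def latticeBlock (k m : ℕ) (u : Fin d → ℤ) : Finset (Fin d → ℤ) :=
  Fintype.piFinset fun i => Finset.Ico (k * u i - m) (k * u i + k + m)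

lemma mem_latticeBlock {k m : ℕ} {u z : Fin d → ℤ} :
    z ∈ latticeBlock k m u ↔ ∀ i, k * u i - m ≤ z i ∧ z i < k * u i + k + m := by
  simp [latticeBlock]

lemma card_latticeBlock (k m : ℕ) (u : Fin d → ℤ) : (latticeBlock k m u).card = (k + 2 * m) ^ d := by
  rw [latticeBlock, Fintype.card_piFinset]
  have : ∀ i, (Finset.Ico ((k : ℤ) * u i - m) (k * u i + k + m)).card = k + 2 * m := by
    intro i; rw [Int.card_Ico]; lia
  simp [this]

open Classical in
/-- Lattice points within distance `ρ` of `x`, by their coordinates. -/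
noncomputable def latticeNear (x : E d) (ρ : ℝ) : Finset (Fin d → ℤ) :=
  ((isLocallyFinite_integerLattice (Metric.closedBall x ρ) Metric.isBounded_closedBall).preimage
    (latticePoint_injective (d := d)).injOn).toFinset

lemma mem_latticeNear {x : E d} {ρ : ℝ} {z : Fin d → ℤ} :
    z ∈ latticeNear x ρ ↔ ‖latticePoint z - x‖ ≤ ρ := by
  simp [latticeNear, latticePoint_mem, dist_eq_norm]

lemma image_latticeNear (x : E d) (ρ : ℝ) (p : E d → Prop) :
    {q ∈ integerLattice d ∩ Metric.closedBall x ρ | p q} =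
      latticePoint '' {z ∈ latticeNear x ρ | p (latticePoint z)} := by
  ext q
  constructor
  · rintro ⟨⟨hq, hB⟩, hp⟩
    obtain ⟨z, rfl⟩ := range_latticePoint (d := d) ▸ hq
    rw [Metric.mem_closedBall, dist_eq_norm] at hB
    exact ⟨z, ⟨mem_latticeNear.2 hB, hp⟩, rfl⟩
  · rintro ⟨z, ⟨hz, hp⟩, rfl⟩
    refine ⟨⟨latticePoint_mem z, ?_⟩, hp⟩
    rw [Metric.mem_closedBall, dist_eq_norm]
    exact mem_latticeNear.1 hz

open Classical in
lemma ncard_eq_card_filter_latticeNear (x : E d) (ρ : ℝ) (p : E d → Prop) :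
    {q ∈ integerLattice d ∩ Metric.closedBall x ρ | p q}.ncard =
      ((latticeNear x ρ).filter fun z => p (latticePoint z)).card := by
  rw [image_latticeNear, Set.ncard_image_of_injective _ latticePoint_injective,
    ← Set.ncard_coe_finset]
  congr 1
  ext z; simp

lemma card_latticeNear_le (x : E d) {ρ : ℝ} (hρ : 0 ≤ ρ) :
    ((latticeNear x ρ).card : ℝ) ≤ unitBallVolume d * (ρ + √d) ^ d := by
  classical
  have h := ncard_eq_card_filter_latticeNear x ρ fun _ => True
  simp only [and_true, Finset.filter_true] at h
  rw [← h]
  exact ncard_integerLattice_le x hρ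

lemma abs_sub_le_of_mem_latticeNear {z w : Fin d → ℤ} {ρ : ℝ} {m : ℕ} (hm : ρ ≤ m)
    (h : w ∈ latticeNear (latticePoint z) ρ) (i : Fin d) : |w i - z i| ≤ m := by
  have h1 := (PiLp.norm_apply_le (latticePoint w - latticePoint z) i).trans (mem_latticeNear.1 h)
  simp only [PiLp.sub_apply, latticePoint_apply, Real.norm_eq_abs] at h1
  exact_mod_cast h1.trans hm

end Density

section Average

variable {d : ℕ} {Ω : Type*} [MeasurableSpace Ω] {P : Measure Ω} [IsProbabilityMeasure P]
  {α : ℝ} {Ψ : Ω → Set (E d)}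

-- Either the ball around `z` has too few process points, or many lattice points nearby are matched
-- at a distance in `(L, ρ]`. Markov's inequality turns the second case into a difference of
-- matching probabilities, ready to be telescoped.
open Classical in
lemma IsPoissonProcess.measureReal_not_matchedWithin_le (hΨ : IsPoissonProcess P α Ψ)
    (hd : 1 ≤ d) (hα : 1 < α) {β : ℝ} (hβ : (1 + β) ^ d ≤ (1 + α) / 2) (z : Fin d → ℤ) {ρ L : ℝ}
    (hρ : 1 ≤ ρ) (hL : 0 ≤ L) (hLρ : L + √d ≤ β * ρ) (hLρ' : L ≤ ρ) :
    1 - P.real {ω | MatchedWithin (Ψ ω) (integerLattice d) (latticePoint z) ρ} ≤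
      Real.exp (-(((α - 1) / (4 * α)) ^ 2 / 2 * α * unitBallVolume d * ρ ^ d)) +
      (∑ w ∈ latticeNear (latticePoint z) (2 * ρ),
        (P.real {ω | MatchedWithin (Ψ ω) (integerLattice d) (latticePoint w) ρ} -
          P.real {ω | MatchedWithin (Ψ ω) (integerLattice d) (latticePoint w) L})) /
        (unitBallVolume d * (α - 1) / 4 * ρ ^ d) := by
  have hκ := unitBallVolume_pos d
  have hM := fun (w : Fin d → ℤ) (r : ℝ) => hΨ.isMeasurableConfig.measurableSet_matchedWithin
    countable_integerLattice (latticePoint w) r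
  set G : (Fin d → ℤ) → Set Ω := fun w =>
    {ω | MatchedWithin (Ψ ω) (integerLattice d) (latticePoint w) ρ} \
      {ω | MatchedWithin (Ψ ω) (integerLattice d) (latticePoint w) L}
  have hGm : ∀ w, MeasurableSet (G w) := fun w => (hM w ρ).diff (hM w L)
  have hGr : ∀ w, P.real (G w) = P.real {ω | MatchedWithin (Ψ ω) (integerLattice d) (latticePoint w) ρ}
      - P.real {ω | MatchedWithin (Ψ ω) (integerLattice d) (latticePoint w) L} := fun w =>
    measureReal_sdiff (fun ω h => h.mono hLρ') (hM w L)
  set a := unitBallVolume d * (α - 1) / 4 * ρ ^ d with ha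
  have hapos : 0 < a := by have : 0 < α - 1 := by linarith
                           positivity
  have hle : P {ω | MatchedWithin (Ψ ω) (integerLattice d) (latticePoint z) ρ}ᶜ ≤
      ENNReal.ofReal (Real.exp (-(((α - 1) / (4 * α)) ^ 2 / 2 * α * unitBallVolume d * ρ ^ d))) +
        (∑ w ∈ latticeNear (latticePoint z) (2 * ρ), P (G w)) / ENNReal.ofReal a := by
    refine le_trans ?_ (add_le_add (hΨ.measure_ncard_closedBall_le hα (latticePoint z)
      (by linarith : (0 : ℝ) ≤ ρ)) (measure_card_filter_ge_le P _ hGm hapos))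
    refine le_trans (measure_mono_ae ?_) (measure_union_le _ _)
    filter_upwards [hΨ.ae_wellFounded hd (by linarith)] with ω hwf hω
    rcases le_or_gt (((Ψ ω ∩ Metric.closedBall (latticePoint z) ρ).ncard : ℝ))
      ((1 + 3 * α) / 4 * (unitBallVolume d * ρ ^ d)) with hcnt | hcnt
    · exact Or.inl hcnt
    · right
      have := le_ncard_of_not_matchedWithin (hΨ.locallyFinite ω) hβ hwf (latticePoint_mem z)
        (by linarith) hL hLρ hω hcnt.le
      rwa [ncard_eq_card_filter_latticeNear] at this
  rw [← probReal_compl_eq_one_sub (hM z ρ)]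
  have hsum : (∑ w ∈ latticeNear (latticePoint z) (2 * ρ), P (G w)) / ENNReal.ofReal a =
      ENNReal.ofReal ((∑ w ∈ latticeNear (latticePoint z) (2 * ρ), P.real (G w)) / a) := by
    rw [ENNReal.ofReal_div_of_pos hapos, ENNReal.ofReal_sum_of_nonneg fun _ _ => measureReal_nonneg]
    simp [ofReal_measureReal]
  rw [hsum, ← ENNReal.ofReal_add (Real.exp_pos _).le
    (div_nonneg (Finset.sum_nonneg fun _ _ => measureReal_nonneg) hapos.le)] at hle
  have := ENNReal.toReal_le_of_le_ofReal (add_nonneg (Real.exp_pos _).le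
    (div_nonneg (Finset.sum_nonneg fun _ _ => measureReal_nonneg) hapos.le)) hle
  rw [measureReal_def]
  simpa only [hGr] using this

-- Each `w` lies near at most order `ρ ^ d` points `z`, which cancels the `ρ ^ d` in the
-- denominator. The prefactor is therefore independent of the scale.
open Classical in
lemma IsPoissonProcess.sum_not_matchedWithin_le (hΨ : IsPoissonProcess P α Ψ)
    (hd : 1 ≤ d) (hα : 1 < α) {β : ℝ} (hβ : (1 + β) ^ d ≤ (1 + α) / 2) (k m : ℕ)
    (u : Fin d → ℤ) {ρ L : ℝ}
    (hρ : 1 ≤ ρ) (hL : 0 ≤ L) (hLρ : L + √d ≤ β * ρ) (hLρ' : L ≤ ρ) (hm : 2 * ρ ≤ m) :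
    ∑ z ∈ latticeBlock k 0 u,
        (1 - P.real {ω | MatchedWithin (Ψ ω) (integerLattice d) (latticePoint z) ρ}) ≤
      (k : ℝ) ^ d * Real.exp (-(((α - 1) / (4 * α)) ^ 2 / 2 * α * unitBallVolume d * ρ ^ d)) +
      4 * (2 + √d) ^ d / (α - 1) * ∑ w ∈ latticeBlock k m u,
        (P.real {ω | MatchedWithin (Ψ ω) (integerLattice d) (latticePoint w) ρ} -
          P.real {ω | MatchedWithin (Ψ ω) (integerLattice d) (latticePoint w) L}) := by
  have hκ := unitBallVolume_pos d
  have hα1 : 0 < α - 1 := by linarith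
  set g : (Fin d → ℤ) → ℝ := fun w =>
    P.real {ω | MatchedWithin (Ψ ω) (integerLattice d) (latticePoint w) ρ} -
          P.real {ω | MatchedWithin (Ψ ω) (integerLattice d) (latticePoint w) L} with hg
  have hg0 : ∀ w, 0 ≤ g w := fun w => sub_nonneg.2 (measureReal_mono fun ω h => h.mono hLρ')
  set a := unitBallVolume d * (α - 1) / 4 * ρ ^ d with ha
  have hapos : 0 < a := by positivity
  have hsum : ∑ z ∈ latticeBlock k 0 u, ∑ w ∈ latticeNear (latticePoint z) (2 * ρ), g w ≤
      unitBallVolume d * ((2 + √d) ^ d * ρ ^ d) * ∑ w ∈ latticeBlock k m u, g w := by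
    rw [Finset.sum_comm' (t' := latticeBlock k m u)
      (s' := fun w => (latticeBlock k 0 u).filter fun z => w ∈ latticeNear (latticePoint z) (2 * ρ)),
      Finset.mul_sum]
    · refine Finset.sum_le_sum fun w _ => ?_
      rw [Finset.sum_const, nsmul_eq_mul]
      refine mul_le_mul_of_nonneg_right ?_ (hg0 w)
      have h1 : ((latticeBlock k 0 u).filter fun z => w ∈ latticeNear (latticePoint z) (2 * ρ)) ⊆
          latticeNear (latticePoint w) (2 * ρ) := by
        intro z hz
        have := (Finset.mem_filter.1 hz).2
        rw [mem_latticeNear, norm_sub_rev] at this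
        exact mem_latticeNear.2 this
      have h2 : (((latticeBlock k 0 u).filter fun z =>
          w ∈ latticeNear (latticePoint z) (2 * ρ)).card : ℝ) ≤
          ((latticeNear (latticePoint w) (2 * ρ)).card : ℝ) := by
        exact_mod_cast Finset.card_le_card h1
      refine h2.trans ((card_latticeNear_le _ (by linarith)).trans ?_)
      refine mul_le_mul_of_nonneg_left ?_ hκ.le
      rw [← mul_pow]
      have : √d ≤ √d * ρ := le_mul_of_one_le_right (Real.sqrt_nonneg _) hρ
      gcongr
      linarith
    · intro z w
      rw [Finset.mem_filter]
      constructor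
      · rintro ⟨hz, hw⟩
        refine ⟨⟨hz, hw⟩, mem_latticeBlock.2 fun i => ?_⟩
        have h1 := mem_latticeBlock.1 hz i
        have h2 := abs_le.1 (abs_sub_le_of_mem_latticeNear hm hw i)
        simp only [Nat.cast_zero] at h1
        lia
      · rintro ⟨⟨hz, hw⟩, -⟩
        exact ⟨hz, hw⟩
  calc _ ≤ ∑ z ∈ latticeBlock k 0 u,
        (Real.exp (-(((α - 1) / (4 * α)) ^ 2 / 2 * α * unitBallVolume d * ρ ^ d)) +
          (∑ w ∈ latticeNear (latticePoint z) (2 * ρ), g w) / a) :=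
        Finset.sum_le_sum fun z _ =>
          hΨ.measureReal_not_matchedWithin_le hd hα hβ z hρ hL hLρ hLρ'
    _ ≤ (k : ℝ) ^ d * Real.exp (-(((α - 1) / (4 * α)) ^ 2 / 2 * α * unitBallVolume d * ρ ^ d)) +
        (unitBallVolume d * ((2 + √d) ^ d * ρ ^ d) * ∑ w ∈ latticeBlock k m u, g w) / a := by
        rw [Finset.sum_add_distrib, Finset.sum_const, card_latticeBlock, nsmul_eq_mul,
          ← Finset.sum_div]
        push_cast
        simp only [add_zero]
        gcongr
    _ = _ := by
        congr 1
        rw [ha]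
        field_simp

end Average

/-- In large blocks, most lattice points are matched within a given distance. -/
theorem exists_sum_not_matchedWithin_le {d : ℕ} (hd : 1 ≤ d) {α : ℝ} (hα : 1 < α) {ε : ℝ}
    (hε : 0 < ε) : ∃ L : ℝ, 1 ≤ L ∧ ∃ k₀ : ℕ, ∀ {Ω : Type*} [MeasurableSpace Ω] {P : Measure Ω}
      [IsProbabilityMeasure P] {Ψ : Ω → Set (E d)}, IsPoissonProcess P α Ψ → ∀ k ≥ k₀,
      ∀ u : Fin d → ℤ, ∑ z ∈ latticeBlock k 0 u,
        P.real {ω | ¬ MatchedWithin (Ψ ω) (integerLattice d) (latticePoint z) L} ≤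
          ε * (k : ℝ) ^ d := by
  have hκ := unitBallVolume_pos d
  have hα1 : 0 < α - 1 := by linarith
  obtain ⟨β, hβ0, hβ⟩ := exists_pow_le hα d
  set c := ((α - 1) / (4 * α)) ^ 2 / 2 * α * unitBallVolume d with hc
  have hcpos : 0 < c := by positivity
  -- The factor `3 ^ d` pays for the enlarged block of side `k + 2 m ≤ 3 k`.
  set C := 4 * (2 + √d) ^ d / (α - 1) * 3 ^ d with hC
  have hCpos : 0 < C := by positivity
  -- There are `J` scales. The telescoping total costs `C k ^ d`, which averages to at most `ε / 2 *
  -- k ^ d` per scale.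
  obtain ⟨J, hJ⟩ := exists_nat_gt (2 * C / ε)
  have hJ0 : (0 : ℝ) < J := lt_of_le_of_lt (by positivity) hJ
  -- The ratio of the scales is chosen so that `ρ i + √d ≤ β ρ (i + 1)`.
  set lam := max 1 ((1 + √d) / β) with hlam
  have hlam1 : 1 ≤ lam := le_max_left _ _
  have hlamβ : 1 + √d ≤ β * lam := by
    have := le_max_right 1 ((1 + √d) / β)
    rw [div_le_iff₀ hβ0] at this
    linarith
  obtain ⟨ρ₀, hρ₀1, hρ₀⟩ : ∃ ρ₀ : ℝ, 1 ≤ ρ₀ ∧ Real.exp (-(c * ρ₀)) ≤ ε / 2 := by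
    have h1 : Filter.Tendsto (fun x : ℝ => Real.exp (-(c * x))) Filter.atTop (nhds 0) :=
      Real.tendsto_exp_neg_atTop_nhds_zero.comp (Filter.tendsto_id.const_mul_atTop hcpos)
    have h2 := (h1.eventually (gt_mem_nhds (show 0 < ε / 2 by positivity))).and
      (Filter.eventually_ge_atTop 1)
    obtain ⟨x, hx, hx1⟩ := h2.exists
    exact ⟨x, hx1, hx.le⟩
  set ρ : ℕ → ℝ := fun i => lam ^ i * ρ₀ with hρ
  have hρge : ∀ i, ρ₀ ≤ ρ i := fun i => le_mul_of_one_le_left (by linarith) (one_le_pow₀ hlam1)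
  have hρ1 : ∀ i, 1 ≤ ρ i := fun i => hρ₀1.trans (hρge i)
  have hρsucc : ∀ i, ρ (i + 1) = lam * ρ i := fun i => by simp only [hρ]; ring
  have hρmono : Monotone ρ := monotone_nat_of_le_succ fun i => by
    rw [hρsucc]; exact le_mul_of_one_le_left (by linarith [hρ1 i]) hlam1
  obtain ⟨m, hm⟩ := exists_nat_ge (2 * ρ J)
  refine ⟨ρ J, hρ1 J, m, ?_⟩
  intro Ω _ P _ Ψ hΨ k hk u
  set w : ℕ → (Fin d → ℤ) → ℝ := fun i z =>
    P.real {ω | MatchedWithin (Ψ ω) (integerLattice d) (latticePoint z) (ρ i)} with hw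
  have hcompl : ∀ z, P.real {ω | ¬ MatchedWithin (Ψ ω) (integerLattice d) (latticePoint z) (ρ J)} =
      1 - w J z := fun z =>
    probReal_compl_eq_one_sub (hΨ.isMeasurableConfig.measurableSet_matchedWithin
      countable_integerLattice _ _)
  simp only [hcompl]
  set S := ∑ z ∈ latticeBlock k 0 u, (1 - w J z) with hS
  have hwmono : ∀ z, Monotone fun i => w i z := fun z i j hij =>
    measureReal_mono fun ω h => h.mono (hρmono hij)
  have hstep : ∀ i ∈ Finset.range J, S ≤ (k : ℝ) ^ d * (ε / 2) + 4 * (2 + √d) ^ d / (α - 1) *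
      ∑ z ∈ latticeBlock k m u, (w (i + 1) z - w i z) := by
    intro i hi
    have hi' : i + 1 ≤ J := Finset.mem_range.1 hi
    have h1 : S ≤ ∑ z ∈ latticeBlock k 0 u, (1 - w (i + 1) z) :=
      Finset.sum_le_sum fun z _ => by have := hwmono z hi'; simp only at this; linarith
    refine h1.trans ((hΨ.sum_not_matchedWithin_le hd hα hβ k m u (hρ1 (i + 1))
      (L := ρ i) (by linarith [hρ1 i]) ?_ (hρmono (Nat.le_succ i)) ?_).trans ?_)
    · rw [hρsucc]
      have h2 : √d ≤ √d * ρ i := le_mul_of_one_le_right (Real.sqrt_nonneg _) (hρ1 i)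
      calc ρ i + √d ≤ (1 + √d) * ρ i := by linarith
        _ ≤ β * lam * ρ i := by gcongr
        _ = _ := by ring
    · exact (mul_le_mul_of_nonneg_left (hρmono hi') (by norm_num)).trans hm
    · gcongr
      refine le_trans (Real.exp_le_exp.2 (neg_le_neg ?_)) hρ₀
      refine mul_le_mul_of_nonneg_left ?_ hcpos.le
      exact (hρge (i + 1)).trans (le_self_pow₀ (hρ1 (i + 1)) (by lia))
  have hsum := Finset.sum_le_sum hstep
  rw [Finset.sum_const, Finset.card_range, nsmul_eq_mul, Finset.sum_add_distrib, Finset.sum_const,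
    Finset.card_range, nsmul_eq_mul, ← Finset.mul_sum, Finset.sum_comm] at hsum
  -- For each lattice point the increments over all scales telescope to at most one.
  have htel : ∑ z ∈ latticeBlock k m u, ∑ i ∈ Finset.range J, (w (i + 1) z - w i z) ≤
      3 ^ d * (k : ℝ) ^ d := by
    calc _ ≤ ∑ z ∈ latticeBlock k m u, (1 : ℝ) := by
          refine Finset.sum_le_sum fun z _ => ?_
          rw [Finset.sum_range_sub (fun i => w i z)]
          have h1 : w J z ≤ 1 := measureReal_le_one
          have h2 : 0 ≤ w 0 z := measureReal_nonneg
          linarith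
      _ = ((k + 2 * m : ℕ) : ℝ) ^ d := by
          rw [Finset.sum_const, card_latticeBlock]; simp
      _ ≤ (3 * k : ℝ) ^ d := by
          gcongr
          have : (m : ℝ) ≤ k := by exact_mod_cast hk
          push_cast
          linarith
      _ = _ := mul_pow _ _ _
  have hfin : (J : ℝ) * S ≤ J * ((k : ℝ) ^ d * (ε / 2)) + C * (k : ℝ) ^ d := by
    refine hsum.trans ?_
    have : 4 * (2 + √d) ^ d / (α - 1) *
        ∑ z ∈ latticeBlock k m u, ∑ i ∈ Finset.range J, (w (i + 1) z - w i z) ≤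
        4 * (2 + √d) ^ d / (α - 1) * (3 ^ d * (k : ℝ) ^ d) := by gcongr
    rw [hC]
    linarith
  rw [div_lt_iff₀ hε] at hJ
  have hk0 : (0 : ℝ) ≤ (k : ℝ) ^ d := by positivity
  refine le_of_mul_le_mul_left ?_ hJ0
  nlinarith

/-! ## Exponential tails of the matching distance -/

section UnionBound

open Classical in
lemma measurableSet_card_filter_ge {Ω ι : Type*} [MeasurableSpace Ω] (T : Finset ι)
    {G : ι → Set Ω} (hG : ∀ i ∈ T, MeasurableSet (G i)) (a : ℝ) :
    MeasurableSet {ω | a ≤ ((T.filter fun i => ω ∈ G i).card : ℝ)} := by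
  have : ∀ ω, ((T.filter fun i => ω ∈ G i).card : ℝ) = ∑ i ∈ T, (G i).indicator 1 ω := by
    intro ω
    rw [Finset.card_filter]
    push_cast
    refine Finset.sum_congr rfl fun i _ => ?_
    by_cases h : ω ∈ G i <;> simp [h]
  simp_rw [this]
  refine measurableSet_le measurable_const (Finset.measurable_fun_sum _ fun i hi => ?_)
  exact measurable_one.indicator (hG i hi)

open Classical in
/-- If unlikely events are independent within each of finitely many classes, then it is
unlikely that many of them occur. -/
lemma measure_card_filter_ge_le_of_classes {Ω ι κ : Type*} [MeasurableSpace Ω] {P : Measure Ω}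
    [Fintype κ] [Nonempty κ] (U : Finset ι) (cl : ι → κ) {D : ι → Set Ω} {Λ b : ℝ} (hΛ : 0 ≤ Λ)
    (hD : ∀ i, P (D i) ≤ ENNReal.ofReal (Real.exp (-Λ)))
    (hprod : ∀ T ⊆ U, (∀ i ∈ T, ∀ j ∈ T, cl i = cl j) → P (⋂ i ∈ T, D i) = ∏ i ∈ T, P (D i)) :
    P {ω | b ≤ ((U.filter fun i => ω ∈ D i).card : ℝ)} ≤
      ENNReal.ofReal (2 ^ U.card * Real.exp (-(Λ * (b / Fintype.card κ)))) := by
  set b' := b / Fintype.card κ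
  set 𝒯 := U.powerset.filter fun T => (∀ i ∈ T, ∀ j ∈ T, cl i = cl j) ∧ b' ≤ (T.card : ℝ)
  have hsub : {ω | b ≤ ((U.filter fun i => ω ∈ D i).card : ℝ)} ⊆ ⋃ T ∈ 𝒯, ⋂ i ∈ T, D i := by
    intro ω hω
    simp only [Set.mem_ofPred_eq] at hω
    -- Pigeonhole: some class contains at least the average number of occurring events; the union
    -- then runs over at most `2 ^ U.card` subsets.
    obtain ⟨s, hs⟩ : ∃ s : κ, b' ≤
        (((U.filter fun i => ω ∈ D i).filter fun i => cl i = s).card : ℝ) := by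
      by_contra! hlt
      have h1 := Finset.card_eq_sum_card_fiberwise (s := U.filter fun i => ω ∈ D i)
        (t := Finset.univ) (f := cl) (fun _ _ => Finset.mem_coe.2 (Finset.mem_univ _))
      have h2 := Finset.sum_lt_sum_of_nonempty (Finset.univ_nonempty (α := κ)) fun s _ => hlt s
      rw [Finset.sum_const, Finset.card_univ, nsmul_eq_mul] at h2
      rw [h1] at hω
      push_cast at hω
      have h3 : (Fintype.card κ : ℝ) * b' = b :=
        mul_div_cancel₀ _ (by exact_mod_cast Fintype.card_ne_zero)
      linarith
    refine Set.mem_biUnion (x := (U.filter fun i => ω ∈ D i).filter fun i => cl i = s) ?_ ?_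
    · refine Finset.mem_coe.2 (Finset.mem_filter.2 ⟨Finset.mem_powerset.2 ?_, ?_, hs⟩)
      · exact (Finset.filter_subset _ _).trans (Finset.filter_subset _ _)
      · intro i hi j hj
        exact (Finset.mem_filter.1 hi).2.trans (Finset.mem_filter.1 hj).2.symm
    · refine Set.mem_iInter₂.2 fun i hi => ?_
      exact (Finset.mem_filter.1 (Finset.mem_filter.1 hi).1).2
  have hT : ∀ T ∈ 𝒯, P (⋂ i ∈ T, D i) ≤ ENNReal.ofReal (Real.exp (-(Λ * b'))) := by
    intro T hT
    obtain ⟨h1, h2, h3⟩ := Finset.mem_filter.1 hT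
    rw [hprod T (Finset.mem_powerset.1 h1) h2]
    refine (Finset.prod_le_prod' fun i _ => hD i).trans ?_
    rw [Finset.prod_const, ← ENNReal.ofReal_pow (Real.exp_pos _).le, ← Real.exp_nat_mul]
    refine ENNReal.ofReal_le_ofReal (Real.exp_le_exp.2 ?_)
    nlinarith
  refine (measure_mono hsub).trans ((measure_biUnion_finset_le _ _).trans
    ((Finset.sum_le_sum hT).trans ?_))
  rw [Finset.sum_const, nsmul_eq_mul, ENNReal.ofReal_mul (by positivity)]
  refine mul_le_mul_left ?_ _
  have h1 : 𝒯.card ≤ 2 ^ U.card := by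
    rw [← Finset.card_powerset]; exact Finset.card_filter_le _ _
  rw [← ENNReal.ofReal_natCast]
  exact ENNReal.ofReal_le_ofReal (by exact_mod_cast h1)

end UnionBound

/-! ### Lattice blocks and their residue classes -/

section Blocks

variable {d : ℕ}

lemma mem_latticeBlock_zero_iff {k : ℕ} (hk : 0 < k) {u z : Fin d → ℤ} :
    z ∈ latticeBlock k 0 u ↔ (fun i => z i / (k : ℤ)) = u := by
  rw [mem_latticeBlock, funext_iff]
  refine forall_congr' fun i => ?_
  have hk' : (0 : ℤ) < k := by exact_mod_cast hk
  rw [Int.ediv_eq_iff_of_pos hk']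
  simp only [Nat.cast_zero, sub_zero, add_zero]
  constructor
  · rintro ⟨h1, h2⟩
    constructor <;> nlinarith
  · rintro ⟨h1, h2⟩
    constructor <;> nlinarith

lemma norm_latticePoint_sub_le {z w : Fin d → ℤ} {k : ℕ} (h : ∀ i, |z i - w i| ≤ k) :
    ‖latticePoint z - latticePoint w‖ ≤ k * √d := by
  rw [EuclideanSpace.norm_eq]
  refine Real.sqrt_le_iff.2 ⟨by positivity, ?_⟩
  calc ∑ i, ‖(latticePoint z - latticePoint w) i‖ ^ 2 ≤ ∑ _i : Fin d, (k : ℝ) ^ 2 := by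
        refine Finset.sum_le_sum fun i _ => ?_
        have h1 : |(z i : ℝ) - w i| ≤ k := by exact_mod_cast h i
        simp only [PiLp.sub_apply, latticePoint_apply, Real.norm_eq_abs]
        gcongr
    _ = (k * √d) ^ 2 := by
        rw [mul_pow, Real.sq_sqrt (Nat.cast_nonneg d)]
        simp [mul_comm]

open Classical in
/-- The blocks that meet a given ball. -/
noncomputable def blocksNear (k : ℕ) (x : E d) (ρ : ℝ) : Finset (Fin d → ℤ) :=
  (latticeNear x ρ).image fun z i => z i / (k : ℤ)

/-- The blocks are disjoint, have `k ^ d` points each, and lie within `ρ + k √d` of `x`. -/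
lemma card_blocksNear_le {k : ℕ} (hk : 0 < k) (x : E d) {ρ : ℝ} (hρ : 0 ≤ ρ) :
    ((blocksNear k x ρ).card : ℝ) * (k : ℝ) ^ d ≤
      unitBallVolume d * (ρ + k * √d + √d) ^ d := by
  classical
  have hsub : (blocksNear k x ρ).biUnion (latticeBlock k 0) ⊆ latticeNear x (ρ + k * √d) := by
    intro w hw
    obtain ⟨u, hu, hw⟩ := Finset.mem_biUnion.1 hw
    obtain ⟨z, hz, rfl⟩ := Finset.mem_image.1 hu
    have h1 := mem_latticeBlock.1 ((mem_latticeBlock_zero_iff (z := z) hk).2 rfl)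
    have h2 := mem_latticeBlock.1 hw
    rw [mem_latticeNear] at hz ⊢
    have h3 : ‖latticePoint w - latticePoint z‖ ≤ k * √d := by
      refine norm_latticePoint_sub_le fun i => ?_
      have := h1 i
      have := h2 i
      rw [abs_le]
      simp only [Nat.cast_zero] at *
      constructor <;> linarith
    calc _ ≤ ‖latticePoint w - latticePoint z‖ + ‖latticePoint z - x‖ :=
          norm_sub_le_norm_sub_add_norm_sub _ _ _
      _ ≤ _ := by linarith
  have hcard := Finset.card_le_card hsub
  rw [Finset.card_biUnion, Finset.sum_congr rfl fun u _ => card_latticeBlock k 0 u] at hcard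
  · refine le_trans ?_ (card_latticeNear_le x (by positivity))
    rw [Finset.sum_const, smul_eq_mul] at hcard
    simp only [mul_zero, add_zero] at hcard
    exact_mod_cast hcard
  · intro u _ u' _ hne
    refine Finset.disjoint_left.2 ?_
    intro z hz hz'
    exact hne (((mem_latticeBlock_zero_iff hk).1 hz).symm.trans ((mem_latticeBlock_zero_iff hk).1 hz'))

/-- The class of a block: blocks in the same class are far apart. -/
def blockClass (u : Fin d → ℤ) : Fin d → ZMod 3 := fun i => (u i : ZMod 3)

/-- Some block index differs by at least three, so two full block widths lie between the points in
that coordinate. -/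
lemma lt_norm_sub_of_blockClass_eq {k : ℕ} {u u' z z' : Fin d → ℤ} (hne : u ≠ u')
    (hcl : blockClass u = blockClass u') (hz : z ∈ latticeBlock k 0 u)
    (hz' : z' ∈ latticeBlock k 0 u') : 2 * (k : ℝ) < ‖latticePoint z - latticePoint z'‖ := by
  obtain ⟨i, hi⟩ := Function.ne_iff.1 hne
  have hmod : (3 : ℤ) ∣ u i - u' i := by
    have := congrFun hcl i
    simp only [blockClass] at this
    exact (ZMod.intCast_eq_intCast_iff_dvd_sub (u' i) (u i) 3).1 this.symm
  have h1 := mem_latticeBlock.1 hz i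
  have h2 := mem_latticeBlock.1 hz' i
  simp only [Nat.cast_zero, sub_zero, add_zero] at h1 h2
  have hk0 : (0 : ℤ) ≤ k := Int.natCast_nonneg k
  have h3 : 2 * (k : ℤ) < |z i - z' i| := by
    rcases lt_or_gt_of_ne hi with h | h
    · have h4 : u i + 3 ≤ u' i := by lia
      rw [lt_abs]
      right
      nlinarith
    · have h4 : u' i + 3 ≤ u i := by lia
      rw [lt_abs]
      left
      nlinarith
  refine lt_of_lt_of_le ?_ (PiLp.norm_apply_le (latticePoint z - latticePoint z') i)
  simp only [PiLp.sub_apply, latticePoint_apply, Real.norm_eq_abs]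
  exact_mod_cast h3

end Blocks

/-! ### Bad points: finite-range events controlling the matching within `L` -/

section BadPoints

variable {d : ℕ}

/-- Matching within a given distance does not depend on points far away if there are no long
chains. -/
lemma matchedWithin_congr {φ φ' : Set (E d)} (hφ : IsLocallyFinite φ) (hφ' : IsLocallyFinite φ')
    (hwf : WellFounded (Desc φ (integerLattice d))) {q : E d} {L : ℝ} (hL : 0 ≤ L) {n : ℕ}
    (hn : 0 < n)
    (hag : φ ∩ Metric.closedBall q ((2 * n + 3) * L) = φ' ∩ Metric.closedBall q ((2 * n + 3) * L))
    (hno : ¬ LongChain (φ ∩ Metric.closedBall q ((2 * n + 3) * L)) (integerLattice d) q L n) :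
    MatchedWithin φ (integerLattice d) q L ↔ MatchedWithin φ' (integerLattice d) q L := by
  have hnL : 0 ≤ n * L := by positivity
  refine exists_congr fun p => and_congr_right fun hp => ?_
  have hiff : p ∈ φ → q ∈ integerLattice d → (IsMatchedPair φ (integerLattice d) p q ↔
      IsMatchedPair φ' (integerLattice d) p q) := by
    intro hpφ hq
    refine isMatchedPair_inter_iff (e := (p, q)) hφ hφ' isLocallyFinite_integerLattice hwf hn hpφ hq
      hp hp (fun hl => hno (hl.mono ?_)) le_rfl hag
    rintro x ⟨⟨hx, -⟩, hxB⟩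
    refine ⟨hx, ?_⟩
    rw [Metric.mem_closedBall, dist_eq_norm] at hxB ⊢
    calc ‖x - q‖ ≤ ‖x - p‖ + ‖p - q‖ := norm_sub_le_norm_sub_add_norm_sub _ _ _
      _ ≤ 2 * L * n + L := add_le_add hxB hp
      _ ≤ _ := by nlinarith
  have hpB : p ∈ Metric.closedBall q ((2 * n + 3) * L) := by
    rw [Metric.mem_closedBall, dist_eq_norm]
    exact hp.trans (by nlinarith)
  constructor
  · intro h
    exact (hiff h.mem_left h.mem_right).1 h
  · intro h
    exact (hiff (hag.symm.subset ⟨h.mem_left, hpB⟩).1 h.mem_right).2 h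

variable {Ω : Type*} {Ψ : Ω → Set (E d)}

/-- The event that the lattice point is not matched within distance `L` in a finite window, or is
the starting point of a long chain. -/
def badPoint (Ψ : Ω → Set (E d)) (L v : ℝ) (n : ℕ) (q : E d) : Set Ω :=
  {ω | MatchedWithin (Ψ ω ∩ Metric.closedBall q ((2 * n + 3) * L)) (integerLattice d) q L}ᶜ ∪
    {ω | LevelChain (Ψ ω) q L v n}

lemma measurableSet_badPoint (hΨ : ∀ ω, IsLocallyFinite (Ψ ω)) {L v : ℝ} (hL : 0 ≤ L) (n : ℕ)
    (q : E d) : MeasurableSet[countAlgebra Ψ (Metric.closedBall q ((2 * n + 3) * L))]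
      (badPoint Ψ L v n q) := by
  let _ := countAlgebra Ψ (Metric.closedBall q ((2 * n + 3) * L))
  refine MeasurableSet.union (MeasurableSet.compl ?_) (measurableSet_levelChain hL)
  exact (isMeasurableConfig_inter hΨ Metric.isClosed_closedBall.measurableSet
    ).measurableSet_matchedWithin countable_integerLattice q L

/-- Badness is decided by the process alone in a window. A good lattice point nevertheless stays
matched within `L` when finitely many points are added outside that window. -/
lemma matchedWithin_union_of_not_mem_badPoint (hΨ : ∀ ω, IsLocallyFinite (Ψ ω)) {L v : ℝ}
    (hL : 0 ≤ L) (hv : 0 < v) {n : ℕ} (hn : 0 < n) {q : E d} {ω : Ω}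
    (hω : ω ∉ badPoint Ψ L v n q) {F : Set (E d)} (hF : F.Finite)
    (hwf : WellFounded (Desc (Ψ ω ∪ F) (integerLattice d)))
    (hFq : Disjoint F (Metric.closedBall q ((2 * n + 3) * L))) :
    MatchedWithin (Ψ ω ∪ F) (integerLattice d) q L := by
  simp only [badPoint, Set.mem_union, Set.mem_compl_iff, not_or, not_not] at hω
  have heq : (Ψ ω ∪ F) ∩ Metric.closedBall q ((2 * n + 3) * L) =
      Ψ ω ∩ Metric.closedBall q ((2 * n + 3) * L) := by
    rw [Set.union_inter_distrib_right, hFq.inter_eq, Set.union_empty]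
  refine (matchedWithin_congr ((hΨ ω).union (isLocallyFinite_of_finite hF))
    ((hΨ ω).mono Set.inter_subset_left) hwf hL hn ?_ ?_).2 hω.1
  · rw [heq, Set.inter_assoc, Set.inter_self]
  · intro hl
    rw [heq] at hl
    exact hω.2 ((hl.mono Set.inter_subset_left).levelChain hv hn)

/-- Almost surely, without a long chain the window and the whole process agree on matching within
`L`. -/
lemma IsPoissonProcess.measure_badPoint_le [MeasurableSpace Ω] {P : Measure Ω} {α : ℝ}
    (hΨ : IsPoissonProcess P α Ψ) (hd : 1 ≤ d) (hα : 0 < α) {L v : ℝ} (hL : 0 ≤ L) (hv : 0 < v)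
    {n : ℕ} (hn : 0 < n) (q : E d) : P (badPoint Ψ L v n q) ≤
      P {ω | ¬ MatchedWithin (Ψ ω) (integerLattice d) q L} +
        P {ω | LevelChain (Ψ ω) q L v n} := by
  refine le_trans (measure_mono_ae ?_) (measure_union_le _ _)
  filter_upwards [hΨ.ae_wellFounded hd hα] with ω hwf hω
  rcases hω with hω | hω
  · by_cases hc : LevelChain (Ψ ω) q L v n
    · exact Or.inr hc
    · left
      intro hm
      refine hω ((matchedWithin_congr (hΨ.locallyFinite ω)
        ((hΨ.locallyFinite ω).mono Set.inter_subset_left) hwf hL hn ?_ ?_).1 hm)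
      · rw [Set.inter_assoc, Set.inter_self]
      · exact fun hl => hc ((hl.mono Set.inter_subset_left).levelChain hv hn)
  · exact Or.inr hω

open Classical in
/-- The event that a given proportion of the lattice points in a block is bad. -/
def badBlock (Ψ : Ω → Set (E d)) (L v : ℝ) (n k : ℕ) (δ : ℝ) (u : Fin d → ℤ) : Set Ω :=
  {ω | δ * (k : ℝ) ^ d ≤
    (((latticeBlock k 0 u).filter fun z => ω ∈ badPoint Ψ L v n (latticePoint z)).card : ℝ)}

/-- The region that determines whether a block is bad. -/
def blockRegion (d k : ℕ) (s : ℝ) (u : Fin d → ℤ) : Set (E d) :=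
  ⋃ z ∈ latticeBlock k 0 u, Metric.closedBall (latticePoint z) s

lemma measurableSet_blockRegion (k : ℕ) (s : ℝ) (u : Fin d → ℤ) :
    MeasurableSet (blockRegion d k s u) :=
  Finset.measurableSet_biUnion _ fun _ _ => Metric.isClosed_closedBall.measurableSet

lemma disjoint_blockRegion {k : ℕ} {s : ℝ} (hs : s ≤ k) {u u' : Fin d → ℤ} (hne : u ≠ u')
    (hcl : blockClass u = blockClass u') : Disjoint (blockRegion d k s u) (blockRegion d k s u') := by
  rw [Set.disjoint_left]
  intro x hx hx'
  obtain ⟨z, hz, hxz⟩ := Set.mem_iUnion₂.1 hx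
  obtain ⟨z', hz', hxz'⟩ := Set.mem_iUnion₂.1 hx'
  have h1 := lt_norm_sub_of_blockClass_eq hne hcl hz hz'
  rw [← dist_eq_norm] at h1
  rw [Metric.mem_closedBall] at hxz hxz'
  have h2 := dist_triangle_left (latticePoint z) (latticePoint z') x
  linarith

lemma measurableSet_badBlock (hΨ : ∀ ω, IsLocallyFinite (Ψ ω)) {L v : ℝ} (hL : 0 ≤ L) (n k : ℕ)
    (δ : ℝ) (u : Fin d → ℤ) :
    MeasurableSet[countAlgebra Ψ (blockRegion d k ((2 * n + 3) * L) u)]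
      (badBlock Ψ L v n k δ u) := by
  refine @measurableSet_card_filter_ge Ω _ (countAlgebra Ψ (blockRegion d k ((2 * n + 3) * L) u))
    _ _ (fun z hz => ?_) _
  refine countAlgebra_mono Metric.isClosed_closedBall.measurableSet ?_ _
    (measurableSet_badPoint hΨ hL n _)
  exact Set.subset_biUnion_of_mem (u := fun z => Metric.closedBall (latticePoint z) _)
    (Finset.mem_coe.2 hz)

-- A good block contributes at most `δ k ^ d` bad points and a bad one at most all its `k ^ d`
-- points.
open Classical in
lemma card_filter_badPoint_lt {L v δ b : ℝ} {n k : ℕ} (hk : 0 < k) (hδ : 0 ≤ δ) (x : E d) (ρ : ℝ)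
    {ω : Ω} (hω : (((blocksNear k x ρ).filter fun u => ω ∈ badBlock Ψ L v n k δ u).card : ℝ) < b) :
    (((latticeNear x ρ).filter fun z => ω ∈ badPoint Ψ L v n (latticePoint z)).card : ℝ) ≤
      (blocksNear k x ρ).card * (δ * (k : ℝ) ^ d) + b * (k : ℝ) ^ d := by
  set N : (Fin d → ℤ) → ℕ := fun u =>
    ((latticeBlock k 0 u).filter fun z => ω ∈ badPoint Ψ L v n (latticePoint z)).card with hN
  have h1 : (((latticeNear x ρ).filter fun z => ω ∈ badPoint Ψ L v n (latticePoint z)).card : ℝ) ≤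
      ∑ u ∈ blocksNear k x ρ, (N u : ℝ) := by
    have : ((latticeNear x ρ).filter fun z => ω ∈ badPoint Ψ L v n (latticePoint z)) ⊆
        (blocksNear k x ρ).biUnion fun u =>
          (latticeBlock k 0 u).filter fun z => ω ∈ badPoint Ψ L v n (latticePoint z) := by
      intro z hz
      obtain ⟨hz, hz'⟩ := Finset.mem_filter.1 hz
      exact Finset.mem_biUnion.2 ⟨_, Finset.mem_image_of_mem _ hz,
        Finset.mem_filter.2 ⟨(mem_latticeBlock_zero_iff hk).2 rfl, hz'⟩⟩
    exact_mod_cast (Finset.card_le_card this).trans Finset.card_biUnion_le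
  refine h1.trans ?_
  have h2 : ∀ u ∈ blocksNear k x ρ, (N u : ℝ) ≤ δ * (k : ℝ) ^ d +
      if ω ∈ badBlock Ψ L v n k δ u then (k : ℝ) ^ d else 0 := by
    intro u _
    split_ifs with h
    · have h3 : N u ≤ k ^ d := by
        refine (Finset.card_filter_le _ _).trans (le_of_eq ?_)
        rw [card_latticeBlock]; simp
      have h4 : (N u : ℝ) ≤ (k : ℝ) ^ d := by exact_mod_cast h3
      have : 0 ≤ δ * (k : ℝ) ^ d := by positivity
      linarith
    · have h3 : ¬ δ * (k : ℝ) ^ d ≤ (N u : ℝ) := h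
      linarith
  refine (Finset.sum_le_sum h2).trans ?_
  rw [Finset.sum_add_distrib, Finset.sum_const, nsmul_eq_mul, ← Finset.sum_filter, Finset.sum_const,
    nsmul_eq_mul]
  gcongr

open Classical in
/-- If a lattice point is not matched within distance `ρ` although there are sufficiently many
points around it, then there are many bad points. -/
lemma le_card_filter_badPoint (hΨ : ∀ ω, IsLocallyFinite (Ψ ω)) {α β : ℝ}
    (hβ : (1 + β) ^ d ≤ (1 + α) / 2) {L v : ℝ}
    (hL : 0 ≤ L) (hv : 0 < v) {n : ℕ} (hn : 0 < n) {F : Finset (E d)} (hF : F.card ≤ 2)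
    {z : Fin d → ℤ} {ρ : ℝ} (hρ : 0 ≤ ρ) (hLρ : L + √d ≤ β * ρ) {ω : Ω}
    (hwf : WellFounded (Desc (Ψ ω ∪ F) (integerLattice d)))
    (hno : ¬ MatchedWithin (Ψ ω ∪ F) (integerLattice d) (latticePoint z) ρ)
    (hcount : (1 + 3 * α) / 4 * (unitBallVolume d * ρ ^ d) ≤
      ((Ψ ω ∩ Metric.closedBall (latticePoint z) ρ).ncard : ℝ)) :
    unitBallVolume d * (α - 1) / 4 * ρ ^ d ≤
      (((latticeNear (latticePoint z) (2 * ρ)).filter fun w =>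
        ω ∈ badPoint Ψ L v n (latticePoint w)).card : ℝ) +
      2 * (unitBallVolume d * ((2 * n + 3) * L + √d) ^ d) := by
  have hφ : IsLocallyFinite (Ψ ω ∪ F) := (hΨ ω).union (isLocallyFinite_of_finite F.finite_toSet)
  have h1 := le_ncard_of_not_matchedWithin hφ hβ hwf (latticePoint_mem z) hρ hL hLρ hno (by
    refine hcount.trans ?_
    have := Set.ncard_le_ncard (Set.inter_subset_inter_left
      (Metric.closedBall (latticePoint z) ρ) (Set.subset_union_left (s := Ψ ω) (t := (F : Set (E d)))))
      (hφ _ Metric.isBounded_closedBall)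
    exact_mod_cast this)
  rw [ncard_eq_card_filter_latticeNear] at h1
  refine h1.trans ?_
  have hs : 0 ≤ (2 * n + 3) * L := by positivity
  -- A lattice point not matched within `L` is bad unless a point of `F` lies in its window; at most
  -- two balls of lattice points are affected in this way.
  have h2 : ((latticeNear (latticePoint z) (2 * ρ)).filter fun w =>
      MatchedWithin (Ψ ω ∪ F) (integerLattice d) (latticePoint w) ρ ∧
        ¬ MatchedWithin (Ψ ω ∪ F) (integerLattice d) (latticePoint w) L) ⊆
      ((latticeNear (latticePoint z) (2 * ρ)).filter fun w =>
        ω ∈ badPoint Ψ L v n (latticePoint w)) ∪ F.biUnion fun f => latticeNear f ((2 * n + 3) * L) := by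
    intro w hw
    obtain ⟨hw, -, hw'⟩ := Finset.mem_filter.1 hw
    by_cases hb : ω ∈ badPoint Ψ L v n (latticePoint w)
    · exact Finset.mem_union_left _ (Finset.mem_filter.2 ⟨hw, hb⟩)
    · refine Finset.mem_union_right _ (Finset.mem_biUnion.2 ?_)
      by_contra! hfar
      refine hw' (matchedWithin_union_of_not_mem_badPoint hΨ hL hv hn hb F.finite_toSet hwf ?_)
      rw [Set.disjoint_left]
      intro f hf hfB
      refine hfar f hf (mem_latticeNear.2 ?_)
      rw [Metric.mem_closedBall, dist_eq_norm] at hfB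
      rwa [norm_sub_rev]
  have h3 := (Finset.card_le_card h2).trans (Finset.card_union_le _ _)
  have h4 : ((F.biUnion fun f => latticeNear f ((2 * n + 3) * L)).card : ℝ) ≤
      2 * (unitBallVolume d * ((2 * n + 3) * L + √d) ^ d) := by
    calc ((F.biUnion fun f => latticeNear f ((2 * n + 3) * L)).card : ℝ)
        ≤ ∑ f ∈ F, ((latticeNear f ((2 * n + 3) * L)).card : ℝ) := by
          exact_mod_cast Finset.card_biUnion_le
      _ ≤ F.card • (unitBallVolume d * ((2 * n + 3) * L + √d) ^ d) :=
          Finset.sum_le_card_nsmul _ _ _ fun f _ => card_latticeNear_le f hs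
      _ ≤ _ := by
          have := unitBallVolume_pos d
          rw [nsmul_eq_mul]
          gcongr
          exact_mod_cast hF
  have h5 : (((latticeNear (latticePoint z) (2 * ρ)).filter fun w =>
      MatchedWithin (Ψ ω ∪ F) (integerLattice d) (latticePoint w) ρ ∧
        ¬ MatchedWithin (Ψ ω ∪ F) (integerLattice d) (latticePoint w) L).card : ℝ) ≤
      ((latticeNear (latticePoint z) (2 * ρ)).filter fun w =>
        ω ∈ badPoint Ψ L v n (latticePoint w)).card +
      (F.biUnion fun f => latticeNear f ((2 * n + 3) * L)).card := by exact_mod_cast h3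
  refine le_trans (le_of_eq ?_) (h5.trans (add_le_add_right h4 _))
  congr!

end BadPoints

/-! ### Exponential tail of the matching distance of a lattice point -/

section Tail

variable {d : ℕ}

-- Markov's inequality: the expected number of bad points is at most `2 ε k ^ d`, one `ε` each for
-- failed matchings and for long chains.
open Classical in
lemma IsPoissonProcess.measure_badBlock_le {Ω : Type*} [MeasurableSpace Ω] {P : Measure Ω}
    [IsProbabilityMeasure P] {α : ℝ} {Ψ : Ω → Set (E d)}
    (hΨ : IsPoissonProcess P α Ψ) (hd : 1 ≤ d) (hα : 0 < α) {L v ε δ : ℝ} (hL : 0 ≤ L) (hv : 0 < v)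
    (hε : 0 ≤ ε) (hδ : 0 < δ) {n k : ℕ} (hn : 0 < n) (hk : 0 < k) (u : Fin d → ℤ)
    (h1 : ∑ z ∈ latticeBlock k 0 u,
      P.real {ω | ¬ MatchedWithin (Ψ ω) (integerLattice d) (latticePoint z) L} ≤ ε * (k : ℝ) ^ d)
    (h2 : ∀ z, P {ω | LevelChain (Ψ ω) z L v n} ≤ ENNReal.ofReal ε) :
    P (badBlock Ψ L v n k δ u) ≤ ENNReal.ofReal (2 * ε / δ) := by
  have hkd : 0 < (k : ℝ) ^ d := by positivity
  have hm : ∀ z, MeasurableSet (badPoint Ψ L v n (latticePoint z : E d)) := fun z =>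
    countAlgebra_le hΨ.isMeasurableConfig Metric.isClosed_closedBall.measurableSet _
      (measurableSet_badPoint hΨ.locallyFinite hL n _)
  refine (measure_card_filter_ge_le P (latticeBlock k 0 u) hm (mul_pos hδ hkd)).trans ?_
  have hsum : ∑ z ∈ latticeBlock k 0 u, P (badPoint Ψ L v n (latticePoint z)) ≤
      ENNReal.ofReal (2 * ε * (k : ℝ) ^ d) := by
    calc _ ≤ ∑ z ∈ latticeBlock k 0 u,
          (ENNReal.ofReal (P.real {ω | ¬ MatchedWithin (Ψ ω) (integerLattice d) (latticePoint z) L}) +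
            ENNReal.ofReal ε) := by
          refine Finset.sum_le_sum fun z _ => ?_
          rw [ofReal_measureReal]
          exact (hΨ.measure_badPoint_le hd hα hL hv hn _).trans (add_le_add_right (h2 _) _)
      _ = ENNReal.ofReal (∑ z ∈ latticeBlock k 0 u,
          (P.real {ω | ¬ MatchedWithin (Ψ ω) (integerLattice d) (latticePoint z) L} + ε)) := by
          rw [ENNReal.ofReal_sum_of_nonneg fun _ _ => add_nonneg measureReal_nonneg hε]
          exact Finset.sum_congr rfl fun z _ => (ENNReal.ofReal_add measureReal_nonneg hε).symm
      _ ≤ _ := by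
          refine ENNReal.ofReal_le_ofReal ?_
          rw [Finset.sum_add_distrib, Finset.sum_const, card_latticeBlock, nsmul_eq_mul]
          push_cast
          simp only [add_zero]
          linarith
  refine (ENNReal.div_le_div_right hsum _).trans ?_
  rw [← ENNReal.ofReal_div_of_pos (mul_pos hδ hkd)]
  refine ENNReal.ofReal_le_ofReal (le_of_eq ?_)
  field_simp

open Classical in
lemma IsPoissonProcess.measure_card_badBlock_ge_le {Ω : Type*} [MeasurableSpace Ω] {P : Measure Ω}
    [IsProbabilityMeasure P] {α : ℝ} {Ψ : Ω → Set (E d)}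
    (hΨ : IsPoissonProcess P α Ψ) {L v δ Λ b : ℝ} (hL : 0 ≤ L) (hΛ : 0 ≤ Λ) {n k : ℕ}
    (hk : (2 * n + 3) * L ≤ k)
    (h : ∀ u, P (badBlock Ψ L v n k δ u) ≤ ENNReal.ofReal (Real.exp (-Λ)))
    (U : Finset (Fin d → ℤ)) :
    P {ω | b ≤ ((U.filter fun u => ω ∈ badBlock Ψ L v n k δ u).card : ℝ)} ≤
      ENNReal.ofReal (2 ^ U.card * Real.exp (-(Λ * (b / 3 ^ d)))) := by
  have h1 := measure_card_filter_ge_le_of_classes (P := P) U (blockClass (d := d)) hΛ h (b := b) ?_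
  · have h2 : Fintype.card (Fin d → ZMod 3) = 3 ^ d := by
      rw [Fintype.card_fun, ZMod.card, Fintype.card_fin]
    rw [h2] at h1
    push_cast at h1
    exact h1
  · intro T _ hT
    refine hΨ.measure_biInter_eq_prod (measurableSet_blockRegion k ((2 * n + 3) * L))
      (measurableSet_badBlock hΨ.locallyFinite hL n k δ) T ?_
    intro u hu u' hu' hne
    exact disjoint_blockRegion hk hne (hT u hu u' hu')

/-- The matching distance of a lattice point has an exponential volume moment. -/
theorem exists_measure_not_matchedWithin_le (hd : 1 ≤ d) {α : ℝ} (hα : 1 < α) :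
    ∃ c : ℝ, 0 < c ∧ ∃ ρ₀ : ℝ, 1 ≤ ρ₀ ∧ ∀ {Ω : Type*} [MeasurableSpace Ω] {P : Measure Ω}
      [IsProbabilityMeasure P] {Ψ : Ω → Set (E d)}, IsPoissonProcess P α Ψ →
      ∀ F : Finset (E d), F.card ≤ 2 → ∀ (z : Fin d → ℤ) (ρ : ℝ), ρ₀ ≤ ρ →
        P {ω | ¬ MatchedWithin (Ψ ω ∪ F) (integerLattice d) (latticePoint z) ρ} ≤
          ENNReal.ofReal (2 * Real.exp (-(c * ρ ^ d))) := by
  classical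
  have hκ := unitBallVolume_pos d
  have hα1 : 0 < α - 1 := by linarith
  obtain ⟨β, hβ0, hβ⟩ := exists_pow_le hα d
  set κ := unitBallVolume d with hκdef
  set c₁ := κ * (α - 1) / 4 with hc₁
  have hc₁0 : 0 < c₁ := by positivity
  set C₂ := κ * 3 ^ d with hC₂
  have hC₂0 : 0 < C₂ := by positivity
  -- Failure at scale `ρ` forces about `c₁ ρ ^ d` bad points near `z`. The choices of `δ` and `η`
  -- let good and bad blocks each supply at most `c₁ / 8 * ρ ^ d` of them.
  set δ := c₁ / (8 * C₂) with hδ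
  have hδ0 : 0 < δ := by positivity
  set η := c₁ / 8 with hη
  have hη0 : 0 < η := by positivity
  -- The union bound costs `2 ^ (C₂ t)` subsets of blocks, with `t = ρ ^ d / k ^ d`; this choice
  -- beats it by `exp (-t)`. Then `ε` is such that `2 ε / δ = exp (-Λ)`.
  set Λ := (C₂ + 1) * 3 ^ d / η with hΛ
  have hΛ0 : 0 < Λ := by positivity
  set ε := δ * Real.exp (-Λ) / 2 with hε
  have hε0 : 0 < ε := by positivity
  obtain ⟨L, hL1, k₁, hstage⟩ := exists_sum_not_matchedWithin_le hd hα hε0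
  have hL0 : 0 ≤ L := by linarith
  obtain ⟨C, -, a, ha, hchain⟩ := exists_measure_levelChain_le hd (show 0 < α by linarith)
  set v := a / L ^ d with hv
  have hv0 : 0 < v := by positivity
  obtain ⟨n, hn1, hn2, hn3⟩ : ∃ n : ℕ, C * L ^ (2 * d) ≤ n ∧ Real.exp (-(n : ℝ)) ≤ ε ∧ 0 < n := by
    have h1 := (Real.tendsto_exp_neg_atTop_nhds_zero.comp
      (tendsto_natCast_atTop_atTop (R := ℝ))).eventually (gt_mem_nhds hε0)
    have h2 := (tendsto_natCast_atTop_atTop (R := ℝ)).eventually_ge_atTop (C * L ^ (2 * d))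
    obtain ⟨n, ⟨h1, h2⟩, h3⟩ := ((h1.and h2).and (Filter.eventually_gt_atTop 0)).exists
    exact ⟨n, h2, h1.le, h3⟩
  set s := (2 * (n : ℝ) + 3) * L with hs
  have hs0 : 0 ≤ s := by positivity
  -- The side is at least the window radius `s`, which makes blocks of one class independent, and at
  -- least `k₁`, where the averaged estimate starts.
  set k := max (max k₁ ⌈s⌉₊) 1 with hk
  have hk0 : 0 < k := lt_of_lt_of_le one_pos (le_max_right _ _)
  have hkk : k₁ ≤ k := (le_max_left _ _).trans (le_max_left _ _)
  have hks : s ≤ k := (Nat.le_ceil s).trans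
    (by exact_mod_cast (le_max_right k₁ ⌈s⌉₊).trans (le_max_left _ 1))
  have hkd : 0 < (k : ℝ) ^ d := by positivity
  set c₅ := ((α - 1) / (4 * α)) ^ 2 / 2 * α * κ with hc₅
  have hc₅0 : 0 < c₅ := by positivity
  set c := min c₅ (1 / (k : ℝ) ^ d) with hc
  have hc0 : 0 < c := lt_min hc₅0 (by positivity)
  -- The last two thresholds ensure that the blocks near `z` fit in a ball of radius `3 ρ`, and that
  -- the points affected by `F` number at most `c₁ / 2 * ρ ^ d`.
  obtain ⟨ρ₀, hρ₀⟩ := exists_gt (max (max 1 ((L + √d) / β))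
    (max ((k + 1) * √d) (2 * (κ * (s + √d) ^ d) / (c₁ / 2))))
  simp only [max_lt_iff] at hρ₀
  obtain ⟨⟨hρ₁, hρ₂⟩, hρ₃, hρ₄⟩ := hρ₀
  refine ⟨c, hc0, ρ₀, hρ₁.le, ?_⟩
  intro Ω _ P _ Ψ hΨ F hF z ρ hρ
  have hρ1 : 1 ≤ ρ := hρ₁.le.trans hρ
  have hρ0 : 0 ≤ ρ := by linarith
  have hρd : ρ ≤ ρ ^ d := le_self_pow₀ hρ1 (by lia)
  set t := ρ ^ d / (k : ℝ) ^ d with ht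
  have htpos : 0 < t := by positivity
  set x : E d := latticePoint z
  have hLρ : L + √d ≤ β * ρ := by
    rw [div_lt_iff₀ hβ0] at hρ₂
    nlinarith
  have hfew : 2 * (κ * (s + √d) ^ d) ≤ c₁ / 2 * ρ ^ d := by
    rw [div_lt_iff₀ (by positivity)] at hρ₄
    nlinarith
  have hU : ((blocksNear k x (2 * ρ)).card : ℝ) ≤ C₂ * t := by
    rw [ht, ← mul_div_assoc, le_div_iff₀ hkd]
    refine (card_blocksNear_le hk0 x (by linarith)).trans ?_
    rw [hC₂, mul_assoc, ← mul_pow]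
    have : (k + 1) * √d = k * √d + √d := by ring
    gcongr
    linarith
  have hbb : ∀ u, P (badBlock Ψ L v n k δ u) ≤ ENNReal.ofReal (Real.exp (-Λ)) := by
    intro u
    refine (hΨ.measure_badBlock_le hd (by linarith) hL0 hv0 hε0.le hδ0 hn3 hk0 u
      (hstage hΨ k hkk u) fun w => ?_).trans (ENNReal.ofReal_le_ofReal (le_of_eq ?_))
    · exact (hchain hΨ w L hL1 n hn1).trans (ENNReal.ofReal_le_ofReal hn2)
    · rw [hε]; field_simp
  have hmany := hΨ.measure_card_badBlock_ge_le hL0 hΛ0.le hks hbb (blocksNear k x (2 * ρ))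
    (b := η * t)
  have hmany' : (2 : ℝ) ^ (blocksNear k x (2 * ρ)).card * Real.exp (-(Λ * (η * t / 3 ^ d))) ≤
      Real.exp (-(c * ρ ^ d)) := by
    have h1 : (2 : ℝ) ^ (blocksNear k x (2 * ρ)).card ≤ Real.exp (C₂ * t) := by
      calc (2 : ℝ) ^ (blocksNear k x (2 * ρ)).card
          ≤ Real.exp 1 ^ (blocksNear k x (2 * ρ)).card := by
            gcongr
            linarith [Real.add_one_le_exp (1 : ℝ)]
        _ = Real.exp ((blocksNear k x (2 * ρ)).card) := by rw [← Real.exp_nat_mul, mul_one]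
        _ ≤ _ := Real.exp_le_exp.2 hU
    have h2 : Λ * (η * t / 3 ^ d) = (C₂ + 1) * t := by rw [hΛ]; field_simp
    rw [h2]
    refine (mul_le_mul_of_nonneg_right h1 (Real.exp_pos _).le).trans ?_
    rw [← Real.exp_add]
    refine Real.exp_le_exp.2 ?_
    have h3 : c * ρ ^ d ≤ t := by
      rw [ht, ← one_div_mul_eq_div]
      exact mul_le_mul_of_nonneg_right (min_le_right _ _) (by positivity)
    linarith
  have hlow := hΨ.measure_ncard_closedBall_le hα x hρ0
  have hlow' : Real.exp (-(c₅ * ρ ^ d)) ≤ Real.exp (-(c * ρ ^ d)) := by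
    refine Real.exp_le_exp.2 (neg_le_neg ?_)
    exact mul_le_mul_of_nonneg_right (min_le_left _ _) (by positivity)
  -- If both alternatives failed, there would be at most `c₁ / 4 * ρ ^ d` bad points and `c₁ / 2 * ρ
  -- ^ d` points affected by `F`, fewer than the `c₁ ρ ^ d` that are forced.
  have hsub : P {ω | ¬ MatchedWithin (Ψ ω ∪ F) (integerLattice d) x ρ} ≤
      P ({ω | ((Ψ ω ∩ Metric.closedBall x ρ).ncard : ℝ) ≤ (1 + 3 * α) / 4 * (κ * ρ ^ d)} ∪
        {ω | η * t ≤ (((blocksNear k x (2 * ρ)).filter fun u =>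
          ω ∈ badBlock Ψ L v n k δ u).card : ℝ)}) := by
    refine measure_mono_ae ?_
    filter_upwards [hΨ.ae_wellFounded hd (by linarith)] with ω hwf hω
    by_contra hnot
    obtain ⟨h1, h2⟩ := not_or.1 hnot
    have h1' : (1 + 3 * α) / 4 * (κ * ρ ^ d) <
      ((Ψ ω ∩ Metric.closedBall x ρ).ncard : ℝ) := not_le.1 h1
    have h2' : (((blocksNear k x (2 * ρ)).filter fun u =>
          ω ∈ badBlock Ψ L v n k δ u).card : ℝ) < η * t := not_le.1 h2
    have h3 := le_card_filter_badPoint hΨ.locallyFinite hβ hL0 hv0 hn3 hF hρ0 hLρ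
      (wellFounded_desc_union_finite isLocallyFinite_integerLattice hwf F.finite_toSet) hω h1'.le
    have h3' : c₁ * ρ ^ d ≤ (((latticeNear x (2 * ρ)).filter fun w =>
        ω ∈ badPoint Ψ L v n (latticePoint w)).card : ℝ) + 2 * (κ * (s + √d) ^ d) := h3
    have h4 := card_filter_badPoint_lt hk0 hδ0.le x (2 * ρ) h2'
    have h5 : ((blocksNear k x (2 * ρ)).card : ℝ) * (δ * (k : ℝ) ^ d) + η * t * (k : ℝ) ^ d ≤
        c₁ / 4 * ρ ^ d := by
      have h6 : ((blocksNear k x (2 * ρ)).card : ℝ) * (δ * (k : ℝ) ^ d) ≤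
          C₂ * t * (δ * (k : ℝ) ^ d) := by gcongr
      have h7 : C₂ * t * (δ * (k : ℝ) ^ d) = c₁ / 8 * ρ ^ d := by
        rw [ht, hδ]; field_simp
      have h8 : η * t * (k : ℝ) ^ d = c₁ / 8 * ρ ^ d := by
        rw [ht, hη]; field_simp
      linarith
    have h9 : 0 < c₁ * ρ ^ d := by positivity
    linarith
  refine hsub.trans ((measure_union_le _ _).trans ?_)
  rw [two_mul (Real.exp _), ENNReal.ofReal_add (Real.exp_pos _).le (Real.exp_pos _).le]
  exact add_le_add (hlow.trans (ENNReal.ofReal_le_ofReal hlow'))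
    (hmany.trans (ENNReal.ofReal_le_ofReal hmany'))

end Tail

/-! ### Locality of the matching status and decay of correlations -/

section Decorrelation

variable {d : ℕ}

/-- Half of the exponent absorbs the polynomial factor, and `(N + j) ^ d ≥ N ^ d + j` makes the rest
geometric in `j`. -/
lemma sum_shell_le {c : ℝ} (hc : 0 < c) (hd : 1 ≤ d) {N : ℕ} (hN : 1 ≤ N) (j : ℕ) :
    ((N + j + 1 : ℝ) + √d) ^ d * (2 * Real.exp (-(c * (N + j : ℝ) ^ d))) ≤
      (2 + √d) ^ d * (4 / c) * Real.exp (-(c / 2 * (N : ℝ) ^ d)) * Real.exp (-(c / 2)) ^ j := by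
  have hN1 : (1 : ℝ) ≤ N := by exact_mod_cast hN
  have hj : (0 : ℝ) ≤ j := Nat.cast_nonneg j
  have hsq : 0 ≤ √(d : ℝ) := Real.sqrt_nonneg _
  set t := (N + j : ℝ) ^ d with ht
  have h1 : ((N + j + 1 : ℝ) + √d) ^ d ≤ (2 + √d) ^ d * t := by
    rw [ht, ← mul_pow]
    gcongr
    nlinarith
  have h2 : (N : ℝ) ^ d + j ≤ t := by
    rw [ht]
    obtain ⟨e, rfl⟩ : ∃ e, d = e + 1 := ⟨d - 1, by lia⟩
    have h3 : (N : ℝ) ^ e ≤ (N + j : ℝ) ^ e := by gcongr; linarith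
    have h4 : (1 : ℝ) ≤ (N + j : ℝ) ^ e := one_le_pow₀ (by linarith)
    rw [pow_succ, pow_succ]
    nlinarith
  have h3 : t ≤ 2 / c * Real.exp (c / 2 * t) := by
    have := Real.add_one_le_exp (c / 2 * t)
    rw [div_mul_eq_mul_div, le_div_iff₀ hc]
    linarith
  have h4 : t * Real.exp (-(c * t)) ≤ 2 / c * Real.exp (-(c / 2 * t)) := by
    calc t * Real.exp (-(c * t)) ≤ 2 / c * Real.exp (c / 2 * t) * Real.exp (-(c * t)) := by gcongr
      _ = 2 / c * Real.exp (-(c / 2 * t)) := by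
        rw [mul_assoc, ← Real.exp_add]
        congr 2
        ring
  have h5 : Real.exp (-(c / 2 * t)) ≤
      Real.exp (-(c / 2 * (N : ℝ) ^ d)) * Real.exp (-(c / 2)) ^ j := by
    rw [← Real.exp_nat_mul, ← Real.exp_add]
    refine Real.exp_le_exp.2 ?_
    nlinarith
  calc _ ≤ (2 + √d) ^ d * t * (2 * Real.exp (-(c * t))) := by gcongr
    _ = 2 * (2 + √d) ^ d * (t * Real.exp (-(c * t))) := by ring
    _ ≤ 2 * (2 + √d) ^ d * (2 / c * (Real.exp (-(c / 2 * (N : ℝ) ^ d)) *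
        Real.exp (-(c / 2)) ^ j)) :=
      mul_le_mul_of_nonneg_left (h4.trans (by gcongr)) (by positivity)
    _ = _ := by ring

/-- The point `x` is matched to a lattice point at distance more than `R`. -/
def FarMatched (φ : Set (E d)) (x : E d) (R : ℝ) : Prop :=
  ∃ q, R < ‖x - q‖ ∧ IsMatchedPair φ (integerLattice d) x q

/-- The far partner of `x` lies in some unit shell. As `x` is its only partner, it is not matched
within the inner radius. -/
lemma FarMatched.exists_shell {φ : Set (E d)} {x : E d} {N : ℕ} (h : FarMatched φ x N) :
    ∃ j : ℕ, ∃ z ∈ latticeNear x (N + j + 1 : ℝ),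
      ¬ MatchedWithin φ (integerLattice d) (latticePoint z) (N + j : ℝ) := by
  obtain ⟨q, hq, hm⟩ := h
  obtain ⟨z, rfl⟩ := range_latticePoint (d := d) ▸ hm.mem_right
  set D := ‖x - latticePoint z‖ with hD
  have h1 : N < ⌈D⌉₊ := Nat.lt_ceil.2 hq
  obtain ⟨j, hj⟩ := Nat.exists_eq_add_of_lt h1
  refine ⟨j, z, ?_, ?_⟩
  · rw [mem_latticeNear, norm_sub_rev]
    have := Nat.le_ceil D
    rw [hj] at this
    exact_mod_cast this
  · rintro ⟨p, hp, hpm⟩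
    rw [hpm.left_unique hm] at hp
    have h2 : N + j < ⌈D⌉₊ := by lia
    have h3 := Nat.lt_ceil.1 h2
    push_cast at h3
    linarith

/-- This transfers the tail from lattice points to an arbitrary point `x`, by summing over the
shells in which its partner may lie. -/
theorem exists_measure_farMatched_le (hd : 1 ≤ d) {α : ℝ} (hα : 1 < α) :
    ∃ a : ℝ, 0 < a ∧ ∃ C : ℝ, 0 < C ∧ ∃ ρ₀ : ℝ, 1 ≤ ρ₀ ∧
      ∀ {Ω : Type*} [MeasurableSpace Ω] {P : Measure Ω}
      [IsProbabilityMeasure P] {Ψ : Ω → Set (E d)}, IsPoissonProcess P α Ψ →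
      ∀ F : Finset (E d), F.card ≤ 2 → ∀ (x : E d) (N : ℕ), ρ₀ ≤ N →
        P {ω | FarMatched (Ψ ω ∪ F) x N} ≤ ENNReal.ofReal (C * Real.exp (-(a * (N : ℝ) ^ d))) := by
  obtain ⟨c, hc, ρ₀, hρ₀, h⟩ := exists_measure_not_matchedWithin_le hd hα
  have hκ := unitBallVolume_pos d
  have hr1 : Real.exp (-(c / 2)) < 1 := Real.exp_zero ▸ Real.exp_lt_exp.2 (by linarith)
  have hr0 : 0 ≤ Real.exp (-(c / 2)) := (Real.exp_pos _).le
  have hr2 : 0 < (1 - Real.exp (-(c / 2)))⁻¹ := inv_pos.2 (by linarith)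
  set A := unitBallVolume d * ((2 + √d) ^ d * (4 / c)) with hA
  have hA0 : 0 < A := by positivity
  refine ⟨c / 2, by positivity, A * (1 - Real.exp (-(c / 2)))⁻¹, by positivity, ρ₀, hρ₀, ?_⟩
  intro Ω _ P _ Ψ hΨ F hF x N hN
  have hN1 : 1 ≤ N := by exact_mod_cast hρ₀.trans hN
  set B := A * Real.exp (-(c / 2 * (N : ℝ) ^ d)) with hB
  have hB0 : 0 ≤ B := by positivity
  have hshell : ∀ j : ℕ, P (⋃ z ∈ latticeNear x (N + j + 1 : ℝ),
      {ω | ¬ MatchedWithin (Ψ ω ∪ F) (integerLattice d) (latticePoint z) (N + j : ℝ)}) ≤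
        ENNReal.ofReal (B * Real.exp (-(c / 2)) ^ j) := by
    intro j
    have hj : (0 : ℝ) ≤ j := Nat.cast_nonneg j
    refine (measure_biUnion_finset_le _ _).trans ((Finset.sum_le_card_nsmul _ _ _
      fun z _ => h hΨ F hF z (N + j : ℝ) (by linarith)).trans ?_)
    rw [nsmul_eq_mul, ← ENNReal.ofReal_natCast, ← ENNReal.ofReal_mul (Nat.cast_nonneg _)]
    refine ENNReal.ofReal_le_ofReal ?_
    calc _ ≤ unitBallVolume d * ((N + j + 1 : ℝ) + √d) ^ d *
          (2 * Real.exp (-(c * (N + j : ℝ) ^ d))) := by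
          gcongr
          exact card_latticeNear_le x (by positivity)
      _ ≤ _ := by
          rw [mul_assoc, hB, hA]
          refine (mul_le_mul_of_nonneg_left (sum_shell_le hc hd hN1 j) hκ.le).trans (le_of_eq ?_)
          ring
  calc P {ω | FarMatched (Ψ ω ∪ F) x N} ≤ P (⋃ j : ℕ, ⋃ z ∈ latticeNear x (N + j + 1 : ℝ),
      {ω | ¬ MatchedWithin (Ψ ω ∪ F) (integerLattice d) (latticePoint z) (N + j : ℝ)}) := by
        refine measure_mono fun ω hω => ?_
        obtain ⟨j, z, hz, hm⟩ := FarMatched.exists_shell hω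
        exact Set.mem_iUnion.2 ⟨j, Set.mem_biUnion hz hm⟩
    _ ≤ ∑' j, ENNReal.ofReal (B * Real.exp (-(c / 2)) ^ j) :=
        (measure_iUnion_le _).trans (ENNReal.tsum_le_tsum hshell)
    _ = ENNReal.ofReal (∑' j, B * Real.exp (-(c / 2)) ^ j) :=
        (ENNReal.ofReal_tsum_of_nonneg (fun j => by positivity)
          ((summable_geometric_of_lt_one hr0 hr1).mul_left B)).symm
    _ = _ := by
        rw [tsum_mul_left, tsum_geometric_of_lt_one hr0 hr1, hB]
        congr 1
        ring

/-- The point `x` is matched within distance `R` when only the points within distance `s` of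
`x` are taken into account. -/
def LocallyMatched (φ : Set (E d)) (x : E d) (R s : ℝ) : Prop :=
  ∃ q ∈ integerLattice d, ‖x - q‖ ≤ R ∧
    IsMatchedPair ((φ ∩ Metric.closedBall x s) ∪ {x}) (integerLattice d) x q

lemma measurableSet_locallyMatched {Ω : Type*} [MeasurableSpace Ω] {Ψ : Ω → Set (E d)}
    (hΨ : ∀ ω, IsLocallyFinite (Ψ ω)) (x : E d) (R s : ℝ) :
    MeasurableSet[countAlgebra Ψ (Metric.closedBall x s)] {ω | LocallyMatched (Ψ ω) x R s} := by
  let _ := countAlgebra Ψ (Metric.closedBall x s)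
  have hm : IsMeasurableConfig fun ω => (Ψ ω ∩ Metric.closedBall x s) ∪ {x} :=
    (isMeasurableConfig_inter hΨ Metric.isClosed_closedBall.measurableSet).union_finite
      (Set.finite_singleton x)
  have : {ω | LocallyMatched (Ψ ω) x R s} = ⋃ q ∈ integerLattice d,
      ({_ω : Ω | ‖x - q‖ ≤ R} ∩ {ω | IsMatchedPair ((Ψ ω ∩ Metric.closedBall x s) ∪ {x})
        (integerLattice d) x q}) := by
    ext ω
    simp only [LocallyMatched, Set.mem_ofPred_eq, Set.mem_iUnion, Set.mem_inter_iff, exists_prop]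
  rw [this]
  exact MeasurableSet.biUnion countable_integerLattice fun q _ =>
    (MeasurableSet.const _).inter (hm.measurableSet_isMatchedPair countable_integerLattice x q)

/-- Without a far partner only lattice points within `R` matter, and without a long chain their
pairs with `x` are decided inside the window. The right side involves neither the other points of
`F` nor the process outside the ball. -/
lemma exists_isMatchedPair_iff_locallyMatched {φ F : Set (E d)} (hφ : IsLocallyFinite φ)
    (hwf : WellFounded (Desc φ (integerLattice d))) (hF : F.Finite) {x : E d} (hx : x ∈ F)
    {R v s : ℝ} (hR : 0 ≤ R) (hv : 0 < v) {n : ℕ} (hn : 0 < n) (hs : (2 * n + 3) * R ≤ s)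
    (hFs : ∀ y ∈ F, y ≠ x → s < ‖y - x‖) (hlev : ¬ LevelChain φ x R v n)
    (hfar : ¬ FarMatched (φ ∪ F) x R) :
    (∃ q, IsMatchedPair (φ ∪ F) (integerLattice d) x q) ↔ LocallyMatched φ x R s := by
  have key : ∀ q ∈ integerLattice d, ‖x - q‖ ≤ R →
      (IsMatchedPair (φ ∪ F) (integerLattice d) x q ↔
        IsMatchedPair ((φ ∩ Metric.closedBall x s) ∪ {x}) (integerLattice d) x q) := by
    intro q hq hxq
    refine isMatchedPair_inter_iff (e := (x, q)) (z := x) (R := R) (n := n) (s := s)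
      (hφ.union (isLocallyFinite_of_finite hF))
      ((hφ.mono Set.inter_subset_left).union (isLocallyFinite_of_finite (Set.finite_singleton x)))
      isLocallyFinite_integerLattice
      (wellFounded_desc_union_finite isLocallyFinite_integerLattice hwf hF) hn (Or.inr hx) hq hxq
      (by simpa using hR) (fun hch => hlev ((hch.mono ?_).levelChain hv hn)) hs ?_
    -- The chain omits `x` and stays within `2 R n ≤ s`, where there are no other points of `F`; so
    -- it is a chain of the process alone.
    · rintro y ⟨⟨hy | hy, hyx⟩, hyB⟩
      · exact hy
      · exfalso
        rw [Metric.mem_closedBall, dist_eq_norm] at hyB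
        have := hFs y hy hyx
        dsimp only at hyB
        nlinarith
    · ext y
      simp only [Set.mem_inter_iff, Set.mem_union, Set.mem_singleton_iff, Metric.mem_closedBall,
        dist_eq_norm]
      constructor
      · rintro ⟨hy | hy, hyB⟩
        · exact ⟨Or.inl ⟨hy, hyB⟩, hyB⟩
        · refine ⟨Or.inr ?_, hyB⟩
          by_contra hne
          exact absurd hyB (not_le.2 (hFs y hy hne))
      · rintro ⟨⟨hy, -⟩ | rfl, hyB⟩
        · exact ⟨Or.inl hy, hyB⟩
        · exact ⟨Or.inr hx, hyB⟩
  constructor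
  · rintro ⟨q, hq⟩
    have hxq : ‖x - q‖ ≤ R := not_lt.1 fun hlt => hfar ⟨q, hlt, hq⟩
    exact ⟨q, hq.mem_right, hxq, (key q hq.mem_right hxq).1 hq⟩
  · rintro ⟨q, hqZ, hxq, hq⟩
    exact ⟨q, (key q hqZ hxq).2 hq⟩

lemma IsPoissonProcess.measurableSet_exists_isMatchedPair {Ω : Type*} [MeasurableSpace Ω]
    {P : Measure Ω} {α : ℝ} {Ψ : Ω → Set (E d)} (hΨ : IsPoissonProcess P α Ψ)
    {F : Set (E d)} (hF : F.Finite) (x : E d) :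
    MeasurableSet {ω | ∃ q, IsMatchedPair (Ψ ω ∪ F) (integerLattice d) x q} := by
  have : {ω | ∃ q, IsMatchedPair (Ψ ω ∪ F) (integerLattice d) x q} =
      ⋃ q ∈ integerLattice d, {ω | IsMatchedPair (Ψ ω ∪ F) (integerLattice d) x q} := by
    ext ω
    simp only [Set.mem_ofPred_eq, Set.mem_iUnion, exists_prop]
    exact ⟨fun ⟨q, hq⟩ => ⟨q, hq.mem_right, hq⟩, fun ⟨q, _, hq⟩ => ⟨q, hq⟩⟩
  rw [this]
  exact MeasurableSet.biUnion countable_integerLattice fun q _ =>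
    (hΨ.isMeasurableConfig.union_finite hF).measurableSet_isMatchedPair
      countable_integerLattice x q

lemma matchingStatus_eq_indicator {Ω : Type*} {Ψ : Ω → Set (E d)} {F : Set (E d)} {x : E d} (hx : x ∈ F) (ω : Ω) :
    matchingStatus (Ψ ω ∪ F) (integerLattice d) x =
      {ω | ∃ q, IsMatchedPair (Ψ ω ∪ F) (integerLattice d) x q}.indicator 1 ω := by
  classical
  rw [matchingStatus_eq (Or.inr hx), Set.indicator_apply]
  simp only [Set.mem_ofPred_eq, Pi.one_apply]

lemma IsPoissonProcess.rhoOne_eq {Ω : Type*} [MeasurableSpace Ω] {P : Measure Ω} {α : ℝ}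
    {Ψ : Ω → Set (E d)} (hΨ : IsPoissonProcess P α Ψ) (x : E d) :
    rhoOne P α Ψ x =
      α * P.real {ω | ∃ q, IsMatchedPair (Ψ ω ∪ {x}) (integerLattice d) x q} := by
  rw [rhoOne]
  simp_rw [matchingStatus_eq_indicator (Ψ := Ψ) (Set.mem_singleton x)]
  rw [integral_indicator_one
    (hΨ.measurableSet_exists_isMatchedPair (Set.finite_singleton x) x)]

lemma IsPoissonProcess.rhoTwo_eq {Ω : Type*} [MeasurableSpace Ω] {P : Measure Ω} {α : ℝ}
    {Ψ : Ω → Set (E d)} (hΨ : IsPoissonProcess P α Ψ) (x y : E d) :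
    rhoTwo P α Ψ x y =
      α ^ 2 * P.real ({ω | ∃ q, IsMatchedPair (Ψ ω ∪ {x, y}) (integerLattice d) x q} ∩
        {ω | ∃ q, IsMatchedPair (Ψ ω ∪ {x, y}) (integerLattice d) y q}) := by
  have hfin : ({x, y} : Set (E d)).Finite := Set.toFinite _
  rw [rhoTwo]
  simp_rw [matchingStatus_eq_indicator (Ψ := Ψ) (show x ∈ ({x, y} : Set (E d)) by simp),
    matchingStatus_eq_indicator (Ψ := Ψ) (show y ∈ ({x, y} : Set (E d)) by simp)]
  rw [← integral_indicator_one ((hΨ.measurableSet_exists_isMatchedPair hfin x).inter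
    (hΨ.measurableSet_exists_isMatchedPair hfin y)), Set.inter_indicator_one]
  rfl

lemma abs_sub_mul_le_one {a b c : ℝ} (ha : 0 ≤ a) (ha1 : a ≤ 1) (hb : 0 ≤ b) (hb1 : b ≤ 1)
    (hc : 0 ≤ c) (hc1 : c ≤ 1) : |a - b * c| ≤ 1 := by
  have h1 := mul_nonneg hb hc
  have h2 := mul_le_one₀ hb1 hc hc1
  rw [abs_le]
  constructor <;> linarith

lemma abs_mul_sub_mul_le {a b a' b' δ : ℝ} (hb : 0 ≤ b) (hb1 : b ≤ 1) (ha' : 0 ≤ a')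
    (ha1' : a' ≤ 1) (ha : |a - a'| ≤ δ) (hbb : |b - b'| ≤ δ) : |a * b - a' * b'| ≤ 2 * δ := by
  have : a * b - a' * b' = (a - a') * b + a' * (b - b') := by ring
  rw [this]
  refine (abs_add_le _ _).trans ?_
  rw [abs_mul, abs_mul, abs_of_nonneg hb, abs_of_nonneg ha']
  have h1 : |a - a'| * b ≤ |a - a'| := mul_le_of_le_one_right (abs_nonneg _) hb1
  have h2 : a' * |b - b'| ≤ |b - b'| := mul_le_of_le_one_left (abs_nonneg _) ha1'
  linarith

section Probability

variable {Ω : Type*} [MeasurableSpace Ω] {P : Measure Ω} [IsProbabilityMeasure P]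

lemma abs_measureReal_sub_le_of_subset_union {S T D : Set Ω} {δ : ℝ} (h1 : S ⊆ T ∪ D)
    (h2 : T ⊆ S ∪ D) (hD : P.real D ≤ δ) : |P.real S - P.real T| ≤ δ := by
  have h3 := (measureReal_mono (μ := P) h1).trans (measureReal_union_le T D)
  have h4 := (measureReal_mono (μ := P) h2).trans (measureReal_union_le S D)
  rw [abs_sub_le_iff]
  constructor <;> linarith

/-- Two pairs of events that are approximated by the same pair of independent events. -/
lemma abs_measureReal_inter_sub_mul_le {A B A' B' X Y D₁ D₂ D₃ D₄ : Set Ω} {δ : ℝ}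
    (hXY : P.real (X ∩ Y) = P.real X * P.real Y)
    (hA : ∀ ω, ω ∉ D₁ → (ω ∈ A ↔ ω ∈ X)) (hB : ∀ ω, ω ∉ D₂ → (ω ∈ B ↔ ω ∈ Y))
    (hA' : ∀ ω, ω ∉ D₃ → (ω ∈ A' ↔ ω ∈ X)) (hB' : ∀ ω, ω ∉ D₄ → (ω ∈ B' ↔ ω ∈ Y))
    (h₁ : P.real D₁ ≤ δ) (h₂ : P.real D₂ ≤ δ) (h₃ : P.real D₃ ≤ δ) (h₄ : P.real D₄ ≤ δ) :
    |P.real (A ∩ B) - P.real A' * P.real B'| ≤ 4 * δ := by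
  have e1 : |P.real (A ∩ B) - P.real (X ∩ Y)| ≤ 2 * δ := by
    refine abs_measureReal_sub_le_of_subset_union (D := D₁ ∪ D₂) (fun ω h => ?_) (fun ω h => ?_)
      ((measureReal_union_le _ _).trans (by linarith))
    · by_cases hD : ω ∈ D₁ ∪ D₂
      · exact Or.inr hD
      · rw [Set.mem_union, not_or] at hD
        exact Or.inl ⟨(hA ω hD.1).1 h.1, (hB ω hD.2).1 h.2⟩
    · by_cases hD : ω ∈ D₁ ∪ D₂
      · exact Or.inr hD
      · rw [Set.mem_union, not_or] at hD
        exact Or.inl ⟨(hA ω hD.1).2 h.1, (hB ω hD.2).2 h.2⟩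
  have aux : ∀ {S T D : Set Ω}, (∀ ω, ω ∉ D → (ω ∈ S ↔ ω ∈ T)) → P.real D ≤ δ →
      |P.real T - P.real S| ≤ δ := by
    intro S T D h hD
    refine abs_measureReal_sub_le_of_subset_union (D := D) (fun ω hω => ?_) (fun ω hω => ?_) hD
    · exact or_iff_not_imp_right.2 fun hn => (h ω hn).2 hω
    · exact or_iff_not_imp_right.2 fun hn => (h ω hn).1 hω
  have e2 := abs_mul_sub_mul_le measureReal_nonneg measureReal_le_one measureReal_nonneg
    measureReal_le_one (aux hA' h₃) (aux hB' h₄)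
  rw [← hXY] at e2
  have := abs_sub_le (P.real (A ∩ B)) (P.real (X ∩ Y)) (P.real A' * P.real B')
  linarith

end Probability

/-- The same two local events approximate the statuses both with `{x, y}` added and with one point
added. Their windows are disjoint, so they are independent and all four approximations cost at most
`δ` each. -/
theorem exists_abs_rhoTwo_sub_le (hd : 1 ≤ d) {α : ℝ} (hα : 1 < α) :
    ∃ a : ℝ, 0 < a ∧ ∃ K : ℝ, 0 < K ∧ ∃ C : ℝ, 1 ≤ C ∧ ∃ ρ₀ : ℝ, 1 ≤ ρ₀ ∧
      ∀ {Ω : Type*} [MeasurableSpace Ω] {P : Measure Ω} [IsProbabilityMeasure P]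
        {Ψ : Ω → Set (E d)}, IsPoissonProcess P α Ψ → ∀ (x y : E d) (N : ℕ), ρ₀ ≤ N →
        14 * C * (N : ℝ) ^ (2 * d + 1) < ‖x - y‖ →
        |rhoTwo P α Ψ x y - rhoOne P α Ψ x * rhoOne P α Ψ y| ≤
          K * Real.exp (-(a * (N : ℝ) ^ d)) := by
  classical
  have hα0 : 0 < α := by linarith
  obtain ⟨a, ha, C', hC', ρ₀, hρ₀, hfar⟩ := exists_measure_farMatched_le hd hα
  obtain ⟨C, hC, c, hc, hlev⟩ := exists_measure_levelChain_le hd hα0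
  -- The minimum with `1` accommodates the chain error `exp (-n)`, where `n ≥ N ^ d`.
  refine ⟨min a 1, by positivity, α ^ 2 * (4 * (1 + C')), by positivity, C, hC, ρ₀, hρ₀, ?_⟩
  intro Ω _ P _ Ψ hΨ x y N hN hxy
  have hN1 : (1 : ℝ) ≤ N := hρ₀.trans hN
  have hN0 : (0 : ℝ) < N := by linarith
  have hpow : (1 : ℝ) ≤ (N : ℝ) ^ (2 * d) := one_le_pow₀ hN1
  have hCN : 1 ≤ C * (N : ℝ) ^ (2 * d) := by nlinarith
  set n := ⌈C * (N : ℝ) ^ (2 * d)⌉₊ with hn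
  have hn0 : 0 < n := Nat.ceil_pos.2 (by linarith)
  have hnle : C * (N : ℝ) ^ (2 * d) ≤ n := Nat.le_ceil _
  have hnlt : (n : ℝ) < C * (N : ℝ) ^ (2 * d) + 1 := Nat.ceil_lt_add_one (by linarith)
  set s := (2 * (n : ℝ) + 3) * N with hs
  -- With `A = C N ^ (2 d) ≥ 1` and `n < A + 1`, one has `2 (2 n + 3) < 4 A + 10 ≤ 14 A`; this is
  -- the source of the `14`.
  have hsxy : 2 * s < ‖x - y‖ := by
    refine lt_of_le_of_lt ?_ hxy
    rw [hs, pow_succ]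
    nlinarith
  have hs0 : 0 ≤ s := by positivity
  set v := c / (N : ℝ) ^ d
  have hv : 0 < v := by positivity
  set δ := (1 + C') * Real.exp (-(min a 1 * (N : ℝ) ^ d)) with hδ
  let D : E d → Finset (E d) → Set Ω := fun w F =>
    {ω | ¬ WellFounded (Desc (Ψ ω) (integerLattice d))} ∪
      ({ω | LevelChain (Ψ ω) w N v n} ∪ {ω | FarMatched (Ψ ω ∪ F) w N})
  have hD : ∀ (w : E d) (F : Finset (E d)), F.card ≤ 2 → P.real (D w F) ≤ δ := by
    intro w F hF
    have h0 : P.real {ω | ¬ WellFounded (Desc (Ψ ω) (integerLattice d))} = 0 := by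
      rw [measureReal_def, ae_iff.1 (hΨ.ae_wellFounded hd hα0), ENNReal.toReal_zero]
    have h1 : P.real {ω | LevelChain (Ψ ω) w N v n} ≤ Real.exp (-(min a 1 * (N : ℝ) ^ d)) := by
      refine (ENNReal.toReal_le_of_le_ofReal (Real.exp_pos _).le
        (hlev hΨ w N hN1 n hnle)).trans (Real.exp_le_exp.2 (neg_le_neg ?_))
      have h2 : (N : ℝ) ^ d ≤ (N : ℝ) ^ (2 * d) := pow_le_pow_right₀ hN1 (by lia)
      have h3 : min a 1 * (N : ℝ) ^ d ≤ 1 * (N : ℝ) ^ d := by gcongr; exact min_le_right _ _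
      nlinarith
    have h2 : P.real {ω | FarMatched (Ψ ω ∪ F) w N} ≤
        C' * Real.exp (-(min a 1 * (N : ℝ) ^ d)) := by
      refine (ENNReal.toReal_le_of_le_ofReal (by positivity)
        (hfar hΨ F hF w N hN)).trans ?_
      gcongr
      exact min_le_left _ _
    calc P.real (D w F) ≤ _ := (measureReal_union_le _ _).trans
          (add_le_add le_rfl (measureReal_union_le _ _))
      _ ≤ δ := by rw [h0, hδ]; linarith
  have hloc : ∀ (w : E d) (F : Finset (E d)), w ∈ F → (∀ u ∈ F, u ≠ w → s < ‖u - w‖) →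
      ∀ ω, ω ∉ D w F → (ω ∈ {ω | ∃ q, IsMatchedPair (Ψ ω ∪ F) (integerLattice d) w q} ↔
        ω ∈ {ω | LocallyMatched (Ψ ω) w N s}) := by
    intro w F hw hF ω hω
    simp only [D, Set.mem_union, not_or, Set.mem_ofPred_eq, not_not] at hω
    exact exists_isMatchedPair_iff_locallyMatched (hΨ.locallyFinite ω) hω.1 F.finite_toSet hw
      hN0.le hv hn0 le_rfl hF hω.2.1 hω.2.2
  have hdisj : Disjoint (Metric.closedBall x s) (Metric.closedBall y s) :=
    Metric.closedBall_disjoint_closedBall (by rw [dist_eq_norm]; linarith)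
  have hind : P.real ({ω | LocallyMatched (Ψ ω) x N s} ∩ {ω | LocallyMatched (Ψ ω) y N s}) =
      P.real {ω | LocallyMatched (Ψ ω) x N s} * P.real {ω | LocallyMatched (Ψ ω) y N s} := by
    simp only [measureReal_def]
    rw [(Indep_iff _ _ _).1 (hΨ.indep_countAlgebra Metric.isClosed_closedBall.measurableSet
      Metric.isClosed_closedBall.measurableSet hdisj) _ _
      (measurableSet_locallyMatched hΨ.locallyFinite x N s)
      (measurableSet_locallyMatched hΨ.locallyFinite y N s), ENNReal.toReal_mul]
  have hyx : s < ‖y - x‖ := by rw [norm_sub_rev]; linarith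
  have hxy' : s < ‖x - y‖ := by linarith
  have hmain := abs_measureReal_inter_sub_mul_le hind
    (hloc x {x, y} (by simp) (by
      intro u hu hne
      rcases Finset.mem_insert.1 hu with rfl | hu
      · exact absurd rfl hne
      · rw [Finset.mem_singleton.1 hu]; exact hyx))
    (hloc y {x, y} (by simp) (by
      intro u hu hne
      rcases Finset.mem_insert.1 hu with rfl | hu
      · exact hxy'
      · exact absurd (Finset.mem_singleton.1 hu) hne))
    (hloc x {x} (by simp) (by
      intro u hu hne; exact absurd (Finset.mem_singleton.1 hu) hne))
    (hloc y {y} (by simp) (by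
      intro u hu hne; exact absurd (Finset.mem_singleton.1 hu) hne))
    (hD x {x, y} Finset.card_le_two) (hD y {x, y} Finset.card_le_two)
    (hD x {x} (by simp)) (hD y {y} (by simp))
  simp only [Finset.coe_insert, Finset.coe_singleton] at hmain
  rw [hΨ.rhoTwo_eq, hΨ.rhoOne_eq, hΨ.rhoOne_eq]
  rw [show ∀ u v w : ℝ, α ^ 2 * u - α * v * (α * w) = α ^ 2 * (u - v * w) by intros; ring,
    abs_mul, abs_of_nonneg (by positivity : 0 ≤ α ^ 2)]
  calc _ ≤ α ^ 2 * (4 * δ) := by gcongr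
    _ = _ := by rw [hδ]; ring

lemma IsPoissonProcess.abs_rhoTwo_sub_le {Ω : Type*} [MeasurableSpace Ω] {P : Measure Ω}
    [IsProbabilityMeasure P] {α : ℝ} {Ψ : Ω → Set (E d)} (hΨ : IsPoissonProcess P α Ψ)
    (x y : E d) : |rhoTwo P α Ψ x y - rhoOne P α Ψ x * rhoOne P α Ψ y| ≤ α ^ 2 := by
  rw [hΨ.rhoTwo_eq, hΨ.rhoOne_eq, hΨ.rhoOne_eq]
  rw [show ∀ u v w : ℝ, α ^ 2 * u - α * v * (α * w) = α ^ 2 * (u - v * w) by intros; ring,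
    abs_mul, abs_of_nonneg (by positivity : 0 ≤ α ^ 2)]
  exact mul_le_of_le_one_right (by positivity) (abs_sub_mul_le_one measureReal_nonneg
    measureReal_le_one measureReal_nonneg measureReal_le_one measureReal_nonneg measureReal_le_one)

end Decorrelation

/-- The constant `a₁` depends only on the dimension `d` and the intensity `α`. -/
theorem proposition8p2 (d : ℕ) (hd : 1 ≤ d) (α : ℝ) (hα : 1 < α) :
    ∃ a₁ : ℝ, 0 < a₁ ∧
      ∀ (Ω : Type*) [MeasurableSpace Ω] (P : Measure Ω) [IsProbabilityMeasure P]
        (Ψ : Ω → Set (E d)), IsPoissonProcess P α Ψ →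
        ∀ x y : E d,
          |rhoTwo P α Ψ x y - rhoOne P α Ψ x * rhoOne P α Ψ y| ≤
            a₁ * Real.exp (-(a₁⁻¹ * ‖x - y‖ ^ ((d : ℝ) / (2 * (d : ℝ) + 1)))) := by
  obtain ⟨a, ha, K, hK, C, hC, ρ₀, hρ₀, h⟩ := exists_abs_rhoTwo_sub_le hd hα
  -- Any value with `14 C c < 1` would separate the windows.
  set c := 1 / (15 * C) with hc
  have hc0 : 0 < c := by positivity
  have hc1 : c ≤ 1 := by rw [hc, div_le_one (by positivity)]; linarith
  -- Rounding `c u` down to `N` costs at most a factor two, as `c u ≥ 2`.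
  set b := a * (c / 2) ^ d with hb
  have hb0 : 0 < b := by positivity
  set T₀ := (2 * ρ₀ / c) ^ d with hT₀
  -- The summands dominate, in turn, the prefactor at large distance, the inverse rate, and the
  -- trivial bound `α ^ 2` in the range `u ^ d ≤ T₀`.
  set a₁ := K + 1 / b + α ^ 2 * Real.exp (b * T₀) with ha₁
  have hKa : K ≤ a₁ := by
    rw [ha₁, add_assoc]; exact le_add_of_nonneg_right (by positivity)
  have hαa : α ^ 2 * Real.exp (b * T₀) ≤ a₁ := by
    rw [ha₁]; exact le_add_of_nonneg_left (by positivity)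
  have hba : 1 / b ≤ a₁ := by
    rw [ha₁, add_right_comm]; exact le_add_of_nonneg_left (by positivity)
  have ha₁0 : 0 < a₁ := lt_of_lt_of_le hK hKa
  have hinv : a₁⁻¹ ≤ b := by
    rw [one_div] at hba
    exact inv_le_of_inv_le₀ hb0 hba
  refine ⟨a₁, ha₁0, ?_⟩
  intro Ω _ P _ Ψ hΨ x y
  set r := ‖x - y‖ with hr
  have hr0 : 0 ≤ r := norm_nonneg _
  -- The scale for which the window radius, of order `u ^ (2 d + 1)`, matches the distance `r`.
  set u := r ^ (1 / (2 * (d : ℝ) + 1)) with hu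
  have hu0 : 0 ≤ u := Real.rpow_nonneg hr0 _
  have hT : r ^ ((d : ℝ) / (2 * (d : ℝ) + 1)) = u ^ d := by
    rw [hu, ← Real.rpow_natCast, ← Real.rpow_mul hr0]
    congr 1
    ring
  have hur : u ^ (2 * d + 1) = r := by
    rw [hu, ← Real.rpow_natCast, ← Real.rpow_mul hr0]
    push_cast
    rw [one_div_mul_cancel (by positivity), Real.rpow_one]
  rw [hT]
  have hexp : Real.exp (-(b * u ^ d)) ≤ Real.exp (-(a₁⁻¹ * u ^ d)) :=
    Real.exp_le_exp.2 (neg_le_neg (mul_le_mul_of_nonneg_right hinv (by positivity)))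
  rcases le_or_gt (2 * ρ₀) (c * u) with hbig | hsmall
  · set N := ⌊c * u⌋₊ with hN
    have hNle : (N : ℝ) ≤ c * u := Nat.floor_le (by positivity)
    have hNge : c / 2 * u ≤ N := by
      have := Nat.lt_floor_add_one (c * u)
      rw [← hN] at this
      linarith
    have hupos : 0 < u := by
      rcases hu0.eq_or_lt with h0 | h0
      · rw [← h0] at hbig; linarith
      · exact h0
    have hrpos : 0 < r := by rw [← hur]; positivity
    have hsep : 14 * C * (N : ℝ) ^ (2 * d + 1) < r := by
      have h1 : (N : ℝ) ^ (2 * d + 1) ≤ c * r := by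
        calc (N : ℝ) ^ (2 * d + 1) ≤ (c * u) ^ (2 * d + 1) := by gcongr
          _ = c ^ (2 * d + 1) * r := by rw [mul_pow, hur]
          _ ≤ c * r := by
            gcongr
            exact pow_le_of_le_one hc0.le hc1 (by lia)
      have h2 : 14 * C * (c * r) = 14 / 15 * r := by
        rw [hc]; field_simp
      have h3 : 14 * C * (N : ℝ) ^ (2 * d + 1) ≤ 14 * C * (c * r) := by gcongr
      linarith
    refine (h hΨ x y N (by linarith) hsep).trans ?_
    have h4 : Real.exp (-(a * (N : ℝ) ^ d)) ≤ Real.exp (-(b * u ^ d)) := by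
      refine Real.exp_le_exp.2 (neg_le_neg ?_)
      rw [hb, mul_assoc, ← mul_pow]
      gcongr
    exact mul_le_mul hKa (h4.trans hexp) (Real.exp_pos _).le ha₁0.le
  · have h1 : u ^ d ≤ T₀ := by
      rw [hT₀]
      have : u ≤ 2 * ρ₀ / c := by rw [le_div_iff₀ hc0]; linarith
      gcongr
    refine (hΨ.abs_rhoTwo_sub_le x y).trans ?_
    calc α ^ 2 = α ^ 2 * Real.exp (b * T₀) * Real.exp (-(b * T₀)) := by
          rw [mul_assoc, ← Real.exp_add, add_neg_cancel, Real.exp_zero, mul_one]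
      _ ≤ a₁ * Real.exp (-(a₁⁻¹ * u ^ d)) := by
          refine mul_le_mul hαa (le_trans ?_ hexp) (Real.exp_pos _).le ha₁0.le
          refine Real.exp_le_exp.2 (neg_le_neg ?_)
          gcongr
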